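/- Let $k$ be a field of characteristic zero. For a Hopf algebra $A$ over $k$ let $\mathrm{Aut}_{\mathrm{Hopf}}(A)$ be its group of Hopf algebra automorphisms. For a Hopf algebra $A$ and group-like $g\in A$, an element $y$ is called $(g,1)$-primitive if $\Delta(y)=y\otimes g+1\otimes y$. For $m,n\ge 2$, a primitive $m$-th root of unity $q\in k$, a primitive $n$-th root of unity $\overline q\in k$ and $\sigma\in k$ with $\sigma^{\gcd(m,n)}=1$, let $\mathrm T^{\sigma}_{n,m}(\overline q,q)$ be the Hopf algebra generated by $h,x,H,X$ subject to $$h^m=H^n=1,\quad x^m=X^n=0,\quad xh=q\,hx,\quad XH=\overline q\,HX,$$ $$xH=\sigma Hx,\quad hX=\sigma Xh,\quad xX=\sigma Xx,\quad hH=Hh,$$ where $h,H$ are group-like, $x$ is $(h,1)$-primitive and $X$ is $(H,1)$-primitive. For a primitive $n$-th root of unity $q\in k$, $n\ge2$, let $\mathrm Q^{1}_n(q)$ be the Hopf algebra generated by $h,x,H,X$ subject to $$h^n=H^n=1,\quad x^n=X^n=0,\quad xh=q\,hx,\quad XH=q^{n-1}HX,$$ $$xH=q\,Hx,\quad hX=q\,Xh,\quad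 xX-q\,Xx=1-Hh,\quad hH=Hh,$$ with $h,H$ group-like, $x$ $(h,1)$-primitive and $X$ $(H,1)$-primitive. Let $T_{n^2}(q)$ be the Taft Hopf algebra generated by $h,x$ with $h^n=1$, $x^n=0$, $xh=q\,hx$, $h$ group-like and $x$ $(h,1)$-primitive. Let $D(T_{n^2}(q))$ be its Drinfeld double: for a finite-dimensional Hopf algebra $A$ with bijective antipode $S$, $D(A)=(A^*)^{\mathrm{cop}}\bowtie A$ is the space $A^*\otimes A$ with unit $\varepsilon\otimes 1$, the tensor product coalgebra structure of $(A^*)^{\mathrm{cop}}\otimes A$ and the multiplication $(f\otimes a)(g\otimes b)=f\,g\bigl(S^{-1}(a_{(3)})\,?\,a_{(1)}\bigr)\otimes a_{(2)}b$. **Theorem.** 1) If $m,n\ge2$, $m\ne n$, then for all primitive roots of unity $q,\overline q\in k$ of orders $m,n$ and all $\sigma\in k$ with $\sigma^{\gcd(m,n)}=1$, $\mathrm{Aut}_{\mathrm{Hopf}}(\mathrm T^{\sigma}_{n,m}(\overline q,q))\cong k^*\times k^*$. If $n\ge2$ and $q\neq\overline q$ are primitive $n$-th roots of unity in $k$, then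 $\mathrm{Aut}_{\mathrm{Hopf}}(\mathrm T^{\sigma}_{n,n}(\overline q,q))\cong k^*\times k^*$ for all $\sigma\in k$ with $\sigma^n=1$. 2) If $n\ge2$, $q\in k$ is a primitive $n$-th root of unity and $\sigma\in k$, $\sigma^n=1$, then $$\mathrm{Aut}_{\mathrm{Hopf}}(\mathrm T^{\sigma}_{n,n}(q,q))\cong\begin{cases}k^*\times k^*&\text{if }\sigma^2\ne1,\\ (k^*\times k^*)\rtimes_{\tau}\mathbb Z_2&\text{if }\sigma^2=1,\end{cases}$$ where $\tau(\overline 1)(a,b)=(b,a)$ for all $a,b\in k^*$. 3) If $n\ge2$ and $q\in k$ is a primitive $n$-th root of unity, then $$\mathrm{Aut}_{\mathrm{Hopf}}(\mathrm Q^{1}_n(q))\cong\begin{cases}k^*&\text{if }n\ge3,\\ k^*\rtimes_{\kappa}\mathbb Z_2&\text{if }n=2,\end{cases}$$ where $\kappa(\overline 1)(a)=a^{-1}$ for all $a\in k^*$. 4) If $n\ge2$ and $q\in k$ is a primitive $n$-th root of unity, then $\mathrm{Aut}_{\mathrm{Hopf}}(D(T_{n^2}(q)))\cong k^*$ if $n\ge3$,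 and $\mathrm{Aut}_{\mathrm{Hopf}}(D(T_{n^2}(q)))\cong k^*\rtimes_{\kappa}\mathbb Z_2$ if $n=2$, with $\kappa$ as in 3). -/

import Mathlib

open scoped TensorProduct

namespace TaftBicrossed

universe u v w


section QBinomial

/-- The Gaussian binomial coefficients, evaluated at `q`. -/
def qBinom {k : Type u} [Field k] (q : k) : ℕ → ℕ → k
  | _, 0 => 1
  | 0, _ + 1 => 0
  | n + 1, i + 1 => qBinom q n i + q ^ (i + 1) * qBinom q n (i + 1)

variable {k : Type u} [Field k] {R : Type v} [Ring R] [Algebra k R]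

theorem qBinom_zero (q : k) (n : ℕ) : qBinom q n 0 = 1 := by
  cases n <;> rfl

theorem qBinom_of_lt (q : k) (n i : ℕ) (h : n < i) : qBinom q n i = 0 := by
  induction n generalizing i with
  | zero => cases i with
    | zero => omega
    | succ i => rfl
  | succ n ih => cases i with
    | zero => omega
    | succ i => simp [qBinom, ih i (by omega), ih (i + 1) (by omega)]

theorem qBinom_self (q : k) (n : ℕ) : qBinom q n n = 1 := by
  induction n with
  | zero => rfl
  | succ n ih => simp [qBinom, ih, qBinom_of_lt q n (n + 1) (by omega)]

theorem qBinom_step (q : k) (n i : ℕ) (hi : i ≤ n) :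
    (1 - q ^ (i + 1)) * qBinom q n (i + 1) = (1 - q ^ (n - i)) * qBinom q n i := by
  induction n generalizing i with
  | zero =>
    obtain rfl : i = 0 := by omega
    simp [qBinom]
  | succ n ih =>
    have key : ∀ j, j ≤ n → (1 - q ^ (j + 1)) * qBinom q (n + 1) (j + 1)
        = (1 - q ^ (n + 1)) * qBinom q n j := by
      intro j hj
      have h1 := ih j hj
      have h2 : q ^ (j + 1) * q ^ (n - j) = q ^ (n + 1) := by
        rw [← pow_add]; congr 1; omega
      simp only [qBinom]
      linear_combination q ^ (j + 1) * h1 - qBinom q n j * h2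
    rcases Nat.lt_or_ge n i with h | h
    · obtain rfl : i = n + 1 := by omega
      simp [qBinom_of_lt q (n + 1) (n + 2) (by omega)]
    · rw [key i h]
      cases i with
      | zero => simp [qBinom_zero]
      | succ i =>
        have h1 := ih i (by omega)
        have h2 : q ^ (i + 1) * q ^ (n - i) = q ^ (n + 1) := by
          rw [← pow_add]; congr 1; omega
        have h3 : n + 1 - (i + 1) = n - i := by omega
        rw [h3]
        simp only [qBinom]
        linear_combination h1 + qBinom q n (i + 1) * h2

theorem qBinom_eq_zero {q : k} {m : ℕ} (hq : IsPrimitiveRoot q m) (i : ℕ) (h0 : 0 < i)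
    (hi : i < m) : qBinom q m i = 0 := by
  induction i with
  | zero => omega
  | succ i ih =>
    have h1 := qBinom_step q m i (by omega)
    have h2 : (1 - q ^ (m - i)) * qBinom q m i = 0 := by
      rcases Nat.eq_zero_or_pos i with rfl | h
      · simp [hq.pow_eq_one]
      · simp [ih h (by omega)]
    rw [h2, mul_eq_zero] at h1
    rcases h1 with h1 | h1
    · exact absurd (sub_eq_zero.1 h1).symm (hq.pow_ne_one_of_pos_of_lt (by omega) hi)
    · exact h1

theorem mul_pow_of_qcomm {q : k} {a b : R} (h : b * a = q • (a * b)) (i : ℕ) :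
    b * a ^ i = q ^ i • (a ^ i * b) := by
  induction i with
  | zero => simp
  | succ i ih =>
    rw [pow_succ a, ← mul_assoc, ih, smul_mul_assoc, mul_assoc, h, mul_smul_comm, smul_smul,
      mul_assoc, pow_succ q]

theorem pow_mul_of_qcomm {q : k} {a b : R} (h : b * a = q • (a * b)) (i : ℕ) :
    b ^ i * a = q ^ i • (a * b ^ i) := by
  induction i with
  | zero => simp
  | succ i ih =>
    rw [pow_succ' b, mul_assoc, ih, mul_smul_comm, ← mul_assoc, h, smul_mul_assoc, smul_smul,
      mul_assoc, pow_succ q]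

theorem add_pow_of_qcomm {q : k} {a b : R} (h : b * a = q • (a * b)) (n : ℕ) :
    (a + b) ^ n = ∑ i ∈ Finset.range (n + 1), qBinom q n i • (a ^ i * b ^ (n - i)) := by
  induction n with
  | zero => simp [qBinom]
  | succ n ih =>
    have e1 : ∀ i ∈ Finset.range (n + 1), (a + b) * (qBinom q n i • (a ^ i * b ^ (n - i))) =
        qBinom q n i • (a ^ (i + 1) * b ^ (n - i)) +
          (q ^ i * qBinom q n i) • (a ^ i * b ^ (n + 1 - i)) := by
      intro i hi
      have hi' : n + 1 - i = (n - i) + 1 := by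
        have := Finset.mem_range.1 hi; omega
      rw [add_mul, mul_smul_comm, mul_smul_comm, ← mul_assoc, ← mul_assoc, mul_pow_of_qcomm h,
        ← pow_succ', smul_mul_assoc, smul_smul, mul_assoc, ← pow_succ', hi', mul_comm (q ^ i)]
    rw [pow_succ' (a + b), ih, Finset.mul_sum, Finset.sum_congr rfl e1, Finset.sum_add_distrib,
      Finset.sum_range_succ' _ (n + 1)]
    have e2 : ∑ i ∈ Finset.range (n + 1), (q ^ i * qBinom q n i) • (a ^ i * b ^ (n + 1 - i)) =
        ∑ i ∈ Finset.range (n + 1),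
          (q ^ (i + 1) * qBinom q n (i + 1)) • (a ^ (i + 1) * b ^ (n - i)) + b ^ (n + 1) := by
      have := Finset.sum_range_succ' (fun i => (q ^ i * qBinom q n i) • (a ^ i * b ^ (n + 1 - i)))
        (n + 1)
      rw [Finset.sum_range_succ, qBinom_of_lt q n (n + 1) (by omega)] at this
      simpa [qBinom_zero] using this
    rw [e2, ← add_assoc, ← Finset.sum_add_distrib]
    simp [qBinom, add_smul]

/-- For a primitive `m`-th root of unity `q` and `b a = q a b` one has `(a + b)^m = a^m + b^m`. -/
theorem add_pow_of_primitive {q : k} {m : ℕ} [NeZero m] (hq : IsPrimitiveRoot q m) {a b : R}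
    (h : b * a = q • (a * b)) : (a + b) ^ m = a ^ m + b ^ m := by
  obtain ⟨m, rfl⟩ := Nat.exists_eq_succ_of_ne_zero (NeZero.ne m)
  rw [add_pow_of_qcomm h, Finset.sum_range_succ, Finset.sum_range_succ', Finset.sum_eq_zero]
  · simp [qBinom_zero, qBinom_self, add_comm]
  · intro i hi
    rw [qBinom_eq_zero hq _ (by omega) (by have := Finset.mem_range.1 hi; omega), zero_smul]

theorem mul_pow_eq_zero_of_qcomm {q : k} {a b : R} (h : b * a = q • (a * b)) {m : ℕ}
    (ha : a ^ m = 0) : (a * b) ^ m = 0 := by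
  have : ∀ n : ℕ, ∃ c : k, (a * b) ^ n = c • (a ^ n * b ^ n) := by
    intro n
    induction n with
    | zero => exact ⟨1, by simp⟩
    | succ n ih =>
      obtain ⟨c, hc⟩ := ih
      refine ⟨c * q ^ n, ?_⟩
      rw [pow_succ (a * b), hc, smul_mul_assoc, mul_assoc, ← mul_assoc (b ^ n), pow_mul_of_qcomm h,
        smul_mul_assoc, mul_smul_comm, smul_smul, pow_succ a, pow_succ b]
      simp only [mul_assoc]
  obtain ⟨c, hc⟩ := this m
  simp [hc, ha]

end QBinomial

section Generation

variable {k : Type u} [Field k] {A : Type v} [Ring A]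

/-- An algebra map `A → Aᵐᵒᵖ` seen as a linear endomorphism of `A`. -/
def unopLinear [Algebra k A] (S : A →ₐ[k] Aᵐᵒᵖ) : A →ₗ[k] A :=
  (MulOpposite.opLinearEquiv k).symm.toLinearMap ∘ₗ S.toLinearMap

theorem unopLinear_apply [Algebra k A] (S : A →ₐ[k] Aᵐᵒᵖ) (a : A) :
    unopLinear S a = (S a).unop := rfl

theorem unopLinear_mul [Algebra k A] (S : A →ₐ[k] Aᵐᵒᵖ) (a b : A) :
    unopLinear S (a * b) = unopLinear S b * unopLinear S a := by
  simp [unopLinear_apply]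

variable [Bialgebra k A]

/-- The left antipode identity only has to be checked on algebra generators. -/
theorem antipode_left_of_adjoin (S : A →ₐ[k] Aᵐᵒᵖ) {s : Set A} (hs : Algebra.adjoin k s = ⊤)
    (h : ∀ a ∈ s, LinearMap.mul' k A ((unopLinear S).rTensor A (Coalgebra.comul a)) =
      algebraMap k A (Coalgebra.counit a)) :
    LinearMap.mul' k A ∘ₗ (unopLinear S).rTensor A ∘ₗ Coalgebra.comul =
      (Algebra.linearMap k A) ∘ₗ Coalgebra.counit := by
  have key : ∀ t b b', LinearMap.mul' k A ((unopLinear S).rTensor A (t * (b ⊗ₜ[k] b'))) =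
      unopLinear S b * LinearMap.mul' k A ((unopLinear S).rTensor A t) * b' := by
    intro t b b'
    induction t with
    | zero => simp
    | add x y hx hy => simp only [add_mul, map_add, hx, hy, mul_add]
    | tmul x y => simp [unopLinear_mul, mul_assoc]
  ext a
  have ha : a ∈ Algebra.adjoin k s := hs ▸ Algebra.mem_top
  simp only [LinearMap.comp_apply, Algebra.linearMap_apply]
  induction ha using Algebra.adjoin_induction with
  | mem x hx => exact h x hx
  | algebraMap r => simp [Algebra.TensorProduct.algebraMap_apply, unopLinear_apply]
  | add x y _ _ hx hy => simp only [map_add, hx, hy]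
  | mul x y _ _ hx hy =>
    rw [Bialgebra.comul_mul, Bialgebra.counit_mul, map_mul (algebraMap k A), ← hy]
    induction (Coalgebra.comul (R := k) y) with
    | zero => simp
    | add u v hu hv => simp only [mul_add, map_add, hu, hv]
    | tmul b b' =>
      rw [key, hx, ← Algebra.commutes]
      simp [mul_assoc]

/-- The right antipode identity only has to be checked on algebra generators. -/
theorem antipode_right_of_adjoin (S : A →ₐ[k] Aᵐᵒᵖ) {s : Set A} (hs : Algebra.adjoin k s = ⊤)
    (h : ∀ a ∈ s, LinearMap.mul' k A ((unopLinear S).lTensor A (Coalgebra.comul a)) =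
      algebraMap k A (Coalgebra.counit a)) :
    LinearMap.mul' k A ∘ₗ (unopLinear S).lTensor A ∘ₗ Coalgebra.comul =
      (Algebra.linearMap k A) ∘ₗ Coalgebra.counit := by
  have key : ∀ t b b', LinearMap.mul' k A ((unopLinear S).lTensor A ((b ⊗ₜ[k] b') * t)) =
      b * LinearMap.mul' k A ((unopLinear S).lTensor A t) * unopLinear S b' := by
    intro t b b'
    induction t with
    | zero => simp
    | add x y hx hy => simp only [add_mul, map_add, hx, hy, mul_add]
    | tmul x y => simp [unopLinear_mul, mul_assoc]
  ext a
  have ha : a ∈ Algebra.adjoin k s := hs ▸ Algebra.mem_top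
  simp only [LinearMap.comp_apply, Algebra.linearMap_apply]
  induction ha using Algebra.adjoin_induction with
  | mem x hx => exact h x hx
  | algebraMap r => simp [Algebra.TensorProduct.algebraMap_apply, unopLinear_apply]
  | add x y _ _ hx hy => simp only [map_add, hx, hy]
  | mul x y _ _ hx hy =>
    rw [Bialgebra.comul_mul, Bialgebra.counit_mul, map_mul (algebraMap k A), ← hx]
    induction (Coalgebra.comul (R := k) x) with
    | zero => simp
    | add u v hu hv => simp only [add_mul, map_add, hu, hv]
    | tmul b b' =>
      rw [key, hy, ← Algebra.commutes]
      rw [mul_assoc, Algebra.commutes]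
      simp [mul_assoc]

end Generation

/-! ### The Taft algebra -/

/-- Names of the generators of a Taft algebra. -/
inductive TaftGen
  | h
  | x

section Taft

variable {k : Type u} [Field k]

/-- The defining relations `h^m = 1`, `x^m = 0`, `x h = q h x`. -/
inductive TaftRel (m : ℕ) (q : k) : FreeAlgebra k TaftGen → FreeAlgebra k TaftGen → Prop
  | h_pow : TaftRel m q (FreeAlgebra.ι k .h ^ m) 1
  | x_pow : TaftRel m q (FreeAlgebra.ι k .x ^ m) 0
  | xh : TaftRel m q (FreeAlgebra.ι k .x * FreeAlgebra.ι k .h)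
      (q • (FreeAlgebra.ι k .h * FreeAlgebra.ι k .x))

/-- The Taft algebra `T_{m²}(q)`, where `q` is a primitive `m`-th root of unity. -/
def Taft {m : ℕ} {q : k} (_hq : IsPrimitiveRoot q m) : Type u :=
  RingQuot (TaftRel m q)

namespace Taft

variable {m : ℕ} {q : k} (hq : IsPrimitiveRoot q m)

noncomputable instance : Ring (Taft hq) := inferInstanceAs (Ring (RingQuot (TaftRel m q)))

noncomputable instance : Algebra k (Taft hq) :=
  inferInstanceAs (Algebra k (RingQuot (TaftRel m q)))

/-- The image of a generator in the Taft algebra. -/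
noncomputable def gen (i : TaftGen) : Taft hq :=
  RingQuot.mkAlgHom k (TaftRel m q) (FreeAlgebra.ι k i)

/-- The generator `h`. -/
noncomputable abbrev h : Taft hq := gen hq .h

/-- The generator `x`. -/
noncomputable abbrev x : Taft hq := gen hq .x

theorem h_pow : h hq ^ m = 1 := by
  have := RingQuot.mkAlgHom_rel k (TaftRel.h_pow (m := m) (q := q))
  rw [map_pow, map_one] at this
  exact this

theorem x_pow : x hq ^ m = 0 := by
  have := RingQuot.mkAlgHom_rel k (TaftRel.x_pow (m := m) (q := q))
  rw [map_pow, map_zero] at this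
  exact this

theorem xh : x hq * h hq = q • (h hq * x hq) := by
  have := RingQuot.mkAlgHom_rel k (TaftRel.xh (m := m) (q := q))
  rw [map_mul, map_smul, map_mul] at this
  exact this

variable {hq}

/-- The universal property of the Taft algebra. -/
noncomputable def lift {B : Type v} [Ring B] [Algebra k B] (h' x' : B) (h1 : h' ^ m = 1)
    (h2 : x' ^ m = 0) (h3 : x' * h' = q • (h' * x')) : Taft hq →ₐ[k] B :=
  RingQuot.liftAlgHom k ⟨FreeAlgebra.lift k (fun | .h => h' | .x => x'), by
    rintro _ _ (_ | _ | _) <;> simp [h1, h2, h3]⟩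

section
variable {B : Type v} [Ring B] [Algebra k B] (h' x' : B) (h1 : h' ^ m = 1)
    (h2 : x' ^ m = 0) (h3 : x' * h' = q • (h' * x'))

@[simp] theorem lift_h : lift (hq := hq) h' x' h1 h2 h3 (gen hq .h) = h' := by
  unfold lift gen
  exact (RingQuot.liftAlgHom_mkAlgHom_apply ..).trans (by simp)

@[simp] theorem lift_x : lift (hq := hq) h' x' h1 h2 h3 (gen hq .x) = x' := by
  unfold lift gen
  exact (RingQuot.liftAlgHom_mkAlgHom_apply ..).trans (by simp)
end

theorem algHom_ext {B : Type v} [Ring B] [Algebra k B] {f g : Taft hq →ₐ[k] B}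
    (hh : f (h hq) = g (h hq)) (hx : f (x hq) = g (x hq)) : f = g := by
  refine RingQuot.ringQuot_ext' k f g (FreeAlgebra.hom_ext (funext fun i => ?_))
  cases i
  · exact hh
  · exact hx

variable (hq)

theorem adjoin_eq_top : Algebra.adjoin k {h hq, x hq} = ⊤ := by
  let S := Algebra.adjoin k {h hq, x hq}
  let f : Taft hq →ₐ[k] S := lift
    ⟨h hq, Algebra.subset_adjoin (by simp)⟩ ⟨x hq, Algebra.subset_adjoin (by simp)⟩
    (Subtype.ext (h_pow hq)) (Subtype.ext (x_pow hq)) (Subtype.ext (xh hq))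
  have hf : S.val.comp f = AlgHom.id k _ := algHom_ext (by simp [f]) (by simp [f])
  refine eq_top_iff.2 fun a _ => ?_
  have : S.val (f a) = a := DFunLike.congr_fun hf a
  rw [← this]
  exact (f a).2

variable [NeZero m]

/-- `Δ(h) = h ⊗ h`, `Δ(x) = x ⊗ h + 1 ⊗ x`. -/
noncomputable def comulHom : Taft hq →ₐ[k] Taft hq ⊗[k] Taft hq :=
  lift (h hq ⊗ₜ h hq) (x hq ⊗ₜ h hq + 1 ⊗ₜ x hq)
    (by rw [Algebra.TensorProduct.tmul_pow, h_pow]; rfl)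
    (by
      rw [add_pow_of_primitive hq, Algebra.TensorProduct.tmul_pow, Algebra.TensorProduct.tmul_pow,
        x_pow, TensorProduct.zero_tmul, TensorProduct.tmul_zero, add_zero]
      simp [xh])
    (by
      simp only [add_mul, mul_add, Algebra.TensorProduct.tmul_mul_tmul, xh, one_mul, mul_one,
        smul_add, TensorProduct.smul_tmul', TensorProduct.tmul_smul])

/-- `ε(h) = 1`, `ε(x) = 0`. -/
noncomputable def counitHom : Taft hq →ₐ[k] k :=
  lift 1 0 (one_pow _) (zero_pow (NeZero.ne m)) (by simp)

noncomputable instance : Bialgebra k (Taft hq) :=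
  Bialgebra.ofAlgHom (comulHom hq) (counitHom hq)
    (algHom_ext (by simp [comulHom])
      (by simp [comulHom, TensorProduct.tmul_add, TensorProduct.add_tmul, add_assoc,
        Algebra.TensorProduct.one_def]))
    (algHom_ext (by simp [comulHom, counitHom]) (by simp [comulHom, counitHom]))
    (algHom_ext (by simp [comulHom, counitHom]) (by simp [comulHom, counitHom]))

theorem comul_h : Coalgebra.comul (R := k) (h hq) = h hq ⊗ₜ h hq :=
  lift_h ..

theorem comul_x : Coalgebra.comul (R := k) (x hq) = x hq ⊗ₜ h hq + 1 ⊗ₜ x hq :=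
  lift_x ..

theorem counit_h : Coalgebra.counit (R := k) (h hq) = 1 :=
  lift_h ..

theorem counit_x : Coalgebra.counit (R := k) (x hq) = 0 :=
  lift_x ..

theorem h_mul_inv : h hq * h hq ^ (m - 1) = 1 := by
  rw [← pow_succ', Nat.sub_add_cancel (NeZero.one_le), h_pow]

theorem inv_mul_h : h hq ^ (m - 1) * h hq = 1 := by
  rw [← pow_succ, Nat.sub_add_cancel (NeZero.one_le), h_pow]

end Taft
end Taft

/-- Moving an inverse through a commutation relation. -/
theorem inv_qcomm {k : Type u} [Field k] {R : Type v} [Ring R] [Algebra k R] {q : k} {a b g : R}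
    (hab : b * a = q • (a * b)) (h1 : a * g = 1) (h2 : g * a = 1) : g * b = q • (b * g) := by
  calc g * b = g * (b * a) * g := by rw [mul_assoc, mul_assoc, h1, mul_one]
    _ = q • (b * g) := by
      rw [hab, mul_smul_comm, smul_mul_assoc, ← mul_assoc, h2, one_mul]

section Taft
namespace Taft
variable {k : Type u} [Field k] {m : ℕ} {q : k} (hq : IsPrimitiveRoot q m) [NeZero m]

/-- The antipode `S(h) = h⁻¹`, `S(x) = - x h⁻¹`, as an algebra map to the opposite algebra. -/
noncomputable def antipodeHom : Taft hq →ₐ[k] (Taft hq)ᵐᵒᵖ :=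
  lift (MulOpposite.op (h hq ^ (m - 1))) (MulOpposite.op (-(x hq * h hq ^ (m - 1))))
    (by rw [← MulOpposite.op_pow, ← pow_mul, mul_comm, pow_mul, h_pow, one_pow]; rfl)
    (by
      rw [← MulOpposite.op_pow, neg_pow, mul_pow_eq_zero_of_qcomm (q := q)
        (inv_qcomm (xh hq) (h_mul_inv hq) (inv_mul_h hq)) (x_pow hq), mul_zero]; rfl)
    (by
      rw [← MulOpposite.op_mul, ← MulOpposite.op_mul, ← MulOpposite.op_smul, mul_neg, neg_mul,
        ← mul_assoc, inv_qcomm (xh hq) (h_mul_inv hq) (inv_mul_h hq), smul_mul_assoc, smul_neg])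

noncomputable instance : HopfAlgebra k (Taft hq) where
  antipode := unopLinear (antipodeHom hq)
  mul_antipode_rTensor_comul := antipode_left_of_adjoin _ (adjoin_eq_top hq) (by
    rintro a (rfl | rfl)
    · simp [comul_h, counit_h, unopLinear_apply, antipodeHom, inv_mul_h]
    · simp [comul_x, counit_x, unopLinear_apply, antipodeHom, mul_assoc, inv_mul_h])
  mul_antipode_lTensor_comul := antipode_right_of_adjoin _ (adjoin_eq_top hq) (by
    rintro a (rfl | rfl)
    · simp [comul_h, counit_h, unopLinear_apply, antipodeHom, h_mul_inv]
    · simp [comul_x, counit_x, unopLinear_apply, antipodeHom])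

theorem antipode_h : HopfAlgebra.antipode k (h hq) = h hq ^ (m - 1) :=
  congrArg MulOpposite.unop (lift_h ..)

theorem antipode_x : HopfAlgebra.antipode k (x hq) = -(x hq * h hq ^ (m - 1)) :=
  congrArg MulOpposite.unop (lift_x ..)

/-- `S²(h) = h` and `S²(x) = q⁻¹ x`, so the antipode has finite order. -/
theorem antipode_bijective : Function.Bijective (HopfAlgebra.antipode k (A := Taft hq)) := by
  have hm := NeZero.ne m
  let F : Taft hq →ₐ[k] Taft hq := AlgHom.ofLinearMap
    (HopfAlgebra.antipode k ∘ₗ HopfAlgebra.antipode k) (by simp)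
    (fun a b => by simp [HopfAlgebra.antipode_mul_antidistrib])
  have ginv : HopfAlgebra.antipode k (h hq ^ (m - 1)) = h hq := by
    have h1 : HopfAlgebra.antipode k (h hq ^ (m - 1)) * h hq ^ (m - 1) = 1 := by
      have := HopfAlgebra.antipode_mul_antidistrib (R := k) (h hq) (h hq ^ (m - 1))
      rw [h_mul_inv, HopfAlgebra.antipode_one, antipode_h] at this
      exact this.symm
    calc _ = HopfAlgebra.antipode k (h hq ^ (m - 1)) * (h hq ^ (m - 1) * h hq) := by
          rw [inv_mul_h, mul_one]
      _ = h hq := by rw [← mul_assoc, h1, one_mul]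
  have Fh : F (h hq) = h hq := by
    change HopfAlgebra.antipode k (HopfAlgebra.antipode k (h hq)) = _
    rw [antipode_h, ginv]
  have Fx : q • F (x hq) = x hq := by
    change q • HopfAlgebra.antipode k (HopfAlgebra.antipode k (x hq)) = _
    rw [antipode_x, map_neg, HopfAlgebra.antipode_mul_antidistrib, antipode_x, ginv, mul_neg,
      neg_neg, ← mul_assoc, ← smul_mul_assoc, ← xh, mul_assoc, h_mul_inv, mul_one]
  have Fpow : ∀ j, (F ^ j) (h hq) = h hq ∧ q ^ j • (F ^ j) (x hq) = x hq := by
    intro j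
    induction j with
    | zero => simp
    | succ j ih =>
      rw [pow_succ' F]
      refine ⟨by rw [AlgHom.mul_apply, ih.1, Fh], ?_⟩
      rw [AlgHom.mul_apply, pow_succ', mul_smul, ← map_smul F, ih.2, Fx]
  have Fm : F ^ m = 1 := algHom_ext (by simp [(Fpow m).1])
    (by simpa [hq.pow_eq_one] using (Fpow m).2)
  have hF : Function.Bijective F := by
    obtain ⟨j, hj⟩ : ∃ j, m = j + 1 := Nat.exists_eq_succ_of_ne_zero hm
    have hj1 : F ^ (j + 1) = 1 := (congrArg (F ^ ·) hj.symm).trans Fm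
    refine Function.bijective_iff_has_inverse.2 ⟨(F ^ j : Taft hq →ₐ[k] Taft hq), ?_, ?_⟩
    · intro a
      have := DFunLike.congr_fun hj1 a
      rwa [pow_succ] at this
    · intro a
      have := DFunLike.congr_fun hj1 a
      rwa [pow_succ'] at this
  exact ⟨Function.Injective.of_comp (f := HopfAlgebra.antipode k) hF.1,
    Function.Surjective.of_comp (g := HopfAlgebra.antipode k) hF.2⟩

instance : Module.Finite k (Taft hq) := by
  let M : Submodule k (Taft hq) := Submodule.span k
    (Set.range fun p : Fin m × Fin m => h hq ^ (p.1 : ℕ) * x hq ^ (p.2 : ℕ))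
  have mem : ∀ i j : ℕ, h hq ^ i * x hq ^ j ∈ M := by
    intro i j
    rcases Nat.lt_or_ge j m with hj | hj
    · refine Submodule.subset_span ⟨(⟨i % m, Nat.mod_lt _ (NeZero.pos m)⟩, ⟨j, hj⟩), ?_⟩
      simp only
      rw [← pow_mod_orderOf (h hq) i, ← pow_mod_orderOf (h hq) (i % m),
        Nat.mod_mod_of_dvd _ (orderOf_dvd_of_pow_eq_one (h_pow hq))]
    · rw [pow_eq_zero_of_le hj (x_pow hq), mul_zero]
      exact M.zero_mem
  have step : ∀ a b : Taft hq, b ∈ M → a * b ∈ M := by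
    intro a
    have ha : a ∈ Algebra.adjoin k {h hq, x hq} := adjoin_eq_top hq ▸ Algebra.mem_top
    induction ha using Algebra.adjoin_induction with
    | mem a ha =>
      intro b hb
      induction hb using Submodule.span_induction with
      | mem b hb =>
        obtain ⟨⟨i, j⟩, rfl⟩ := hb
        rcases ha with rfl | rfl
        · simp only
          rw [← mul_assoc, ← pow_succ']
          exact mem _ _
        · simp only
          rw [← mul_assoc, mul_pow_of_qcomm (xh hq), smul_mul_assoc, mul_assoc, ← pow_succ']
          exact M.smul_mem _ (mem _ _)
      | zero => rw [mul_zero]; exact M.zero_mem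
      | add b c _ _ hb hc => rw [mul_add]; exact M.add_mem hb hc
      | smul r b _ hb => rw [mul_smul_comm]; exact M.smul_mem _ hb
    | algebraMap r => intro b hb; rw [← Algebra.smul_def]; exact M.smul_mem _ hb
    | add a a' _ _ ha ha' =>
      intro b hb; rw [add_mul]; exact M.add_mem (ha b hb) (ha' b hb)
    | mul a a' _ _ ha ha' =>
      intro b hb; rw [mul_assoc]; exact ha _ (ha' b hb)
  have top : M = ⊤ := eq_top_iff.2 fun a _ => by
    have := step a 1 (by simpa using mem 0 0)
    rwa [mul_one] at this
  exact ⟨top ▸ Submodule.fg_span (Set.finite_range _)⟩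

end Taft
end Taft

/-! ### The bicrossed products of two Taft algebras -/

/-- Names of the generators of a bicrossed product of two Taft algebras. -/
inductive BicrossGen
  | h
  | x
  | H
  | X

section Bicross

variable {k : Type u} [Field k]

/-- The relations satisfied by elements `h, x, H, X` of an algebra: those of the Taft algebras
`T_{m²}(q) = ⟨h, x⟩` and `T_{n²}(q') = ⟨H, X⟩`, and the cross relations
`x H = σ H x`, `h X = σ X h`, `x X = σ X x + α (1 - H h)`, `h H = H h`. -/
structure BicrossRelations (m n : ℕ) (q q' σ α : k) {B : Type v} [Ring B] [Algebra k B]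
    (h x H X : B) : Prop where
  h_pow : h ^ m = 1
  H_pow : H ^ n = 1
  x_pow : x ^ m = 0
  X_pow : X ^ n = 0
  xh : x * h = q • (h * x)
  XH : X * H = q' • (H * X)
  xH : x * H = σ • (H * x)
  hX : h * X = σ • (X * h)
  xX : x * X = σ • (X * x) + α • (1 - H * h)
  hH : h * H = H * h

/-- The same relations as pairs of elements of the free algebra on `h, x, H, X`. -/
inductive BicrossRel (m n : ℕ) (q q' σ α : k) :
    FreeAlgebra k BicrossGen → FreeAlgebra k BicrossGen → Prop
  | h_pow : BicrossRel m n q q' σ α (FreeAlgebra.ι k .h ^ m) 1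
  | H_pow : BicrossRel m n q q' σ α (FreeAlgebra.ι k .H ^ n) 1
  | x_pow : BicrossRel m n q q' σ α (FreeAlgebra.ι k .x ^ m) 0
  | X_pow : BicrossRel m n q q' σ α (FreeAlgebra.ι k .X ^ n) 0
  | xh : BicrossRel m n q q' σ α (FreeAlgebra.ι k .x * FreeAlgebra.ι k .h)
      (q • (FreeAlgebra.ι k .h * FreeAlgebra.ι k .x))
  | XH : BicrossRel m n q q' σ α (FreeAlgebra.ι k .X * FreeAlgebra.ι k .H)
      (q' • (FreeAlgebra.ι k .H * FreeAlgebra.ι k .X))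
  | xH : BicrossRel m n q q' σ α (FreeAlgebra.ι k .x * FreeAlgebra.ι k .H)
      (σ • (FreeAlgebra.ι k .H * FreeAlgebra.ι k .x))
  | hX : BicrossRel m n q q' σ α (FreeAlgebra.ι k .h * FreeAlgebra.ι k .X)
      (σ • (FreeAlgebra.ι k .X * FreeAlgebra.ι k .h))
  | xX : BicrossRel m n q q' σ α (FreeAlgebra.ι k .x * FreeAlgebra.ι k .X)
      (σ • (FreeAlgebra.ι k .X * FreeAlgebra.ι k .x) +
        α • (1 - FreeAlgebra.ι k .H * FreeAlgebra.ι k .h))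
  | hH : BicrossRel m n q q' σ α (FreeAlgebra.ι k .h * FreeAlgebra.ι k .H)
      (FreeAlgebra.ι k .H * FreeAlgebra.ι k .h)

/-- The algebra generated by `h, x, H, X` subject to
`h^m = H^n = 1`, `x^m = X^n = 0`, `x h = q h x`, `X H = q' H X`,
`x H = σ H x`, `h X = σ X h`, `x X = σ X x + α (1 - H h)`, `h H = H h`,
where `q` and `q'` are primitive roots of unity of orders `m` and `n`. -/
def Bicross {m n : ℕ} {q q' : k} (_hq' : IsPrimitiveRoot q' n) (_hq : IsPrimitiveRoot q m)
    (σ α : k) : Type u :=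
  RingQuot (BicrossRel m n q q' σ α)

namespace Bicross

variable {m n : ℕ} {q q' : k} (hq' : IsPrimitiveRoot q' n) (hq : IsPrimitiveRoot q m) (σ α : k)

noncomputable instance : Ring (Bicross hq' hq σ α) :=
  inferInstanceAs (Ring (RingQuot (BicrossRel m n q q' σ α)))

noncomputable instance : Algebra k (Bicross hq' hq σ α) :=
  inferInstanceAs (Algebra k (RingQuot (BicrossRel m n q q' σ α)))

/-- The image of a generator in the bicrossed product. -/
noncomputable def gen (i : BicrossGen) : Bicross hq' hq σ α :=
  RingQuot.mkAlgHom k (BicrossRel m n q q' σ α) (FreeAlgebra.ι k i)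

theorem relations : BicrossRelations m n q q' σ α (gen hq' hq σ α .h) (gen hq' hq σ α .x)
    (gen hq' hq σ α .H) (gen hq' hq σ α .X) := by
  have key : ∀ {a b}, BicrossRel m n q q' σ α a b →
      (RingQuot.mkAlgHom k (BicrossRel m n q q' σ α) a : Bicross hq' hq σ α) =
        RingQuot.mkAlgHom k (BicrossRel m n q q' σ α) b :=
    fun r => RingQuot.mkAlgHom_rel k r
  constructor
  · have := key .h_pow; rw [map_pow, map_one] at this; exact this
  · have := key .H_pow; rw [map_pow, map_one] at this; exact this
  · have := key .x_pow; rw [map_pow, map_zero] at this; exact this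
  · have := key .X_pow; rw [map_pow, map_zero] at this; exact this
  · have := key .xh; rw [map_mul, map_smul, map_mul] at this; exact this
  · have := key .XH; rw [map_mul, map_smul, map_mul] at this; exact this
  · have := key .xH; rw [map_mul, map_smul, map_mul] at this; exact this
  · have := key .hX; rw [map_mul, map_smul, map_mul] at this; exact this
  · have := key .xX
    rw [map_mul, map_add, map_smul, map_smul, map_sub, map_mul, map_mul, map_one] at this
    exact this
  · have := key .hH; rw [map_mul, map_mul] at this; exact this

variable {hq' hq σ α}

/-- The universal property of the bicrossed product. -/
noncomputable def lift {B : Type v} [Ring B] [Algebra k B] {h' x' H' X' : B}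
    (r : BicrossRelations m n q q' σ α h' x' H' X') : Bicross hq' hq σ α →ₐ[k] B :=
  RingQuot.liftAlgHom k
    ⟨FreeAlgebra.lift k (fun | .h => h' | .x => x' | .H => H' | .X => X'), by
      rintro _ _ (_ | _ | _ | _ | _ | _ | _ | _ | _ | _)
      · simpa using r.h_pow
      · simpa using r.H_pow
      · simpa using r.x_pow
      · simpa using r.X_pow
      · simpa using r.xh
      · simpa using r.XH
      · simpa using r.xH
      · simpa using r.hX
      · simpa using r.xX
      · simpa using r.hH⟩

section
variable {B : Type v} [Ring B] [Algebra k B] {h' x' H' X' : B}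
    (r : BicrossRelations m n q q' σ α h' x' H' X')

@[simp] theorem lift_h : lift (hq' := hq') (hq := hq) r (gen hq' hq σ α .h) = h' := by
  unfold lift gen
  exact (RingQuot.liftAlgHom_mkAlgHom_apply ..).trans (by simp)

@[simp] theorem lift_x : lift (hq' := hq') (hq := hq) r (gen hq' hq σ α .x) = x' := by
  unfold lift gen
  exact (RingQuot.liftAlgHom_mkAlgHom_apply ..).trans (by simp)

@[simp] theorem lift_H : lift (hq' := hq') (hq := hq) r (gen hq' hq σ α .H) = H' := by
  unfold lift gen
  exact (RingQuot.liftAlgHom_mkAlgHom_apply ..).trans (by simp)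

@[simp] theorem lift_X : lift (hq' := hq') (hq := hq) r (gen hq' hq σ α .X) = X' := by
  unfold lift gen
  exact (RingQuot.liftAlgHom_mkAlgHom_apply ..).trans (by simp)
end

theorem algHom_ext {B : Type v} [Ring B] [Algebra k B] {f g : Bicross hq' hq σ α →ₐ[k] B}
    (hfg : ∀ i, f (gen hq' hq σ α i) = g (gen hq' hq σ α i)) : f = g :=
  RingQuot.ringQuot_ext' k f g (FreeAlgebra.hom_ext (funext fun i => hfg i))

variable (hq' hq σ α)

theorem adjoin_eq_top : Algebra.adjoin k (Set.range (gen hq' hq σ α)) = ⊤ := by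
  let S := Algebra.adjoin k (Set.range (gen hq' hq σ α))
  have hS : ∀ i, gen hq' hq σ α i ∈ S := fun i => Algebra.subset_adjoin ⟨i, rfl⟩
  have r := relations hq' hq σ α
  let f : Bicross hq' hq σ α →ₐ[k] S := lift (h' := ⟨_, hS .h⟩) (x' := ⟨_, hS .x⟩)
    (H' := ⟨_, hS .H⟩) (X' := ⟨_, hS .X⟩)
    ⟨Subtype.ext r.h_pow, Subtype.ext r.H_pow, Subtype.ext r.x_pow, Subtype.ext r.X_pow,
      Subtype.ext r.xh, Subtype.ext r.XH, Subtype.ext r.xH, Subtype.ext r.hX,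
      Subtype.ext r.xX, Subtype.ext r.hH⟩
  have hf : S.val.comp f = AlgHom.id k _ := algHom_ext (by rintro (_ | _ | _ | _) <;> simp [f])
  refine eq_top_iff.2 fun a _ => ?_
  have : S.val (f a) = a := DFunLike.congr_fun hf a
  rw [← this]
  exact (f a).2

variable [NeZero m] [NeZero n]

theorem comul_relations : BicrossRelations m n q q' σ α
    (gen hq' hq σ α .h ⊗ₜ[k] gen hq' hq σ α .h)
    (gen hq' hq σ α .x ⊗ₜ[k] gen hq' hq σ α .h + 1 ⊗ₜ[k] gen hq' hq σ α .x)
    (gen hq' hq σ α .H ⊗ₜ[k] gen hq' hq σ α .H)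
    (gen hq' hq σ α .X ⊗ₜ[k] gen hq' hq σ α .H + 1 ⊗ₜ[k] gen hq' hq σ α .X) := by
  have r := relations hq' hq σ α
  generalize gen hq' hq σ α .h = h at *
  generalize gen hq' hq σ α .x = x at *
  generalize gen hq' hq σ α .H = H at *
  generalize gen hq' hq σ α .X = X at *
  constructor
  · rw [Algebra.TensorProduct.tmul_pow, r.h_pow]; rfl
  · rw [Algebra.TensorProduct.tmul_pow, r.H_pow]; rfl
  · rw [add_pow_of_primitive hq, Algebra.TensorProduct.tmul_pow, Algebra.TensorProduct.tmul_pow,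
      r.x_pow, TensorProduct.zero_tmul, TensorProduct.tmul_zero, add_zero]
    simp [r.xh]
  · rw [add_pow_of_primitive hq', Algebra.TensorProduct.tmul_pow, Algebra.TensorProduct.tmul_pow,
      r.X_pow, TensorProduct.zero_tmul, TensorProduct.tmul_zero, add_zero]
    simp [r.XH]
  · simp only [add_mul, mul_add, Algebra.TensorProduct.tmul_mul_tmul, r.xh, one_mul, mul_one,
      smul_add, TensorProduct.smul_tmul', TensorProduct.tmul_smul]
  · simp only [add_mul, mul_add, Algebra.TensorProduct.tmul_mul_tmul, r.XH, one_mul, mul_one,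
      smul_add, TensorProduct.smul_tmul', TensorProduct.tmul_smul]
  · simp only [add_mul, mul_add, Algebra.TensorProduct.tmul_mul_tmul, r.xH, r.hH, one_mul, mul_one,
      smul_add, TensorProduct.smul_tmul', TensorProduct.tmul_smul]
  · simp only [add_mul, mul_add, Algebra.TensorProduct.tmul_mul_tmul, r.hX, r.hH, one_mul, mul_one,
      smul_add, TensorProduct.smul_tmul', TensorProduct.tmul_smul]
  · simp only [add_mul, mul_add, Algebra.TensorProduct.tmul_mul_tmul, r.xX, r.hX, r.xH, r.hH,
      one_mul, mul_one, smul_add, TensorProduct.smul_tmul', TensorProduct.tmul_smul,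
      TensorProduct.add_tmul, TensorProduct.tmul_add, TensorProduct.sub_tmul,
      TensorProduct.tmul_sub, smul_sub, Algebra.TensorProduct.one_def]
    abel
  · simp [r.hH]

/-- `Δ(h) = h ⊗ h`, `Δ(H) = H ⊗ H`, `Δ(x) = x ⊗ h + 1 ⊗ x`, `Δ(X) = X ⊗ H + 1 ⊗ X`. -/
noncomputable def comulHom :
    Bicross hq' hq σ α →ₐ[k] Bicross hq' hq σ α ⊗[k] Bicross hq' hq σ α :=
  lift (comul_relations hq' hq σ α)

/-- `ε(h) = ε(H) = 1`, `ε(x) = ε(X) = 0`. -/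
noncomputable def counitHom : Bicross hq' hq σ α →ₐ[k] k :=
  lift (h' := 1) (x' := 0) (H' := 1) (X' := 0)
    ⟨one_pow _, one_pow _, zero_pow (NeZero.ne m), zero_pow (NeZero.ne n), by simp, by simp,
      by simp, by simp, by simp, by simp⟩

noncomputable instance : Bialgebra k (Bicross hq' hq σ α) :=
  Bialgebra.ofAlgHom (comulHom hq' hq σ α) (counitHom hq' hq σ α)
    (algHom_ext (by
      rintro (_ | _ | _ | _) <;> simp [comulHom, TensorProduct.tmul_add, TensorProduct.add_tmul,
        add_assoc, Algebra.TensorProduct.one_def]))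
    (algHom_ext (by rintro (_ | _ | _ | _) <;> simp [comulHom, counitHom]))
    (algHom_ext (by rintro (_ | _ | _ | _) <;> simp [comulHom, counitHom]))

section
local notation "B" => Bicross hq' hq σ α
local notation "γ" => gen hq' hq σ α

theorem comul_h : Coalgebra.comul (R := k) (γ .h) = γ .h ⊗ₜ γ .h := lift_h _

theorem comul_x : Coalgebra.comul (R := k) (γ .x) = γ .x ⊗ₜ γ .h + 1 ⊗ₜ γ .x := lift_x _

theorem comul_H : Coalgebra.comul (R := k) (γ .H) = γ .H ⊗ₜ γ .H := lift_H _

theorem comul_X : Coalgebra.comul (R := k) (γ .X) = γ .X ⊗ₜ γ .H + 1 ⊗ₜ γ .X := lift_X _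

theorem counit_h : Coalgebra.counit (R := k) (γ .h) = 1 := lift_h _

theorem counit_x : Coalgebra.counit (R := k) (γ .x) = 0 := lift_x _

theorem counit_H : Coalgebra.counit (R := k) (γ .H) = 1 := lift_H _

theorem counit_X : Coalgebra.counit (R := k) (γ .X) = 0 := lift_X _

theorem h_mul_inv : γ .h * γ .h ^ (m - 1) = 1 := by
  rw [← pow_succ', Nat.sub_add_cancel NeZero.one_le, (relations hq' hq σ α).h_pow]

theorem inv_mul_h : γ .h ^ (m - 1) * γ .h = 1 := by
  rw [← pow_succ, Nat.sub_add_cancel NeZero.one_le, (relations hq' hq σ α).h_pow]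

theorem H_mul_inv : γ .H * γ .H ^ (n - 1) = 1 := by
  rw [← pow_succ', Nat.sub_add_cancel NeZero.one_le, (relations hq' hq σ α).H_pow]

theorem inv_mul_H : γ .H ^ (n - 1) * γ .H = 1 := by
  rw [← pow_succ, Nat.sub_add_cancel NeZero.one_le, (relations hq' hq σ α).H_pow]

theorem antipode_relations : BicrossRelations m n q q' σ α
    (MulOpposite.op (γ .h ^ (m - 1))) (MulOpposite.op (-(γ .x * γ .h ^ (m - 1))))
    (MulOpposite.op (γ .H ^ (n - 1))) (MulOpposite.op (-(γ .X * γ .H ^ (n - 1)))) := by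
  have r := relations hq' hq σ α
  have g1 := h_mul_inv hq' hq σ α
  have g2 := inv_mul_h hq' hq σ α
  have G1 := H_mul_inv hq' hq σ α
  have G2 := inv_mul_H hq' hq σ α
  have gm : (γ .h ^ (m - 1)) ^ m = 1 := by rw [← pow_mul, mul_comm, pow_mul, r.h_pow, one_pow]
  have Gn : (γ .H ^ (n - 1)) ^ n = 1 := by rw [← pow_mul, mul_comm, pow_mul, r.H_pow, one_pow]
  generalize γ .h ^ (m - 1) = g at *
  generalize γ .H ^ (n - 1) = G at *
  generalize γ .h = h at *
  generalize γ .x = x at *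
  generalize γ .H = H at *
  generalize γ .X = X at *
  have gx : g * x = q • (x * g) := inv_qcomm r.xh g1 g2
  have GX : G * X = q' • (X * G) := inv_qcomm r.XH G1 G2
  have Gx : G * x = σ • (x * G) := inv_qcomm r.xH G1 G2
  have Xg : X * g = σ • (g * X) := by
    calc X * g = g * (h * X) * g := by rw [← mul_assoc g, g2, one_mul]
      _ = σ • (g * X) := by
        rw [r.hX, mul_smul_comm, smul_mul_assoc, mul_assoc, mul_assoc, g1, mul_one]
  have gH : g * H = H * g := by
    simpa using inv_qcomm (q := (1 : k)) (by rw [one_smul, r.hH]) g1 g2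
  have Gg : G * g = g * G := by
    simpa using inv_qcomm (q := (1 : k)) (by rw [one_smul, gH]) G1 G2
  have Hh : g * G * (H * h) = 1 := by
    rw [mul_assoc, ← mul_assoc G, G2, one_mul, g2]
  constructor <;> apply MulOpposite.unop_injective <;>
    simp only [MulOpposite.unop_mul, MulOpposite.unop_pow, MulOpposite.unop_smul,
      MulOpposite.unop_op, MulOpposite.unop_one, MulOpposite.unop_zero, MulOpposite.unop_add,
      MulOpposite.unop_sub, mul_neg, neg_mul, neg_neg]
  · exact gm
  · exact Gn
  · rw [neg_pow, mul_pow_eq_zero_of_qcomm gx r.x_pow, mul_zero]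
  · rw [neg_pow, mul_pow_eq_zero_of_qcomm GX r.X_pow, mul_zero]
  · rw [← mul_assoc, gx, smul_mul_assoc, smul_neg]
  · rw [← mul_assoc, GX, smul_mul_assoc, smul_neg]
  · rw [← mul_assoc, Gx, smul_mul_assoc, mul_assoc, mul_assoc, Gg, smul_neg]
  · rw [mul_assoc, Gg, ← mul_assoc, Xg, smul_mul_assoc, mul_assoc, smul_neg]
  · have e1 : X * G * (x * g) = σ • (X * x * (g * G)) := by
      rw [mul_assoc, ← mul_assoc G, Gx, smul_mul_assoc, mul_smul_comm, mul_assoc x, Gg]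
      simp only [mul_assoc]
    have e2 : σ • (x * g * (X * G)) = x * X * (g * G) := by
      rw [mul_assoc, ← mul_assoc g, ← mul_smul_comm, ← smul_mul_assoc, ← Xg]
      simp only [mul_assoc]
    have e3 : H * h * (g * G) = 1 := by
      rw [mul_assoc, ← mul_assoc h, g1, one_mul, G1]
    rw [e1, e2, r.xX, add_mul, smul_mul_assoc, smul_mul_assoc, sub_mul, e3, add_assoc, ← smul_add]
    simp
  · exact Gg

/-- `S(h) = h⁻¹`, `S(H) = H⁻¹`, `S(x) = - x h⁻¹`, `S(X) = - X H⁻¹`, as an algebra map to the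
opposite algebra. Here `- x h⁻¹ = - q^{m-1} h^{m-1} x` and `- X H⁻¹ = - q'^{n-1} H^{n-1} X`. -/
noncomputable def antipodeHom : B →ₐ[k] Bᵐᵒᵖ :=
  lift (antipode_relations hq' hq σ α)

noncomputable instance : HopfAlgebra k B where
  antipode := unopLinear (antipodeHom hq' hq σ α)
  mul_antipode_rTensor_comul := antipode_left_of_adjoin _ (adjoin_eq_top hq' hq σ α) (by
    rintro _ ⟨_ | _ | _ | _, rfl⟩
    · simp [comul_h, counit_h, unopLinear_apply, antipodeHom, inv_mul_h]
    · simp [comul_x, counit_x, unopLinear_apply, antipodeHom, mul_assoc, inv_mul_h]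
    · simp [comul_H, counit_H, unopLinear_apply, antipodeHom, inv_mul_H]
    · simp [comul_X, counit_X, unopLinear_apply, antipodeHom, mul_assoc, inv_mul_H])
  mul_antipode_lTensor_comul := antipode_right_of_adjoin _ (adjoin_eq_top hq' hq σ α) (by
    rintro _ ⟨_ | _ | _ | _, rfl⟩
    · simp [comul_h, counit_h, unopLinear_apply, antipodeHom, h_mul_inv]
    · simp [comul_x, counit_x, unopLinear_apply, antipodeHom]
    · simp [comul_H, counit_H, unopLinear_apply, antipodeHom, H_mul_inv]
    · simp [comul_X, counit_X, unopLinear_apply, antipodeHom])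

end

end Bicross

/-- The Hopf algebra `T^σ_{n,m}(q', q)` generated by `h, x, H, X` subject to
`h^m = H^n = 1`, `x^m = X^n = 0`, `x h = q h x`, `X H = q' H X`,
`x H = σ H x`, `h X = σ X h`, `x X = σ X x`, `h H = H h`,
with `h, H` group-like, `x` an `(h, 1)`-primitive and `X` an `(H, 1)`-primitive element. -/
abbrev TaftT {m n : ℕ} {q q' : k} (hq' : IsPrimitiveRoot q' n) (hq : IsPrimitiveRoot q m)
    (σ : k) : Type u :=
  Bicross hq' hq σ 0

theorem isPrimitiveRoot_pow_sub_one {n : ℕ} [NeZero n] {q : k} (hq : IsPrimitiveRoot q n) :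
    IsPrimitiveRoot (q ^ (n - 1)) n :=
  hq.pow_of_coprime _ ((Nat.coprime_self_sub_left NeZero.one_le).2 (Nat.coprime_one_left n))

/-- The Hopf algebra `Q^α_n(q)` generated by `h, x, H, X` subject to
`h^n = H^n = 1`, `x^n = X^n = 0`, `x h = q h x`, `X H = q^{n-1} H X`,
`x H = q H x`, `h X = q X h`, `x X - q X x = α (1 - H h)`, `h H = H h`,
with `h, H` group-like, `x` an `(h, 1)`-primitive and `X` an `(H, 1)`-primitive element. -/
abbrev TaftQ {n : ℕ} [NeZero n] {q : k} (hq : IsPrimitiveRoot q n) (α : k) : Type u :=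
  Bicross (isPrimitiveRoot_pow_sub_one hq) hq q α

end Bicross

/-! ### The Drinfeld double -/

section Double

open Coalgebra HopfAlgebra WithConv

variable {k : Type u} [Field k] {H : Type v} [Ring H] [HopfAlgebra k H]

theorem coassoc_four : (TensorProduct.assoc k H H H).symm.toLinearMap.lTensor H ∘ₗ
      (TensorProduct.assoc k H H (H ⊗[k] H)).toLinearMap ∘ₗ TensorProduct.map comul comul ∘ₗ comul =
    (comul.rTensor H).lTensor H ∘ₗ (comul (R := k)).lTensor H ∘ₗ comul := by
  simp only [coassoc_simps]

theorem coassoc_five : (TensorProduct.assoc k H (H ⊗[k] H) H).symm.toLinearMap.lTensor H ∘ₗ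
      ((TensorProduct.assoc k H H H).symm.toLinearMap.lTensor H).lTensor H ∘ₗ
      (TensorProduct.assoc k H H (H ⊗[k] (H ⊗[k] H))).toLinearMap ∘ₗ
      TensorProduct.map comul (TensorProduct.map LinearMap.id comul) ∘ₗ comul.lTensor H ∘ₗ comul =
    ((comul.lTensor H ∘ₗ comul (R := k)).rTensor H).lTensor H ∘ₗ comul.lTensor H ∘ₗ comul := by
  simp only [coassoc_simps]

/-- The antipode is an anti-coalgebra map. -/
theorem comul_comp_antipode : comul ∘ₗ antipode k (A := H) =
    (TensorProduct.comm k H H).toLinearMap ∘ₗ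
      TensorProduct.map (antipode k) (antipode k) ∘ₗ comul := by
  apply WithConv.toConv_injective
  apply left_inv_eq_right_inv (a := toConv (comul (R := k) (A := H)))
  · have h1 := LinearMap.algHom_comp_convMul_distrib (Bialgebra.comulAlgHom k H)
      (toConv (antipode k (A := H))) (toConv LinearMap.id)
    rw [LinearMap.antipode_mul_id] at h1
    apply WithConv.ofConv_injective
    refine Eq.trans h1.symm ?_
    ext a
    simp [LinearMap.convOne_def]
  · let Ω : H ⊗[k] ((H ⊗[k] H) ⊗[k] H) →ₗ[k] H ⊗[k] H :=
      TensorProduct.map (LinearMap.mul' k H ∘ₗ (antipode k).lTensor H)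
        (LinearMap.mul' k H ∘ₗ (antipode k).lTensor H) ∘ₗ
      (TensorProduct.assoc k _ _ _).symm.toLinearMap ∘ₗ
      (TensorProduct.comm k (H ⊗[k] H) H).toLinearMap.lTensor H
    have e1 : LinearMap.mul' k (H ⊗[k] H) ∘ₗ TensorProduct.map LinearMap.id
        ((TensorProduct.comm k H H).toLinearMap ∘ₗ
          TensorProduct.map (antipode k) (antipode k)) =
        Ω ∘ₗ (TensorProduct.assoc k H H H).symm.toLinearMap.lTensor H ∘ₗ
          (TensorProduct.assoc k H H (H ⊗[k] H)).toLinearMap := by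
      ext x y z w
      simp [Ω]
    have e2 : Ω ∘ₗ (comul.rTensor H).lTensor H =
        TensorProduct.map (LinearMap.mul' k H ∘ₗ (antipode k).lTensor H) (Algebra.linearMap k H) ∘ₗ
        (TensorProduct.assoc k _ _ _).symm.toLinearMap ∘ₗ
        (TensorProduct.comm k k H).toLinearMap.lTensor H ∘ₗ (counit.rTensor H).lTensor H := by
      have e3 : LinearMap.mul' k H ∘ₗ (antipode k).lTensor H ∘ₗ comul =
        (Algebra.linearMap k H) ∘ₗ counit := mul_antipode_lTensor_comul
      have e4 : ∀ (x w : H) (t : H ⊗[k] H), Ω (x ⊗ₜ (t ⊗ₜ w)) = (x * antipode k w) ⊗ₜ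
          (LinearMap.mul' k H ((antipode k).lTensor H t)) := by
        intro x w t
        simp [Ω]
      ext x y w
      simp [e4]
    apply WithConv.ofConv_injective
    rw [LinearMap.convMul_def]
    ext a
    have e5 := LinearMap.congr_fun (coassoc_four (k := k) (H := H)) a
    have e6 := LinearMap.congr_fun e1 (TensorProduct.map comul comul (comul a))
    simp only [LinearMap.comp_apply] at e5 e6
    rw [e5] at e6
    have e7 := LinearMap.congr_fun e2 (comul.lTensor H (comul a))
    simp only [LinearMap.comp_apply] at e7
    rw [e7] at e6
    have e8 : ∀ t : H ⊗[k] H, (counit.rTensor H).lTensor H ((comul (R := k)).lTensor H t) =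
        (TensorProduct.mk k k H 1).lTensor H t := by
      intro t
      rw [← LinearMap.comp_apply, ← LinearMap.lTensor_comp, Coalgebra.rTensor_counit_comp_comul]
    rw [e8] at e6
    have e9 : ∀ t : H ⊗[k] H, TensorProduct.map (LinearMap.mul' k H ∘ₗ (antipode k).lTensor H)
        (Algebra.linearMap k H) ((TensorProduct.assoc k _ _ _).symm
        ((TensorProduct.comm k k H).toLinearMap.lTensor H ((TensorProduct.mk k k H 1).lTensor H t)))
        = (LinearMap.mul' k H ((antipode k).lTensor H t)) ⊗ₜ 1 := by
      intro t
      induction t with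
      | zero => simp
      | add x y hx hy => simp only [map_add, hx, hy, TensorProduct.add_tmul]
      | tmul x y => simp
    have e10 : TensorProduct.map LinearMap.id ((TensorProduct.comm k H H).toLinearMap ∘ₗ
          TensorProduct.map (antipode k) (antipode k)) (TensorProduct.map comul comul (comul a)) =
        TensorProduct.map comul ((TensorProduct.comm k H H).toLinearMap ∘ₗ
          TensorProduct.map (antipode k) (antipode k) ∘ₗ comul) (comul a) := by
      rw [← LinearMap.comp_apply, ← TensorProduct.map_comp]
      rfl
    rw [e10] at e6
    refine e6.trans ?_
    refine (e9 _).trans ?_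
    rw [mul_antipode_lTensor_comul_apply]
    rfl

/-- The inverse of the antipode. -/
noncomputable def antipodeInv (hS : Function.Bijective (antipode k (A := H))) : H →ₗ[k] H :=
  (LinearEquiv.ofBijective (antipode k) hS).symm.toLinearMap

section
variable (hS : Function.Bijective (antipode k (A := H)))

theorem antipode_antipodeInv (a : H) : antipode k (antipodeInv hS a) = a :=
  LinearEquiv.apply_symm_apply (LinearEquiv.ofBijective (antipode k) hS) a

theorem antipodeInv_antipode (a : H) : antipodeInv hS (antipode k a) = a :=
  LinearEquiv.symm_apply_apply (LinearEquiv.ofBijective (antipode k) hS) a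

theorem antipodeInv_one : antipodeInv hS 1 = 1 :=
  hS.1 (by rw [antipode_antipodeInv, antipode_one])

theorem antipodeInv_mul (a b : H) :
    antipodeInv hS (a * b) = antipodeInv hS b * antipodeInv hS a :=
  hS.1 (by simp only [antipode_antipodeInv, antipode_mul_antidistrib])

theorem counit_antipodeInv (a : H) : counit (R := k) (antipodeInv hS a) = counit (R := k) a := by
  rw [← counit_antipode, antipode_antipodeInv]

theorem comul_antipodeInv (a : H) : comul (R := k) (antipodeInv hS a) =
    TensorProduct.comm k H H (TensorProduct.map (antipodeInv hS) (antipodeInv hS) (comul a)) := by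
  have h1 := LinearMap.congr_fun (comul_comp_antipode (k := k) (H := H)) (antipodeInv hS a)
  simp only [LinearMap.comp_apply, antipode_antipodeInv] at h1
  rw [h1]
  generalize comul (R := k) (antipodeInv hS a) = t
  induction t with
  | zero => simp
  | add x y hx hy => simp only [map_add]; exact congrArg₂ _ hx hy
  | tmul x y => simp [antipodeInv_antipode]

end

variable (k H) in
/-- The dual space `H*` of a coalgebra with the convolution product
`(f g)(a) = f(a₍₁₎) g(a₍₂₎)` and unit `ε`. -/
abbrev ConvDual : Type (max u v) := WithConv (H →ₗ[k] k)

/-- `Δ²(h) = h₍₁₎ ⊗ h₍₂₎ ⊗ h₍₃₎`. -/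
noncomputable def comulTwo : H →ₐ[k] H ⊗[k] (H ⊗[k] H) :=
  (Algebra.TensorProduct.map (AlgHom.id k H) (Bialgebra.comulAlgHom k H)).comp
    (Bialgebra.comulAlgHom k H)

theorem comulTwo_apply (a : H) : comulTwo (k := k) a = comul.lTensor H (comul a) := rfl

variable (hS : Function.Bijective (antipode k (A := H)))

/-- The functional `f(S⁻¹(y) ? x)`. -/
noncomputable def coadj (x y : H) : ConvDual k H →ₗ[k] ConvDual k H where
  toFun f := toConv (f.ofConv ∘ₗ LinearMap.mulLeft k (antipodeInv hS y) ∘ₗ LinearMap.mulRight k x)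
  map_add' _ _ := rfl
  map_smul' _ _ := rfl

theorem coadj_apply (x y : H) (f : ConvDual k H) (a : H) :
    coadj hS x y f a = f (antipodeInv hS y * (a * x)) := rfl

theorem coadj_add_left (x x' y : H) : coadj hS (x + x') y = coadj hS x y + coadj hS x' y := by
  ext f a
  simp [coadj_apply, mul_add]

theorem coadj_smul_left (c : k) (x y : H) : coadj hS (c • x) y = c • coadj hS x y := by
  ext f a
  simp [coadj_apply]

theorem coadj_add_right (x y y' : H) : coadj hS x (y + y') = coadj hS x y + coadj hS x y' := by
  ext f a
  simp [coadj_apply, add_mul]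

theorem coadj_smul_right (c : k) (x y : H) : coadj hS x (c • y) = c • coadj hS x y := by
  ext f a
  simp [coadj_apply]

theorem coadj_mul (x x' y y' : H) (f : ConvDual k H) :
    coadj hS (x * x') (y * y') f = coadj hS x y (coadj hS x' y' f) := by
  ext a
  simp only [coadj_apply, antipodeInv_mul, mul_assoc]

theorem coadj_one_one (f : ConvDual k H) : coadj hS 1 1 f = f := by
  ext a
  simp only [coadj_apply, antipodeInv_one, one_mul, mul_one]

theorem coadj_unit (x y : H) : coadj hS x y 1 = (counit (R := k) x * counit (R := k) y) • 1 := by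
  ext a
  change counit (R := k) (antipodeInv hS y * (a * x)) =
    (counit (R := k) x * counit (R := k) y) • counit (R := k) a
  simp only [Bialgebra.counit_mul, counit_antipodeInv, smul_eq_mul]
  ring

/-- The linear map `x ⊗ y ↦ (f ↦ f(S⁻¹(y) ? x))`. -/
noncomputable def coadjHom : H ⊗[k] H →ₗ[k] ConvDual k H →ₗ[k] ConvDual k H :=
  TensorProduct.lift (LinearMap.mk₂ k (coadj hS) (coadj_add_left hS) (coadj_smul_left hS)
    (coadj_add_right hS) (coadj_smul_right hS))

theorem coadjHom_tmul (x y : H) : coadjHom hS (x ⊗ₜ y) = coadj hS x y := rfl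

end Double

section Double

open Coalgebra HopfAlgebra WithConv

variable {k : Type u} [Field k] {H : Type v} [Ring H] [HopfAlgebra k H]
  (hS : Function.Bijective (antipode k (A := H)))

/-- `(x₁ ⊗ x₂) ⊗ (y₁ ⊗ y₂) ↦ f(S⁻¹(y₂) ? x₁) g(S⁻¹(y₁) ? x₂)`. -/
noncomputable def coadjMul (f g : ConvDual k H) : (H ⊗[k] H) ⊗[k] (H ⊗[k] H) →ₗ[k] ConvDual k H :=
  LinearMap.mul' k (ConvDual k H) ∘ₗ
    TensorProduct.map ((coadjHom hS).flip f) ((coadjHom hS).flip g) ∘ₗ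
    (TensorProduct.tensorTensorTensorComm k H H H H).toLinearMap ∘ₗ
    (TensorProduct.comm k H H).toLinearMap.lTensor (H ⊗[k] H)

theorem coadjMul_tmul (f g : ConvDual k H) (x₁ x₂ y₁ y₂ : H) :
    coadjMul hS f g ((x₁ ⊗ₜ x₂) ⊗ₜ (y₁ ⊗ₜ y₂)) = coadj hS x₁ y₂ f * coadj hS x₂ y₁ g := rfl

theorem coadj_convMul (x y : H) (f g : ConvDual k H) :
    coadj hS x y (f * g) = coadjMul hS f g (comul x ⊗ₜ comul y) := by
  ext a
  rw [coadj_apply, LinearMap.convMul_apply, Bialgebra.comul_mul, Bialgebra.comul_mul,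
    comul_antipodeInv]
  generalize comul (R := k) x = s
  generalize comul (R := k) y = t
  induction s with
  | zero => simp
  | add s s' hs hs' =>
    simp only [mul_add, map_add, TensorProduct.add_tmul, hs, hs']
    rfl
  | tmul x₁ x₂ =>
    induction t with
    | zero => simp
    | add t t' ht ht' =>
      simp only [add_mul, map_add, TensorProduct.tmul_add, ht, ht']
      rfl
    | tmul y₁ y₂ =>
      rw [coadjMul_tmul, LinearMap.convMul_apply]
      generalize comul (R := k) a = r
      induction r with
      | zero => simp
      | add r r' hr hr' => simp only [add_mul, mul_add, map_add, hr, hr']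
      | tmul a₁ a₂ =>
        simp only [TensorProduct.map_tmul, TensorProduct.comm_tmul,
          Algebra.TensorProduct.tmul_mul_tmul, LinearMap.mul'_apply]
        rfl

/-- The bilinear map `(x ⊗ y ⊗ z, g) ↦ g(S⁻¹(z) ? x) ⊗ y`. -/
noncomputable def twist :
    H ⊗[k] (H ⊗[k] H) →ₗ[k] ConvDual k H →ₗ[k] ConvDual k H ⊗[k] H :=
  LinearMap.mk₂ k (fun u g => TensorProduct.map ((coadjHom hS).flip g) LinearMap.id
    ((TensorProduct.assoc k H H H).symm
      ((TensorProduct.comm k H H).toLinearMap.lTensor H u)))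
    (fun u u' g => by simp only [map_add])
    (fun c u g => by simp only [map_smul])
    (fun u g g' => by simp only [map_add, TensorProduct.map_add_left, LinearMap.add_apply])
    (fun c u g => by simp only [map_smul, TensorProduct.map_smul_left, LinearMap.smul_apply])

theorem twist_tmul (x y z : H) (g : ConvDual k H) :
    twist hS (x ⊗ₜ (y ⊗ₜ z)) g = coadj hS x z g ⊗ₜ y := rfl

/-- The multiplication `(f ⊗ h)(g ⊗ t) = f g(S⁻¹(h₍₃₎) ? h₍₁₎) ⊗ h₍₂₎ t`. -/
noncomputable def doubleMul :
    ConvDual k H ⊗[k] H →ₗ[k] ConvDual k H ⊗[k] H →ₗ[k] ConvDual k H ⊗[k] H :=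
  TensorProduct.lift (LinearMap.mk₂ k
    (fun f h => TensorProduct.lift (LinearMap.mk₂ k
      (fun g t => TensorProduct.map (LinearMap.mul k (ConvDual k H) f) ((LinearMap.mul k H).flip t)
        (twist hS (comulTwo h) g))
      (fun g g' t => by simp only [map_add])
      (fun c g t => by simp only [map_smul])
      (fun g t t' => by simp only [map_add, TensorProduct.map_add_right, LinearMap.add_apply])
      (fun c g t => by
        simp only [map_smul, TensorProduct.map_smul_right, LinearMap.smul_apply])))
    (fun f f' h => by
      ext g t
      simp only [map_add, TensorProduct.map_add_left, LinearMap.add_apply,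
        TensorProduct.AlgebraTensorModule.curry_apply, LinearMap.restrictScalars_self,
        TensorProduct.curry_apply, TensorProduct.lift.tmul, LinearMap.mk₂_apply])
    (fun c f h => by
      ext g t
      simp only [map_smul, TensorProduct.map_smul_left, LinearMap.smul_apply,
        TensorProduct.AlgebraTensorModule.curry_apply, LinearMap.restrictScalars_self,
        TensorProduct.curry_apply, TensorProduct.lift.tmul, LinearMap.mk₂_apply])
    (fun f h h' => by
      ext g t
      simp only [map_add, LinearMap.add_apply,
        TensorProduct.AlgebraTensorModule.curry_apply, LinearMap.restrictScalars_self,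
        TensorProduct.curry_apply, TensorProduct.lift.tmul, LinearMap.mk₂_apply])
    (fun c f h => by
      ext g t
      simp only [map_smul, LinearMap.smul_apply,
        TensorProduct.AlgebraTensorModule.curry_apply, LinearMap.restrictScalars_self,
        TensorProduct.curry_apply, TensorProduct.lift.tmul, LinearMap.mk₂_apply]))

theorem doubleMul_tmul (f g : ConvDual k H) (h t : H) :
    doubleMul hS (f ⊗ₜ h) (g ⊗ₜ t) =
      TensorProduct.map (LinearMap.mul k (ConvDual k H) f) ((LinearMap.mul k H).flip t)
        (twist hS (comulTwo h) g) := rfl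

/-- `g ⊗ t ↦ Σ g(S⁻¹(z) ? x) ⊗ y t` for `u = Σ x ⊗ y ⊗ z`. -/
noncomputable def leftStep (u : H ⊗[k] (H ⊗[k] H)) :
    ConvDual k H ⊗[k] H →ₗ[k] ConvDual k H ⊗[k] H :=
  TensorProduct.lift (LinearMap.mk₂ k
    (fun g t => TensorProduct.map LinearMap.id ((LinearMap.mul k H).flip t) (twist hS u g))
    (fun g g' t => by simp only [map_add])
    (fun c g t => by simp only [map_smul])
    (fun g t t' => by simp only [map_add, TensorProduct.map_add_right, LinearMap.add_apply])
    (fun c g t => by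
      simp only [map_smul, TensorProduct.map_smul_right, LinearMap.smul_apply]))

theorem leftStep_tmul (u : H ⊗[k] (H ⊗[k] H)) (g : ConvDual k H) (t : H) :
    leftStep hS u (g ⊗ₜ t) =
      TensorProduct.map LinearMap.id ((LinearMap.mul k H).flip t) (twist hS u g) := rfl

/-- `f ⊗ h ↦ Σ f g(S⁻¹(h₍₃₎) ? h₍₁₎) ⊗ h₍₂₎`. -/
noncomputable def rightStep (g : ConvDual k H) :
    ConvDual k H ⊗[k] H →ₗ[k] ConvDual k H ⊗[k] H :=
  TensorProduct.lift (LinearMap.mk₂ k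
    (fun f h => TensorProduct.map (LinearMap.mul k (ConvDual k H) f) LinearMap.id
      (twist hS (comulTwo h) g))
    (fun f f' h => by simp only [map_add, TensorProduct.map_add_left, LinearMap.add_apply])
    (fun c f h => by simp only [map_smul, TensorProduct.map_smul_left, LinearMap.smul_apply])
    (fun f h h' => by simp only [map_add, LinearMap.add_apply])
    (fun c f h => by simp only [map_smul, LinearMap.smul_apply]))

theorem rightStep_tmul (f g : ConvDual k H) (h : H) :
    rightStep hS g (f ⊗ₜ h) =
      TensorProduct.map (LinearMap.mul k (ConvDual k H) f) LinearMap.id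
        (twist hS (comulTwo h) g) := rfl

theorem twist_mul (u v : H ⊗[k] (H ⊗[k] H)) (g : ConvDual k H) :
    twist hS (u * v) g = leftStep hS u (twist hS v g) := by
  induction v with
  | zero => simp
  | add v v' hv hv' => simp only [mul_add, map_add, LinearMap.add_apply, hv, hv']
  | tmul p v =>
    induction v with
    | zero => simp
    | add v v' hv hv' =>
      simp only [TensorProduct.tmul_add, mul_add, map_add, LinearMap.add_apply, hv, hv']
    | tmul q r =>
      rw [twist_tmul, leftStep_tmul]
      induction u with
      | zero => simp
      | add u u' hu hu' => simp only [add_mul, map_add, LinearMap.add_apply, hu, hu']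
      | tmul x u =>
        induction u with
        | zero => simp
        | add u u' hu hu' =>
          simp only [TensorProduct.tmul_add, add_mul, map_add, LinearMap.add_apply, hu, hu']
        | tmul y z =>
          rw [Algebra.TensorProduct.tmul_mul_tmul, Algebra.TensorProduct.tmul_mul_tmul, twist_tmul,
            twist_tmul, coadj_mul]
          rfl

/-- `x ⊗ ((p ⊗ (q ⊗ r)) ⊗ z) ↦ f(S⁻¹(z) ? x) g(S⁻¹(r) ? p) ⊗ q`. -/
noncomputable def twistTwo (f g : ConvDual k H) :
    H ⊗[k] ((H ⊗[k] (H ⊗[k] H)) ⊗[k] H) →ₗ[k] ConvDual k H ⊗[k] H :=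
  (LinearMap.mul' k (ConvDual k H)).rTensor H ∘ₗ
    (TensorProduct.assoc k _ _ _).symm.toLinearMap ∘ₗ
    TensorProduct.map ((coadjHom hS).flip f) ((twist hS).flip g) ∘ₗ
    (TensorProduct.assoc k _ _ _).symm.toLinearMap ∘ₗ
    (TensorProduct.comm k _ H).toLinearMap.lTensor H

theorem twistTwo_tmul (f g : ConvDual k H) (x p q r z : H) :
    twistTwo hS f g (x ⊗ₜ ((p ⊗ₜ (q ⊗ₜ r)) ⊗ₜ z)) = (coadj hS x z f * coadj hS p r g) ⊗ₜ q := rfl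

theorem twist_convMul_left (u : H ⊗[k] (H ⊗[k] H)) (f g : ConvDual k H) :
    twist hS u (f * g) = twistTwo hS f g
      ((TensorProduct.assoc k H (H ⊗[k] H) H).symm.toLinearMap.lTensor H
      (((TensorProduct.assoc k H H H).symm.toLinearMap.lTensor H).lTensor H
      ((TensorProduct.assoc k H H (H ⊗[k] (H ⊗[k] H))).toLinearMap
      (TensorProduct.map comul (TensorProduct.map LinearMap.id comul) u)))) := by
  induction u with
  | zero => simp
  | add u u' hu hu' => simp only [map_add, LinearMap.add_apply, hu, hu']
  | tmul x u =>
    induction u with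
    | zero => simp
    | add u u' hu hu' =>
      simp only [TensorProduct.tmul_add, map_add, LinearMap.add_apply, hu, hu']
    | tmul y z =>
      rw [twist_tmul, coadj_convMul, TensorProduct.map_tmul, TensorProduct.map_tmul]
      generalize comul (R := k) x = s
      generalize comul (R := k) z = t
      induction s with
      | zero => simp
      | add s s' hs hs' => simp only [TensorProduct.add_tmul, map_add, hs, hs']
      | tmul x₁ x₂ =>
        induction t with
        | zero => simp
        | add t t' ht ht' =>
          simp only [TensorProduct.add_tmul, TensorProduct.tmul_add, map_add, ht, ht']
        | tmul y₁ y₂ =>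
          rw [coadjMul_tmul, ← twistTwo_tmul]
          rfl

theorem rightStep_twist (u : H ⊗[k] (H ⊗[k] H)) (f g : ConvDual k H) :
    rightStep hS g (twist hS u f) = twistTwo hS f g
      (((comul.lTensor H ∘ₗ comul (R := k)).rTensor H).lTensor H u) := by
  induction u with
  | zero => simp
  | add u u' hu hu' => simp only [map_add, LinearMap.add_apply, hu, hu']
  | tmul x u =>
    induction u with
    | zero => simp
    | add u u' hu hu' =>
      simp only [TensorProduct.tmul_add, map_add, LinearMap.add_apply, hu, hu']
    | tmul y z =>
      rw [twist_tmul, rightStep_tmul, LinearMap.lTensor_tmul,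
        LinearMap.rTensor_tmul, LinearMap.comp_apply, ← comulTwo_apply]
      generalize comulTwo (k := k) y = v
      induction v with
      | zero => simp
      | add v v' hv hv' =>
        simp only [TensorProduct.add_tmul, TensorProduct.tmul_add, map_add, LinearMap.add_apply,
          hv, hv']
      | tmul p v =>
        induction v with
        | zero => simp
        | add v v' hv hv' =>
          simp only [TensorProduct.add_tmul, TensorProduct.tmul_add, map_add, LinearMap.add_apply,
            hv, hv']
        | tmul q r =>
          rw [twistTwo_tmul, twist_tmul]
          rfl

theorem twist_convMul (h : H) (f g : ConvDual k H) :
    twist hS (comulTwo h) (f * g) = rightStep hS g (twist hS (comulTwo h) f) := by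
  have h5 := LinearMap.congr_fun (coassoc_five (k := k) (H := H)) h
  simp only [LinearMap.comp_apply, ← comulTwo_apply] at h5
  rw [twist_convMul_left, h5, rightStep_twist]

theorem twist_comulTwo_one (g : ConvDual k H) :
    twist hS (comulTwo 1) g = g ⊗ₜ 1 := by
  rw [map_one]
  change twist hS (1 ⊗ₜ (1 ⊗ₜ 1)) g = _
  rw [twist_tmul, coadj_one_one]

theorem twist_comulTwo_unit (h : H) :
    twist hS (comulTwo h) 1 = 1 ⊗ₜ h := by
  have h1 : ∀ u : H ⊗[k] (H ⊗[k] H), twist hS u 1 = 1 ⊗ₜ (TensorProduct.rid k H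
      (TensorProduct.lid k (H ⊗[k] k) (TensorProduct.map counit
        (TensorProduct.map LinearMap.id counit) u))) := by
    intro u
    induction u with
    | zero => simp
    | add u u' hu hu' => simp only [map_add, LinearMap.add_apply, hu, hu', TensorProduct.tmul_add]
    | tmul x u =>
      induction u with
      | zero => simp
      | add u u' hu hu' =>
        simp only [TensorProduct.tmul_add, map_add, LinearMap.add_apply, hu, hu']
      | tmul y z =>
        rw [twist_tmul, coadj_unit]
        simp [TensorProduct.smul_tmul, smul_smul]
  rw [h1, comulTwo_apply]
  have h2 : ∀ t : H ⊗[k] H, TensorProduct.map (counit (R := k))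
      (TensorProduct.map LinearMap.id (counit (R := k))) ((comul (R := k)).lTensor H t) =
      ((TensorProduct.mk k H k).flip 1).lTensor k ((counit (R := k)).rTensor H t) := by
    intro t
    induction t with
    | zero => simp
    | add t t' ht ht' => simp only [map_add, ht, ht']
    | tmul x y =>
      have := Coalgebra.lTensor_counit_comul (R := k) y
      simp only [LinearMap.lTensor_tmul, TensorProduct.map_tmul, LinearMap.rTensor_tmul]
      rw [← LinearMap.lTensor_def, this]
      rfl
  rw [h2, Coalgebra.rTensor_counit_comul]
  simp

/-- `w ↦ (f ⊗ 1) w (1 ⊗ t)`. -/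
noncomputable def outer (f : ConvDual k H) (t : H) :
    ConvDual k H ⊗[k] H →ₗ[k] ConvDual k H ⊗[k] H :=
  TensorProduct.map (LinearMap.mul k (ConvDual k H) f) ((LinearMap.mul k H).flip t)

theorem outer_tmul (f g : ConvDual k H) (s t : H) : outer f t (g ⊗ₜ[k] s) = (f * g) ⊗ₜ (s * t) :=
  rfl

theorem doubleMul_tmul' (f g : ConvDual k H) (h t : H) :
    doubleMul hS (f ⊗ₜ h) (g ⊗ₜ t) = outer f t (twist hS (comulTwo h) g) := rfl

theorem outer_outer (f g : ConvDual k H) (s t : H) (w : ConvDual k H ⊗[k] H) :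
    outer f s (outer g t w) = outer (f * g) (t * s) w := by
  induction w with
  | zero => simp only [map_zero]
  | add w w' hw hw' => simp only [map_add, hw, hw']
  | tmul e x => simp only [outer_tmul, mul_assoc]

theorem doubleMul_outer_right (f g : ConvDual k H) (h s : H) (w : ConvDual k H ⊗[k] H) :
    doubleMul hS (f ⊗ₜ h) (outer g s w) =
      outer f s (doubleMul hS (1 ⊗ₜ h) (outer g 1 w)) := by
  induction w with
  | zero => simp only [map_zero]
  | add w w' hw hw' => simp only [map_add, hw, hw']
  | tmul e x =>
    rw [outer_tmul, outer_tmul, doubleMul_tmul', doubleMul_tmul', outer_outer, mul_one, mul_one]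

theorem doubleMul_outer_left (f e : ConvDual k H) (t s : H) (v : ConvDual k H ⊗[k] H) :
    doubleMul hS (outer f t v) (e ⊗ₜ s) =
      outer f s (doubleMul hS (outer 1 t v) (e ⊗ₜ 1)) := by
  induction v with
  | zero => simp only [map_zero, LinearMap.zero_apply]
  | add w w' hw hw' => simp only [map_add, LinearMap.add_apply, hw, hw']
  | tmul g x =>
    rw [outer_tmul, outer_tmul, doubleMul_tmul', doubleMul_tmul', outer_outer, one_mul, one_mul]

theorem doubleMul_leftStep (g : ConvDual k H) (h : H) (w : ConvDual k H ⊗[k] H) :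
    outer g 1 (leftStep hS (comulTwo h) w) = doubleMul hS (g ⊗ₜ h) w := by
  induction w with
  | zero => simp only [map_zero]
  | add w w' hw hw' => simp only [map_add, hw, hw']
  | tmul e t =>
    rw [leftStep_tmul, doubleMul_tmul']
    generalize twist hS (comulTwo h) e = y
    induction y with
    | zero => simp only [map_zero]
    | add y y' hy hy' => simp only [map_add, hy, hy']
    | tmul a b =>
      rw [TensorProduct.map_tmul, outer_tmul, outer_tmul, mul_one]
      rfl

theorem doubleMul_rightStep (e : ConvDual k H) (t : H) (v : ConvDual k H ⊗[k] H) :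
    outer 1 t (rightStep hS e v) = doubleMul hS v (e ⊗ₜ t) := by
  induction v with
  | zero => simp only [map_zero, LinearMap.zero_apply]
  | add w w' hw hw' => simp only [map_add, hw, hw', LinearMap.add_apply]
  | tmul g h =>
    rw [rightStep_tmul, doubleMul_tmul']
    generalize twist hS (comulTwo h) e = y
    induction y with
    | zero => simp only [map_zero]
    | add y y' hy hy' => simp only [map_add, hy, hy']
    | tmul a b =>
      rw [TensorProduct.map_tmul, outer_tmul, outer_tmul, one_mul]
      rfl

theorem doubleMul_key (h t : H) (g e : ConvDual k H) :
    doubleMul hS (outer 1 t (twist hS (comulTwo h) g)) (e ⊗ₜ 1) =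
      doubleMul hS (1 ⊗ₜ h) (outer g 1 (twist hS (comulTwo t) e)) := by
  have hL : ∀ v : ConvDual k H ⊗[k] H, doubleMul hS (outer 1 t v) (e ⊗ₜ 1) =
      doubleMul hS v (twist hS (comulTwo t) e) := by
    intro v
    induction v with
    | zero => simp only [map_zero, LinearMap.zero_apply]
    | add v v' hv hv' => simp only [map_add, LinearMap.add_apply, hv, hv']
    | tmul g' h' =>
      rw [outer_tmul, doubleMul_tmul', map_mul, twist_mul, one_mul, doubleMul_leftStep]
  rw [hL]
  generalize twist hS (comulTwo t) e = w
  induction w with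
  | zero => simp only [map_zero]
  | add w w' hw hw' => simp only [map_add, hw, hw']
  | tmul e' t' =>
    rw [outer_tmul, doubleMul_tmul', twist_convMul, mul_one, doubleMul_rightStep]

theorem doubleMul_assoc (a b c : ConvDual k H ⊗[k] H) :
    doubleMul hS (doubleMul hS a b) c = doubleMul hS a (doubleMul hS b c) := by
  induction a with
  | zero => simp only [map_zero, LinearMap.zero_apply]
  | add a a' ha ha' => simp only [map_add, LinearMap.add_apply, ha, ha']
  | tmul f h =>
  induction b with
  | zero => simp only [map_zero, LinearMap.zero_apply]
  | add b b' hb hb' => simp only [map_add, LinearMap.add_apply, hb, hb']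
  | tmul g t =>
  induction c with
  | zero => simp only [map_zero, LinearMap.zero_apply]
  | add c c' hc hc' => simp only [map_add, hc, hc']
  | tmul e s =>
  rw [doubleMul_tmul', doubleMul_tmul', doubleMul_outer_left, doubleMul_outer_right, doubleMul_key]

theorem doubleMul_one (a : ConvDual k H ⊗[k] H) : doubleMul hS a (1 ⊗ₜ 1) = a := by
  induction a with
  | zero => simp only [map_zero, LinearMap.zero_apply]
  | add a a' ha ha' => simp only [map_add, LinearMap.add_apply, ha, ha']
  | tmul f h => rw [doubleMul_tmul', twist_comulTwo_unit, outer_tmul, mul_one, mul_one]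

theorem one_doubleMul (a : ConvDual k H ⊗[k] H) : doubleMul hS (1 ⊗ₜ 1) a = a := by
  induction a with
  | zero => simp only [map_zero, LinearMap.zero_apply]
  | add a a' ha ha' => simp only [map_add, ha, ha']
  | tmul f h => rw [doubleMul_tmul', twist_comulTwo_one, outer_tmul, one_mul, one_mul]

end Double

section Double

open Coalgebra HopfAlgebra WithConv

variable {k : Type u} [Field k] {H : Type v} [Ring H] [HopfAlgebra k H]

/-- The Drinfeld double `D(H) = (H*)^cop ⋈ H` of a finite-dimensional Hopf algebra `H` with
bijective antipode: the space `H* ⊗ H` with the multiplication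
`(f ⊗ h)(g ⊗ t) = f g(S⁻¹(h₍₃₎) ? h₍₁₎) ⊗ h₍₂₎ t`, the unit `ε ⊗ 1`
and the tensor product coalgebra structure of `(H*)^cop ⊗ H`. -/
def DrinfeldDouble (_hS : Function.Bijective (antipode k (A := H))) : Type (max u v) :=
  ConvDual k H ⊗[k] H

namespace DrinfeldDouble

variable (hS : Function.Bijective (antipode k (A := H)))

noncomputable instance : AddCommGroup (DrinfeldDouble hS) :=
  inferInstanceAs (AddCommGroup (ConvDual k H ⊗[k] H))

noncomputable instance : Module k (DrinfeldDouble hS) :=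
  inferInstanceAs (Module k (ConvDual k H ⊗[k] H))

noncomputable instance : Ring (DrinfeldDouble hS) where
  mul a b := doubleMul hS a b
  one := (1 : ConvDual k H) ⊗ₜ[k] (1 : H)
  mul_assoc := doubleMul_assoc hS
  one_mul := one_doubleMul hS
  mul_one := doubleMul_one hS
  left_distrib a b c := map_add (doubleMul hS a) b c
  right_distrib a b c := LinearMap.map_add₂ (doubleMul hS) a b c
  zero_mul a := LinearMap.map_zero₂ (doubleMul hS) a
  mul_zero a := map_zero (doubleMul hS a)
  zsmul := (· • ·)
  zsmul_zero' a := SubNegMonoid.zsmul_zero' a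
  zsmul_succ' n a := SubNegMonoid.zsmul_succ' n a
  zsmul_neg' n a := SubNegMonoid.zsmul_neg' n a
  neg_add_cancel := neg_add_cancel
  sub_eq_add_neg := sub_eq_add_neg

noncomputable instance : Algebra k (DrinfeldDouble hS) :=
  Algebra.ofModule (fun c a b => LinearMap.map_smul₂ (doubleMul hS) c a b)
    (fun c a b => map_smul (doubleMul hS a) c b)

/-- The element `f ⊗ h` of the Drinfeld double. -/
noncomputable def mk (f : ConvDual k H) (h : H) : DrinfeldDouble hS := f ⊗ₜ[k] h

end DrinfeldDouble

variable [Module.Finite k H]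

variable (k H) in
/-- The comultiplication of `(H*)^cop`: `Δ(f)` is the element `f₍₁₎ ⊗ f₍₂₎` of `H* ⊗ H*` with
`f₍₁₎(a) f₍₂₎(b) = f(b a)` for all `a` and `b`. -/
noncomputable def dualComulCop : ConvDual k H →ₗ[k] ConvDual k H ⊗[k] ConvDual k H :=
  TensorProduct.map (WithConv.linearEquiv k (H →ₗ[k] k)).symm.toLinearMap
      (WithConv.linearEquiv k (H →ₗ[k] k)).symm.toLinearMap ∘ₗ
    (TensorProduct.dualDistribEquiv k H H).symm.toLinearMap ∘ₗ
    (LinearMap.mul' k H ∘ₗ (TensorProduct.comm k H H).toLinearMap).dualMap ∘ₗ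
    (WithConv.linearEquiv k (H →ₗ[k] k)).toLinearMap

/-- The defining property of `dualComulCop`. -/
theorem dualComulCop_apply (f : ConvDual k H) (a b : H) :
    TensorProduct.dualDistrib k H H
      (TensorProduct.map (WithConv.linearEquiv k (H →ₗ[k] k)).toLinearMap
        (WithConv.linearEquiv k (H →ₗ[k] k)).toLinearMap (dualComulCop k H f)) (a ⊗ₜ b) =
      f (b * a) := by
  simp only [dualComulCop, LinearMap.comp_apply]
  rw [← LinearMap.comp_apply (TensorProduct.map _ _) (TensorProduct.map _ _),
    ← TensorProduct.map_comp, LinearEquiv.comp_symm, TensorProduct.map_id, LinearMap.id_apply]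
  have := (TensorProduct.dualDistribEquiv k H H).apply_symm_apply
    ((LinearMap.mul' k H ∘ₗ (TensorProduct.comm k H H).toLinearMap).dualMap f.ofConv)
  exact LinearMap.congr_fun this (a ⊗ₜ b)

noncomputable instance (hS : Function.Bijective (antipode k (A := H))) :
    CoalgebraStruct k (DrinfeldDouble hS) where
  comul := (TensorProduct.tensorTensorTensorComm k (ConvDual k H) (ConvDual k H) H H).toLinearMap ∘ₗ
    TensorProduct.map (dualComulCop k H) comul
  counit := LinearMap.mul' k k ∘ₗ TensorProduct.map
    (LinearMap.applyₗ (1 : H) ∘ₗ (WithConv.linearEquiv k (H →ₗ[k] k)).toLinearMap) counit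

theorem DrinfeldDouble.mk_mul_mk (hS : Function.Bijective (antipode k (A := H)))
    (f g : ConvDual k H) (h t : H) :
    mk hS f h * mk hS g t = TensorProduct.map (LinearMap.mul k (ConvDual k H) f)
      ((LinearMap.mul k H).flip t) (twist hS (comul.lTensor H (comul h)) g) := rfl

theorem DrinfeldDouble.counit_mk (hS : Function.Bijective (antipode k (A := H)))
    (f : ConvDual k H) (h : H) : counit (R := k) (mk hS f h) = f 1 * counit (R := k) h := rfl

end Double

/-! ### Automorphism groups -/

section Aut

/-- Bialgebra automorphisms form a group under composition. As bialgebra maps between Hopf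
algebras commute with the antipodes, these are the Hopf algebra automorphisms. -/
instance bialgEquivGroup {k : Type u} [CommSemiring k] {A : Type v} [Semiring A] [Algebra k A]
    [CoalgebraStruct k A] : Group (A ≃ₐc[k] A) where
  mul f g := g.trans f
  one := BialgEquiv.refl k A
  inv f := f.symm
  mul_assoc _ _ _ := rfl
  one_mul _ := rfl
  mul_one _ := rfl
  inv_mul_cancel f := BialgEquiv.ext fun x => f.symm_apply_apply x

/-- The group of Hopf algebra automorphisms. -/
abbrev HopfAut (k : Type u) [CommSemiring k] (A : Type v) [Semiring A] [Algebra k A]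
    [CoalgebraStruct k A] : Type v :=
  A ≃ₐc[k] A

/-- The action of `ℤ/2` on a group by an automorphism `e` with `e² = 1`, where the class of `1`
acts as `e`. -/
def involutionAction {G : Type u} [Group G] (e : MulAut G) (he : e * e = 1) :
    Multiplicative (ZMod 2) →* MulAut G where
  toFun z := if z = 1 then 1 else e
  map_one' := if_pos rfl
  map_mul' a b := by
    have h2 : ∀ z : Multiplicative (ZMod 2), z = 1 ∨ z = Multiplicative.ofAdd 1 := by decide
    have h3 : (Multiplicative.ofAdd 1 : Multiplicative (ZMod 2)) ≠ 1 := by decide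
    have h4 : (Multiplicative.ofAdd 1 * Multiplicative.ofAdd 1 : Multiplicative (ZMod 2)) = 1 := by
      decide
    rcases h2 a with rfl | rfl <;> rcases h2 b with rfl | rfl <;> simp [h3, h4, he]

/-- The action `τ` of `ℤ/2` on `G × G` with `τ(1)(a, b) = (b, a)`. -/
def swapAction (G : Type u) [Group G] : Multiplicative (ZMod 2) →* MulAut (G × G) :=
  involutionAction (MulEquiv.prodComm : G × G ≃* G × G) (MulEquiv.ext fun _ => rfl)

/-- The action `κ` of `ℤ/2` on a commutative group `G` with `κ(1)(a) = a⁻¹`. -/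
def invAction (G : Type u) [CommGroup G] : Multiplicative (ZMod 2) →* MulAut G :=
  involutionAction (MulEquiv.inv G) (MulEquiv.ext fun a => inv_inv a)

theorem swapAction_one (G : Type u) [Group G] (a b : G) :
    swapAction G (Multiplicative.ofAdd 1) (a, b) = (b, a) := rfl

theorem invAction_one (G : Type u) [CommGroup G] (a : G) :
    invAction G (Multiplicative.ofAdd 1) a = a⁻¹ := rfl

end Aut

end TaftBicrossed

/-!
Multiplication identifies `T^σ_{n,m}` and `Q^1_n(q)`, as coalgebras, with the tensor product of the
two Taft algebras generated by `H, X` and by `h, x`. For `T^σ_{n,m}` this is seen on an explicit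
module structure on the tensor product. In a Taft algebra a skew derivation `ξ` with `ξ(x) = 1` acts
by hits which lower the degree in `x`, so an element killed by them is determined by its part in the
span of the powers of `h`; this yields the group-likes and skew primitives of a Taft algebra, and
then those of the tensor product. Up to a multiple of `1 - g`, the only skew primitives are the
multiples of `x` and of `X`. A Hopf automorphism respects `x h = q h x`, so it either fixes `h`, `H`
and scales `x`, `X`, or exchanges the two Taft algebras. Scalings by `(a, b)` have to preserve
`x X = σ X x + α (1 - H h)`, which for `α = 1` means `a b = 1`; an exchange forces `q = q̄` and
`σ² = 1`.

The powers of a character and of `ξ` identify the dual of a Taft algebra with the Taft algebra of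
`q⁻¹`. Under this identification the cross relations of the Drinfeld double become those of
`Q^1_n(q)`, so that the two Hopf algebras coincide; this also shows that the multiplication map of
`Q^1_n(q)` is injective.
-/

namespace TaftBicrossed

open Coalgebra HopfAlgebra WithConv

section Generation

theorem eq_top_of_adjoin_mul_mem {k A : Type*} [CommSemiring k] [Semiring A] [Algebra k A]
    {s : Set A} (hs : Algebra.adjoin k s = ⊤) {V : Submodule k A} (one_mem : 1 ∈ V)
    (mul_mem : ∀ a ∈ s, ∀ b ∈ V, a * b ∈ V) : V = ⊤ := by
  rw [eq_top_iff, ← Algebra.top_toSubmodule, ← hs, Algebra.adjoin_eq_span, Submodule.span_le]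
  intro a ha
  induction ha using Submonoid.closure_induction_left with
  | one => exact one_mem
  | mul_left a ha b _ hb => exact mul_mem a ha b hb

theorem adjoin_le_span_isGroupLikeElem {k A : Type*} [CommSemiring k] [Semiring A] [Bialgebra k A]
    {s : Set A} (hs : ∀ g ∈ s, IsGroupLikeElem k g) :
    Subalgebra.toSubmodule (Algebra.adjoin k s) ≤ Submodule.span k {g | IsGroupLikeElem k g} := by
  rw [Algebra.adjoin_eq_span]
  refine Submodule.span_mono fun g hg => ?_
  induction hg using Submonoid.closure_induction with
  | mem g hg => exact hs g hg
  | one => exact IsGroupLikeElem.one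
  | mul a b _ _ ha hb => exact ha.mul hb

end Generation

section SkewPrimitive

variable {k A B : Type*} [CommSemiring k] [Semiring A] [Bialgebra k A] [Semiring B]
  [Bialgebra k B] {g y : A}

variable (k) in
/-- The `(g, 1)`-primitive elements of a bialgebra. -/
def IsSkewPrimitive (g y : A) : Prop :=
  comul (R := k) y = y ⊗ₜ g + 1 ⊗ₜ y

theorem IsSkewPrimitive.map (hy : IsSkewPrimitive k g y) (f : A →ₗc[k] B) (hf : f 1 = 1) :
    IsSkewPrimitive k (f g) (f y) := by
  rw [IsSkewPrimitive, ← CoalgHomClass.map_comp_comul_apply, hy]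
  simp [hf]

end SkewPrimitive

section Hit

variable {k C : Type*} [CommSemiring k] [AddCommMonoid C] [Module k C] [Coalgebra k C]

/-- The left hit action `f ⇀ c = c₍₁₎ f(c₍₂₎)` of the dual of a coalgebra. -/
noncomputable def leftHit (f : C →ₗ[k] k) : C →ₗ[k] C :=
  (TensorProduct.rid k C).toLinearMap ∘ₗ f.lTensor C ∘ₗ comul

/-- The right hit action `c ↼ f = f(c₍₁₎) c₍₂₎` of the dual of a coalgebra. -/
noncomputable def rightHit (f : C →ₗ[k] k) : C →ₗ[k] C :=
  (TensorProduct.lid k C).toLinearMap ∘ₗ f.rTensor C ∘ₗ comul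

theorem leftHit_of_isGroupLikeElem (f : C →ₗ[k] k) {g : C} (hg : IsGroupLikeElem k g) :
    leftHit f g = f g • g := by
  simp [leftHit, hg.comul_eq_tmul_self]

theorem rightHit_of_isGroupLikeElem (f : C →ₗ[k] k) {g : C} (hg : IsGroupLikeElem k g) :
    rightHit f g = f g • g := by
  simp [rightHit, hg.comul_eq_tmul_self]

variable {A : Type*} [Semiring A] [Bialgebra k A]

theorem leftHit_of_isSkewPrimitive (f : A →ₗ[k] k) {g y : A} (hy : IsSkewPrimitive k g y) :
    leftHit f y = f g • y + f y • 1 := by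
  rw [IsSkewPrimitive] at hy
  simp [leftHit, hy]

theorem rightHit_of_isSkewPrimitive (f : A →ₗ[k] k) {g y : A} (hy : IsSkewPrimitive k g y) :
    rightHit f y = f y • g + f 1 • y := by
  rw [IsSkewPrimitive] at hy
  simp [rightHit, hy]

theorem leftHit_mul {f g : A →ₗ[k] k}
    (hf : ∀ a b, f (a * b) = g a * f b + f a * counit (R := k) b) (a b : A) :
    leftHit f (a * b) = leftHit g a * leftHit f b + leftHit f a * b := by
  have key : ∀ s t : A ⊗[k] A, TensorProduct.rid k A (f.lTensor A (s * t)) =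
      TensorProduct.rid k A (g.lTensor A s) * TensorProduct.rid k A (f.lTensor A t) +
        TensorProduct.rid k A (f.lTensor A s) *
          TensorProduct.rid k A (counit.lTensor A t) := by
    intro s t
    induction s with
    | zero => simp
    | add s s' hs hs' => simp only [add_mul, map_add, hs, hs']; abel
    | tmul a a' =>
      induction t with
      | zero => simp
      | add t t' ht ht' => simp only [mul_add, map_add, ht, ht']; abel
      | tmul b b' => simp [hf, add_smul, smul_smul, mul_comm]
  simpa [leftHit] using key (comul a) (comul b)

theorem rightHit_mul {f g : A →ₗ[k] k}
    (hf : ∀ a b, f (a * b) = g a * f b + f a * counit (R := k) b) (a b : A) :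
    rightHit f (a * b) = rightHit g a * rightHit f b + rightHit f a * b := by
  have key : ∀ s t : A ⊗[k] A, TensorProduct.lid k A (f.rTensor A (s * t)) =
      TensorProduct.lid k A (g.rTensor A s) * TensorProduct.lid k A (f.rTensor A t) +
        TensorProduct.lid k A (f.rTensor A s) *
          TensorProduct.lid k A (counit.rTensor A t) := by
    intro s t
    induction s with
    | zero => simp
    | add s s' hs hs' => simp only [add_mul, map_add, hs, hs']; abel
    | tmul a a' =>
      induction t with
      | zero => simp
      | add t t' ht ht' => simp only [mul_add, map_add, ht, ht']; abel
      | tmul b b' => simp [hf, add_smul, smul_smul, mul_comm]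
  simpa [rightHit] using key (comul a) (comul b)

end Hit

section QFactorial

variable {k : Type*} [Field k] {m : ℕ} {q : k}

/-- The `r`-factorial `∏ (1 + r + ⋯ + rʲ)`, over `j < i`. -/
def qFactorial (r : k) (i : ℕ) : k := ∏ j ∈ Finset.range i, ∑ l ∈ Finset.range (j + 1), r ^ l

theorem qFactorial_inv_ne_zero (hq : IsPrimitiveRoot q m) {i : ℕ} (hi : i < m) :
    qFactorial q⁻¹ i ≠ 0 := by
  refine Finset.prod_ne_zero_iff.2 fun j hj hsum => ?_
  have hj : j + 1 < m := by have := Finset.mem_range.1 hj; lia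
  have hpow := mul_geom_sum q⁻¹ (j + 1)
  rw [hsum, mul_zero] at hpow
  exact hq.inv.pow_ne_one_of_pos_of_lt j.succ_ne_zero hj (sub_eq_zero.1 hpow.symm)

end QFactorial

namespace Taft

variable {k : Type*} [Field k] {m : ℕ} {q : k} (hq : IsPrimitiveRoot q m)

/-- The subalgebra generated by `h`. -/
noncomputable abbrev torus : Subalgebra k (Taft hq) := Algebra.adjoin k {h hq}

theorem h_mem_torus : h hq ∈ torus hq := Algebra.subset_adjoin rfl

variable {hq} in
theorem linearMap_eq_zero_of_mem_torus {M : Type*} [AddCommGroup M] [Module k M]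
    {L : Taft hq →ₗ[k] M} (hL : ∀ i : ℕ, L (h hq ^ i) = 0) {a : Taft hq} (ha : a ∈ torus hq) :
    L a = 0 := by
  have hle : Subalgebra.toSubmodule (torus hq) ≤ LinearMap.ker L := by
    rw [Algebra.adjoin_eq_span, Submodule.span_le]
    intro b hb
    obtain ⟨i, rfl⟩ := Submonoid.mem_closure_singleton.1 hb
    exact hL i
  exact hle ha

section NeZero

variable [NeZero m]

/-- The projection onto the torus with kernel generated by `x`. -/
noncomputable def torusProj : Taft hq →ₐ[k] torus hq :=
  lift ⟨h hq, h_mem_torus hq⟩ 0 (Subtype.ext (h_pow hq)) (zero_pow (NeZero.ne m)) (by simp)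

theorem torusProj_of_mem {a : Taft hq} (ha : a ∈ torus hq) : (torusProj hq a : Taft hq) = a := by
  have hle : torus hq ≤ AlgHom.equalizer ((torus hq).val.comp (torusProj hq)) (AlgHom.id k _) :=
    Algebra.adjoin_le (by simp [torusProj])
  exact hle ha

theorem h_mul_x_pow (i : ℕ) : h hq * x hq ^ i = q⁻¹ ^ i • (x hq ^ i * h hq) := by
  refine mul_pow_of_qcomm ?_ i
  rw [xh, smul_smul, inv_mul_cancel₀ (hq.ne_zero (NeZero.ne m)), one_smul]

theorem linearMap_ext {M : Type*} [AddCommGroup M] [Module k M] {L L' : Taft hq →ₗ[k] M}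
    (hL : ∀ l < m, ∀ u ∈ torus hq, L (x hq ^ l * u) = L' (x hq ^ l * u)) : L = L' := by
  let V := Submodule.span k {a | ∃ l < m, ∃ u ∈ torus hq, x hq ^ l * u = a}
  have hspan : V = ⊤ := by
    refine eq_top_of_adjoin_mul_mem (adjoin_eq_top hq)
      (Submodule.subset_span ⟨0, NeZero.pos m, 1, one_mem _, by simp⟩) fun a ha b hb => ?_
    suffices V ≤ V.comap (LinearMap.mulLeft k a) from this hb
    rw [Submodule.span_le]
    rintro _ ⟨l, hl, u, hu, rfl⟩
    simp only [Submodule.comap_coe, Set.mem_preimage, LinearMap.mulLeft_apply, SetLike.mem_coe,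
      ← mul_assoc]
    obtain rfl | rfl := ha
    · rw [h_mul_x_pow, smul_mul_assoc, mul_assoc]
      exact Submodule.smul_mem _ _
        (Submodule.subset_span ⟨l, hl, _, mul_mem (h_mem_torus hq) hu, rfl⟩)
    · rw [← pow_succ']
      obtain hlt | hge := lt_or_ge (l + 1) m
      · exact Submodule.subset_span ⟨l + 1, hlt, u, hu, rfl⟩
      · simp [pow_eq_zero_of_le hge (x_pow hq)]
  refine LinearMap.ext_on hspan ?_
  rintro _ ⟨l, hl, u, hu, rfl⟩
  exact hL l hl u hu

theorem isGroupLikeElem_h : IsGroupLikeElem k (h hq) :=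
  ⟨counit_h hq, comul_h hq⟩

theorem isSkewPrimitive_x : IsSkewPrimitive k (h hq) (x hq) :=
  comul_x hq

/-- The character with `h ↦ q⁻¹` and `x ↦ 0`. -/
noncomputable def character : Taft hq →ₐ[k] k :=
  lift q⁻¹ 0 (by rw [inv_pow, hq.pow_eq_one, inv_one]) (zero_pow (NeZero.ne m)) (by simp)

@[simp] theorem character_h : character hq (h hq) = q⁻¹ := lift_h ..

@[simp] theorem character_x : character hq (x hq) = 0 := lift_x ..

end NeZero

section SkewForm

variable [m.AtLeastTwo]

/-- The representation by upper triangular matrices with `h ↦ diag(q⁻¹, 1)` and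
`x ↦ E₁₂`. -/
noncomputable def triangular : Taft hq →ₐ[k] Matrix (Fin 2) (Fin 2) k :=
  lift (Matrix.diagonal ![q⁻¹, 1]) !![0, 1; 0, 0]
    (by
      rw [Matrix.diagonal_pow, ← Matrix.diagonal_one]
      congr 1
      ext i
      fin_cases i <;> simp [hq.pow_eq_one])
    (pow_eq_zero_of_le Nat.AtLeastTwo.prop
      (by ext i j; fin_cases i <;> fin_cases j <;> simp [pow_two]))
    (by
      ext i j
      fin_cases i <;> fin_cases j <;>
        simp [Matrix.diagonal_apply, Matrix.mul_apply, hq.ne_zero (NeZero.ne m)])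

theorem triangular_apply (a : Taft hq) : triangular hq a 1 0 = 0 ∧
    triangular hq a 0 0 = character hq a ∧ triangular hq a 1 1 = counit (R := k) a := by
  have ha : a ∈ Algebra.adjoin k {h hq, x hq} := adjoin_eq_top hq ▸ Algebra.mem_top
  induction ha using Algebra.adjoin_induction with
  | mem a ha => obtain rfl | rfl := ha <;> simp [triangular, counit_h, counit_x]
  | algebraMap r => simp [Matrix.algebraMap_matrix_apply]
  | add a b _ _ ha hb => simp [ha, hb]
  | mul a b _ _ ha hb => simp [Matrix.mul_apply, Fin.sum_univ_two, ha, hb]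

/-- The functional `ξ` with `ξ(h) = 0` and `ξ(x) = 1` which is a skew derivation from the
character `h ↦ q⁻¹`, `x ↦ 0` to the counit. -/
noncomputable def skewForm : Taft hq →ₗ[k] k :=
  Matrix.entryLinearMap k k 0 1 ∘ₗ (triangular hq).toLinearMap

theorem skewForm_mul (a b : Taft hq) : skewForm hq (a * b) =
    character hq a * skewForm hq b + skewForm hq a * counit (R := k) b := by
  simp [skewForm, Matrix.mul_apply, Fin.sum_univ_two, triangular_apply hq a,
    triangular_apply hq b]

@[simp] theorem skewForm_one : skewForm hq 1 = 0 := by simp [skewForm]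

@[simp] theorem skewForm_h : skewForm hq (h hq) = 0 := by simp [skewForm, triangular]

@[simp] theorem skewForm_x : skewForm hq (x hq) = 1 := by simp [skewForm, triangular]

@[simp] theorem skewForm_h_pow (i : ℕ) : skewForm hq (h hq ^ i) = 0 := by
  induction i with
  | zero => simp
  | succ i ih => simp [pow_succ, skewForm_mul, ih]

theorem leftHit_skewForm_of_mem_torus {a : Taft hq} (ha : a ∈ torus hq) :
    leftHit (skewForm hq) a = 0 :=
  linearMap_eq_zero_of_mem_torus
    (fun i => by simp [leftHit_of_isGroupLikeElem _ ((isGroupLikeElem_h hq).pow (n := i))]) ha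

theorem rightHit_skewForm_of_mem_torus {a : Taft hq} (ha : a ∈ torus hq) :
    rightHit (skewForm hq) a = 0 :=
  linearMap_eq_zero_of_mem_torus
    (fun i => by simp [rightHit_of_isGroupLikeElem _ ((isGroupLikeElem_h hq).pow (n := i))]) ha

theorem leftHit_skewForm_x : leftHit (skewForm hq) (x hq) = 1 := by
  simp [leftHit_of_isSkewPrimitive _ (isSkewPrimitive_x hq)]

theorem rightHit_skewForm_x : rightHit (skewForm hq) (x hq) = h hq := by
  simp [rightHit_of_isSkewPrimitive _ (isSkewPrimitive_x hq)]

theorem leftHit_skewForm_x_mul (a : Taft hq) : leftHit (skewForm hq) (x hq * a) =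
    q⁻¹ • (x hq * leftHit (skewForm hq) a) + a := by
  rw [leftHit_mul (g := (character hq).toLinearMap) (skewForm_mul hq),
    leftHit_of_isSkewPrimitive _ (isSkewPrimitive_x hq), leftHit_skewForm_x]
  simp

theorem leftHit_skewForm_h_mul (a : Taft hq) : leftHit (skewForm hq) (h hq * a) =
    q⁻¹ • (h hq * leftHit (skewForm hq) a) := by
  rw [leftHit_mul (g := (character hq).toLinearMap) (skewForm_mul hq),
    leftHit_of_isGroupLikeElem _ (isGroupLikeElem_h hq),
    leftHit_of_isGroupLikeElem _ (isGroupLikeElem_h hq)]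
  simp

theorem rightHit_skewForm_x_mul (a : Taft hq) : rightHit (skewForm hq) (x hq * a) =
    x hq * rightHit (skewForm hq) a + h hq * a := by
  rw [rightHit_mul (g := (character hq).toLinearMap) (skewForm_mul hq),
    rightHit_of_isSkewPrimitive _ (isSkewPrimitive_x hq), rightHit_skewForm_x]
  simp

theorem rightHit_skewForm_h_mul (a : Taft hq) : rightHit (skewForm hq) (h hq * a) =
    q⁻¹ • (h hq * rightHit (skewForm hq) a) := by
  rw [rightHit_mul (g := (character hq).toLinearMap) (skewForm_mul hq),
    rightHit_of_isGroupLikeElem _ (isGroupLikeElem_h hq),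
    rightHit_of_isGroupLikeElem _ (isGroupLikeElem_h hq)]
  simp

theorem leftHit_skewForm_x_pow_succ_mul (l : ℕ) {u : Taft hq} (hu : u ∈ torus hq) :
    leftHit (skewForm hq) (x hq ^ (l + 1) * u) =
      (∑ i ∈ Finset.range (l + 1), q⁻¹ ^ i) • (x hq ^ l * u) := by
  induction l with
  | zero => simp [leftHit_skewForm_x_mul, leftHit_skewForm_of_mem_torus hq hu]
  | succ l ih =>
    rw [pow_succ', mul_assoc, leftHit_skewForm_x_mul, ih, mul_smul_comm, smul_smul, ← mul_assoc,
      ← pow_succ', geom_sum_succ (n := l + 1), add_smul, one_smul]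

theorem leftHit_skewForm_pow_x_pow_mul {i l : ℕ} (hil : l < i) {u : Taft hq} (hu : u ∈ torus hq) :
    (leftHit (skewForm hq) ^ i) (x hq ^ l * u) = 0 := by
  obtain ⟨i, rfl⟩ := Nat.exists_eq_succ_of_ne_zero (Nat.ne_zero_of_lt hil)
  induction l generalizing i with
  | zero => simp [pow_succ, leftHit_skewForm_of_mem_torus hq hu]
  | succ l ih =>
    obtain ⟨i, rfl⟩ := Nat.exists_eq_succ_of_ne_zero (n := i) (by lia)
    rw [pow_succ, Module.End.mul_apply, leftHit_skewForm_x_pow_succ_mul hq l hu, map_smul,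
      ih i (by lia), smul_zero]

theorem leftHit_skewForm_pow : leftHit (skewForm hq) ^ m = 0 :=
  linearMap_ext hq fun l hl u hu => by
    rw [leftHit_skewForm_pow_x_pow_mul hq hl hu, LinearMap.zero_apply]

theorem torusProj_x_pow_mul (l : ℕ) {u : Taft hq} (hu : u ∈ torus hq) :
    (torusProj hq (x hq ^ l * u) : Taft hq) = if l = 0 then u else 0 := by
  have hx : torusProj hq (x hq) = 0 := lift_x ..
  split_ifs with hl
  · simp [hl, torusProj_of_mem hq hu]
  · simp [hx, hl]

theorem torusProj_leftHit_skewForm_pow (i l : ℕ) {u : Taft hq} (hu : u ∈ torus hq) :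
    (torusProj hq ((leftHit (skewForm hq) ^ i) (x hq ^ l * u)) : Taft hq) =
      if l = i then qFactorial q⁻¹ i • u else 0 := by
  induction i generalizing l with
  | zero => simpa [qFactorial] using torusProj_x_pow_mul hq l hu
  | succ i ih =>
    rw [pow_succ, Module.End.mul_apply]
    cases l with
    | zero => simp [leftHit_skewForm_of_mem_torus hq hu]
    | succ l =>
      rw [leftHit_skewForm_x_pow_succ_mul hq l hu, map_smul, map_smul, Subalgebra.coe_smul, ih]
      split_ifs with h1 h2 h2
      · rw [h1, smul_smul, mul_comm, qFactorial, qFactorial, Finset.prod_range_succ]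
      · lia
      · lia
      · exact smul_zero _

theorem sum_taylor (a : Taft hq) : ∑ i ∈ Finset.range m, (qFactorial q⁻¹ i)⁻¹ •
    (x hq ^ i * (torusProj hq ((leftHit (skewForm hq) ^ i) a) : Taft hq)) = a := by
  suffices ∑ i ∈ Finset.range m, (qFactorial q⁻¹ i)⁻¹ • LinearMap.mulLeft k (x hq ^ i) ∘ₗ
      ((torus hq).val.comp (torusProj hq)).toLinearMap ∘ₗ leftHit (skewForm hq) ^ i =
      LinearMap.id by simpa [LinearMap.sum_apply] using DFunLike.congr_fun this a
  refine linearMap_ext hq fun l hl u hu => ?_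
  simp only [LinearMap.sum_apply, LinearMap.smul_apply, LinearMap.comp_apply,
    LinearMap.mulLeft_apply, AlgHom.toLinearMap_apply, AlgHom.comp_apply, Subalgebra.coe_val,
    torusProj_leftHit_skewForm_pow hq _ _ hu, LinearMap.id_apply, mul_ite, mul_zero, smul_ite,
    smul_zero]
  rw [Finset.sum_ite_eq, if_pos (Finset.mem_range.2 hl), mul_smul_comm, smul_smul,
    inv_mul_cancel₀ (qFactorial_inv_ne_zero hq hl), one_smul]

theorem mem_torus_of_leftHit_skewForm_eq_zero {a : Taft hq} (ha : leftHit (skewForm hq) a = 0) :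
    a ∈ torus hq := by
  rw [← sum_taylor hq a]
  refine sum_mem fun i _ => Subalgebra.smul_mem _ ?_ _
  cases i with
  | zero => simp
  | succ i => simp [pow_succ, ha]

theorem eq_bot_of_leftHit_skewForm_mem {V : Submodule k (Taft hq)}
    (hV : ∀ a ∈ V, leftHit (skewForm hq) a ∈ V) (htorus : ∀ a ∈ V, a ∈ torus hq → a = 0) :
    V = ⊥ := by
  have key : ∀ i, ∀ a ∈ V, (leftHit (skewForm hq) ^ i) a = 0 → a = 0 := by
    intro i
    induction i with
    | zero => exact fun a _ ha => ha
    | succ i ih =>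
      exact fun a ha hi => htorus a ha
        (mem_torus_of_leftHit_skewForm_eq_zero hq (ih _ (hV a ha) (by rwa [pow_succ] at hi)))
  exact (Submodule.eq_bot_iff V).2 fun a ha => key m a ha (by simp [leftHit_skewForm_pow])

variable {hq} in
theorem skewForm_of_isGroupLikeElem {g : Taft hq} (hg : IsGroupLikeElem k g) :
    skewForm hq g = 0 := by
  have hpow : ∀ i : ℕ, (leftHit (skewForm hq) ^ i) g = skewForm hq g ^ i • g := by
    intro i
    induction i with
    | zero => simp
    | succ i ih =>
      rw [pow_succ, Module.End.mul_apply, leftHit_of_isGroupLikeElem _ hg, map_smul, ih,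
        smul_smul, pow_succ']
  have hm := hpow m
  rw [leftHit_skewForm_pow, LinearMap.zero_apply] at hm
  exact pow_eq_zero_iff (NeZero.ne m) |>.1 ((smul_eq_zero.1 hm.symm).resolve_right hg.ne_zero)

variable {hq} in
theorem mem_torus_of_isGroupLikeElem {g : Taft hq} (hg : IsGroupLikeElem k g) : g ∈ torus hq := by
  apply mem_torus_of_leftHit_skewForm_eq_zero
  rw [leftHit_of_isGroupLikeElem _ hg, skewForm_of_isGroupLikeElem hg, zero_smul]

variable {hq} in
theorem sub_smul_x_mem_torus {g y : Taft hq} (hg : IsGroupLikeElem k g)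
    (hy : IsSkewPrimitive k g y) : y - skewForm hq y • x hq ∈ torus hq := by
  apply mem_torus_of_leftHit_skewForm_eq_zero
  rw [map_sub, map_smul, leftHit_of_isSkewPrimitive _ hy, skewForm_of_isGroupLikeElem hg,
    leftHit_skewForm_x, zero_smul, zero_add, sub_self]

variable {hq} in
theorem eq_h_of_skewForm_ne_zero {g y : Taft hq} (hg : IsGroupLikeElem k g)
    (hy : IsSkewPrimitive k g y) (hne : skewForm hq y ≠ 0) : g = h hq := by
  have hzero := rightHit_skewForm_of_mem_torus hq (sub_smul_x_mem_torus hg hy)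
  rw [map_sub, map_smul, rightHit_of_isSkewPrimitive _ hy, skewForm_one, zero_smul, add_zero,
    rightHit_skewForm_x, ← smul_sub] at hzero
  exact sub_eq_zero.1 ((smul_eq_zero.1 hzero).resolve_left hne)

end SkewForm

end Taft

section TensorCoalgebra

variable {k C D : Type*} [CommSemiring k] [AddCommMonoid C] [Module k C] [Coalgebra k C]
  [AddCommMonoid D] [Module k D] [Coalgebra k D]

variable (k C D) in
/-- The coalgebra map `c ⊗ d ↦ ε(d) c`. -/
noncomputable def tensorFst : C ⊗[k] D →ₗc[k] C :=
  (Coalgebra.TensorProduct.rid k k C : C ⊗[k] k →ₗc[k] C).comp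
    (Coalgebra.TensorProduct.map (CoalgHom.id k C) (counitCoalgHom k D))

variable (k C D) in
/-- The coalgebra map `c ⊗ d ↦ ε(c) d`. -/
noncomputable def tensorSnd : C ⊗[k] D →ₗc[k] D :=
  (Coalgebra.TensorProduct.lid k D : k ⊗[k] D →ₗc[k] D).comp
    (Coalgebra.TensorProduct.map (counitCoalgHom k C) (CoalgHom.id k D))

@[simp] theorem tensorFst_tmul (c : C) (d : D) :
    tensorFst k C D (c ⊗ₜ d) = counit (R := k) d • c := rfl

@[simp] theorem tensorSnd_tmul (c : C) (d : D) :
    tensorSnd k C D (c ⊗ₜ d) = counit (R := k) c • d := rfl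

theorem map_tensorFst_tensorSnd_comul (z : C ⊗[k] D) :
    TensorProduct.map (tensorFst k C D : C ⊗[k] D →ₗ[k] C)
      (tensorSnd k C D : C ⊗[k] D →ₗ[k] D) (comul z) = z := by
  have key : TensorProduct.map (tensorFst k C D : C ⊗[k] D →ₗ[k] C)
      (tensorSnd k C D : C ⊗[k] D →ₗ[k] D) ∘ₗ
        (TensorProduct.AlgebraTensorModule.tensorTensorTensorComm k k k k C C D D).toLinearMap =
      TensorProduct.map ((TensorProduct.rid k C).toLinearMap ∘ₗ counit.lTensor C)
        ((TensorProduct.lid k D).toLinearMap ∘ₗ counit.rTensor D) := by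
    ext c c' d d'
    simp [TensorProduct.smul_tmul', smul_smul, mul_comm]
  induction z with
  | zero => simp
  | add z w hz hw => rw [map_add, map_add, hz, hw]
  | tmul c d => simpa using DFunLike.congr_fun key (comul c ⊗ₜ[k] comul d)

theorem map_tensorSnd_tensorFst_comul (z : C ⊗[k] D) :
    TensorProduct.map (tensorSnd k C D : C ⊗[k] D →ₗ[k] D)
      (tensorFst k C D : C ⊗[k] D →ₗ[k] C) (comul z) = TensorProduct.comm k C D z := by
  have key : TensorProduct.map (tensorSnd k C D : C ⊗[k] D →ₗ[k] D)
      (tensorFst k C D : C ⊗[k] D →ₗ[k] C) ∘ₗ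
        (TensorProduct.AlgebraTensorModule.tensorTensorTensorComm k k k k C C D D).toLinearMap =
      (TensorProduct.comm k C D).toLinearMap ∘ₗ
        TensorProduct.map ((TensorProduct.lid k C).toLinearMap ∘ₗ counit.rTensor C)
          ((TensorProduct.rid k D).toLinearMap ∘ₗ counit.lTensor D) := by
    ext c c' d d'
    simp [TensorProduct.smul_tmul', smul_smul, mul_comm]
  induction z with
  | zero => simp
  | add z w hz hw => rw [map_add, map_add, hz, hw, map_add]
  | tmul c d => simpa using DFunLike.congr_fun key (comul c ⊗ₜ[k] comul d)

end TensorCoalgebra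

section TensorBialgebra

variable {k A B : Type*} [CommSemiring k] [Semiring A] [Bialgebra k A] [Semiring B]
  [Bialgebra k B] {g z : A ⊗[k] B}

theorem tensorFst_one : tensorFst k A B 1 = 1 := by
  simp [Algebra.TensorProduct.one_def]

theorem tensorSnd_one : tensorSnd k A B 1 = 1 := by
  simp [Algebra.TensorProduct.one_def]

theorem tensorFst_tmul_tensorSnd (hg : IsGroupLikeElem k g) :
    tensorFst k A B g ⊗ₜ tensorSnd k A B g = g := by
  simpa [hg.comul_eq_tmul_self] using map_tensorFst_tensorSnd_comul g

theorem IsSkewPrimitive.eq_tmul_add_one_tmul (hz : IsSkewPrimitive k g z) :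
    z = tensorFst k A B z ⊗ₜ tensorSnd k A B g + 1 ⊗ₜ tensorSnd k A B z := by
  have hz' := map_tensorFst_tensorSnd_comul z
  rw [hz] at hz'
  simpa [tensorFst_one] using hz'.symm

theorem IsSkewPrimitive.eq_tmul_add_tmul_one (hz : IsSkewPrimitive k g z) :
    z = tensorFst k A B g ⊗ₜ tensorSnd k A B z + tensorFst k A B z ⊗ₜ 1 := by
  have hz' := map_tensorSnd_tensorFst_comul z
  rw [hz] at hz'
  exact (TensorProduct.comm k A B).injective (by simpa [tensorSnd_one] using hz'.symm)

end TensorBialgebra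

namespace Bicross

section Factorization

variable {k : Type*} [Field k] {m n : ℕ} {q q' : k} {hq' : IsPrimitiveRoot q' n}
  {hq : IsPrimitiveRoot q m} {σ α : k}

local notation "B" => Bicross hq' hq σ α
local notation "γ" => gen hq' hq σ α

variable [NeZero m] [NeZero n]

/-- The Hopf algebra map from the Taft algebra of `q` to the subalgebra generated by `h`
and `x`. -/
noncomputable def inr : Taft hq →ₐc[k] B :=
  have r := relations hq' hq σ α
  BialgHom.ofAlgHom (Taft.lift (γ .h) (γ .x) r.h_pow r.x_pow r.xh)
    (Taft.algHom_ext (by simp [Taft.counit_h, counit_h]) (by simp [Taft.counit_x, counit_x]))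
    (Taft.algHom_ext (by simp [Taft.comul_h, comul_h]) (by simp [Taft.comul_x, comul_x]))

/-- The Hopf algebra map from the Taft algebra of `q'` to the subalgebra generated by `H`
and `X`. -/
noncomputable def inl : Taft hq' →ₐc[k] B :=
  have r := relations hq' hq σ α
  BialgHom.ofAlgHom (Taft.lift (γ .H) (γ .X) r.H_pow r.X_pow r.XH)
    (Taft.algHom_ext (by simp [Taft.counit_h, counit_H]) (by simp [Taft.counit_x, counit_X]))
    (Taft.algHom_ext (by simp [Taft.comul_h, comul_H]) (by simp [Taft.comul_x, comul_X]))

@[simp] theorem inr_h : inr (Taft.h hq) = γ .h := Taft.lift_h ..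
@[simp] theorem inr_x : inr (Taft.x hq) = γ .x := Taft.lift_x ..
@[simp] theorem inl_h : inl (Taft.h hq') = γ .H := Taft.lift_h ..
@[simp] theorem inl_x : inl (Taft.x hq') = γ .X := Taft.lift_x ..

variable (hq' hq σ α) in
/-- The multiplication map `a ⊗ b ↦ a b` on the tensor product of the two Taft algebras. -/
noncomputable def mulCoalgHom : Taft hq' ⊗[k] Taft hq →ₗc[k] B :=
  (Bialgebra.mulCoalgHom k B).comp
    (Coalgebra.TensorProduct.map (inl : _ →ₐc[k] B).toCoalgHom (inr : _ →ₐc[k] B).toCoalgHom)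

@[simp] theorem mulCoalgHom_tmul (a : Taft hq') (b : Taft hq) :
    mulCoalgHom hq' hq σ α (a ⊗ₜ b) = inl a * inr b := rfl

@[simp] theorem mulCoalgHom_one : mulCoalgHom hq' hq σ α 1 = 1 := by
  simp [Algebra.TensorProduct.one_def]

theorem exists_h_mul_inl (a : Taft hq') : ∃ b : Taft hq', γ .h * inl a = inl b * γ .h := by
  have r := relations hq' hq σ α
  have ha : a ∈ Algebra.adjoin k {Taft.h hq', Taft.x hq'} :=
    Taft.adjoin_eq_top hq' ▸ Algebra.mem_top
  induction ha using Algebra.adjoin_induction with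
  | mem a ha =>
    obtain rfl | rfl := ha
    · exact ⟨Taft.h hq', by simp [r.hH]⟩
    · exact ⟨σ • Taft.x hq', by simp [r.hX]⟩
  | algebraMap c => exact ⟨algebraMap k _ c, by simp [Algebra.algebraMap_eq_smul_one]⟩
  | add a b _ _ ha hb =>
    obtain ⟨a', ha⟩ := ha
    obtain ⟨b', hb⟩ := hb
    exact ⟨a' + b', by simp [mul_add, add_mul, ha, hb]⟩
  | mul a b _ _ ha hb =>
    obtain ⟨a', ha⟩ := ha
    obtain ⟨b', hb⟩ := hb
    exact ⟨a' * b', by rw [map_mul, ← mul_assoc, ha, mul_assoc, hb, map_mul, mul_assoc]⟩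

theorem exists_x_mul_inl (a : Taft hq') : ∃ b c d : Taft hq',
    γ .x * inl a = inl b * γ .x + inl c + inl d * γ .h := by
  have r := relations hq' hq σ α
  have ha : a ∈ Algebra.adjoin k {Taft.h hq', Taft.x hq'} :=
    Taft.adjoin_eq_top hq' ▸ Algebra.mem_top
  induction ha using Algebra.adjoin_induction with
  | mem a ha =>
    obtain rfl | rfl := ha
    · exact ⟨σ • Taft.h hq', 0, 0, by simp [r.xH]⟩
    · exact ⟨σ • Taft.x hq', α • 1, -(α • Taft.h hq'), by
        simp [r.xX, sub_eq_add_neg, add_assoc]⟩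
  | algebraMap c => exact ⟨algebraMap k _ c, 0, 0, by simp [Algebra.algebraMap_eq_smul_one]⟩
  | add a b _ _ ha hb =>
    obtain ⟨a₁, a₂, a₃, ha⟩ := ha
    obtain ⟨b₁, b₂, b₃, hb⟩ := hb
    refine ⟨a₁ + b₁, a₂ + b₂, a₃ + b₃, ?_⟩
    simp only [map_add, mul_add, add_mul, ha, hb]
    abel
  | mul a b _ _ ha hb =>
    obtain ⟨a₁, a₂, a₃, ha⟩ := ha
    obtain ⟨b₁, b₂, b₃, hb⟩ := hb
    obtain ⟨b', hb'⟩ := exists_h_mul_inl (hq := hq) (σ := σ) (α := α) b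
    refine ⟨a₁ * b₁, a₁ * b₂ + a₂ * b, a₁ * b₃ + a₃ * b', ?_⟩
    rw [map_mul, ← mul_assoc, ha, add_mul, add_mul, mul_assoc, hb, mul_assoc (inl a₃), hb']
    simp only [map_mul, map_add, mul_add, add_mul, mul_assoc]
    abel

theorem mulCoalgHom_surjective : Function.Surjective (mulCoalgHom hq' hq σ α) := by
  let V := LinearMap.range (mulCoalgHom hq' hq σ α : Taft hq' ⊗[k] Taft hq →ₗ[k] B)
  have mem : ∀ (a : Taft hq') (b : Taft hq), inl a * inr b ∈ V := fun a b => ⟨a ⊗ₜ b, rfl⟩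
  refine LinearMap.range_eq_top.1 <|
    eq_top_of_adjoin_mul_mem (V := V) (adjoin_eq_top hq' hq σ α) (by simpa using mem 1 1) ?_
  rintro _ ⟨i, rfl⟩ _ ⟨z, rfl⟩
  induction z with
  | zero => simp
  | add z z' hz hz' => rw [map_add, mul_add]; exact V.add_mem hz hz'
  | tmul a b =>
    rw [CoalgHom.coe_toLinearMap, mulCoalgHom_tmul, ← mul_assoc]
    cases i with
    | h =>
      obtain ⟨a', ha⟩ := exists_h_mul_inl (hq := hq) (σ := σ) (α := α) a
      rw [ha, mul_assoc, ← inr_h, ← map_mul]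
      exact mem _ _
    | x =>
      obtain ⟨a₁, a₂, a₃, ha⟩ := exists_x_mul_inl (hq := hq) (σ := σ) (α := α) a
      rw [ha, add_mul, add_mul, mul_assoc, mul_assoc, ← inr_h, ← inr_x, ← map_mul, ← map_mul]
      exact V.add_mem (V.add_mem (mem _ _) (mem _ _)) (mem _ _)
    | H => rw [← inl_h, ← map_mul]; exact mem _ _
    | X => rw [← inl_x, ← map_mul]; exact mem _ _

end Factorization

end Bicross

namespace Taft

theorem h_ne_one {k : Type*} [Field k] {m : ℕ} {q : k} (hq : IsPrimitiveRoot q m)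
    [m.AtLeastTwo] : h hq ≠ 1 := fun h_eq_one => by
  have hχ := congrArg (character hq) h_eq_one
  rw [character_h, map_one, inv_eq_one] at hχ
  exact hq.ne_one Nat.AtLeastTwo.prop hχ

end Taft

theorem eq_zero_and_eq_of_qcomm {k R : Type*} [Field k] [Ring R] [Algebra k R]
    {S : Submodule k R} {q r β : k} {h x v : R} (hh : IsUnit h) (hx : x * h = q • (h * x))
    (hv : Commute v h) (hxS : x ∉ S) (hvS : v ∈ S) (hr : r ≠ 1)
    (hβ : (β • x + v) * h = r • (h * (β • x + v))) : v = 0 ∧ (β = 0 ∨ r = q) := by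
  have hzero : (β * (q - r)) • x = (r - 1) • v := by
    refine hh.mul_left_cancel ?_
    rw [add_mul, smul_mul_assoc, hx, hv.eq, mul_add, mul_smul_comm, ← sub_eq_zero] at hβ
    rw [mul_smul_comm, mul_smul_comm, ← sub_eq_zero, ← hβ]
    module
  have hcoeff : β * (q - r) = 0 := by
    by_contra hne
    exact hxS ((S.smul_mem_iff hne).1 (hzero ▸ S.smul_mem _ hvS))
  rw [hcoeff, zero_smul] at hzero
  exact ⟨(smul_eq_zero.1 hzero.symm).resolve_left (sub_ne_zero.2 hr),
    (mul_eq_zero.1 hcoeff).imp_right fun hqr => (sub_eq_zero.1 hqr).symm⟩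

namespace Bicross

section Torus

variable {k : Type*} [Field k] {m n : ℕ} {q q' : k} (hq' : IsPrimitiveRoot q' n)
  (hq : IsPrimitiveRoot q m) (σ α : k)

local notation "B" => Bicross hq' hq σ α
local notation "γ" => gen hq' hq σ α

/-- The commutative subalgebra generated by `h` and `H`. -/
noncomputable abbrev torus : Subalgebra k B := Algebra.adjoin k {γ .h, γ .H}

theorem h_mem_torus : γ .h ∈ torus hq' hq σ α := Algebra.subset_adjoin (.inl rfl)

theorem H_mem_torus : γ .H ∈ torus hq' hq σ α := Algebra.subset_adjoin (.inr rfl)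

variable {hq' hq σ α}

theorem commute_of_mem_torus {a b : B} (ha : a ∈ torus hq' hq σ α) (hb : b ∈ torus hq' hq σ α) :
    Commute a b := by
  have hcomm := (relations hq' hq σ α).hH
  have := Algebra.isMulCommutative_adjoin k (s := {γ .h, γ .H}) (by
    rintro _ (rfl | rfl) _ (rfl | rfl)
    exacts [rfl, hcomm, hcomm.symm, rfl])
  exact setLike_mul_comm ha hb

variable [NeZero m] [NeZero n]

theorem isGroupLikeElem_h : IsGroupLikeElem k (γ .h) :=
  ⟨counit_h .., comul_h ..⟩

theorem isGroupLikeElem_H : IsGroupLikeElem k (γ .H) :=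
  ⟨counit_H .., comul_H ..⟩

theorem isSkewPrimitive_x : IsSkewPrimitive k (γ .h) (γ .x) :=
  comul_x ..

theorem isSkewPrimitive_X : IsSkewPrimitive k (γ .H) (γ .X) :=
  comul_X ..

theorem inr_mem_torus {b : Taft hq} (hb : b ∈ Taft.torus hq) :
    inr b ∈ torus hq' hq σ α := by
  have hle : Taft.torus hq ≤ (torus hq' hq σ α).comap (inr : _ →ₐc[k] B).toAlgHom :=
    Algebra.adjoin_le (by simpa using h_mem_torus hq' hq σ α)
  exact hle hb

theorem inl_mem_torus {a : Taft hq'} (ha : a ∈ Taft.torus hq') :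
    inl a ∈ torus hq' hq σ α := by
  have hle : Taft.torus hq' ≤ (torus hq' hq σ α).comap (inl : _ →ₐc[k] B).toAlgHom :=
    Algebra.adjoin_le (by simpa using H_mem_torus hq' hq σ α)
  exact hle ha

end Torus

section SkewPrimitive

variable {k : Type*} [Field k] {m n : ℕ} {q q' : k} {hq' : IsPrimitiveRoot q' n}
  {hq : IsPrimitiveRoot q m} {σ α : k} [m.AtLeastTwo] [n.AtLeastTwo]

local notation "B" => Bicross hq' hq σ α
local notation "γ" => gen hq' hq σ α
local notation "μ" => mulCoalgHom hq' hq σ α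

theorem mulCoalgHom_mem_torus_of_isGroupLikeElem {g : Taft hq' ⊗[k] Taft hq}
    (hg : IsGroupLikeElem k g) : μ g ∈ torus hq' hq σ α := by
  rw [← tensorFst_tmul_tensorSnd hg, mulCoalgHom_tmul]
  exact mul_mem
    (inl_mem_torus (Taft.mem_torus_of_isGroupLikeElem (hg.map (tensorFst k _ _))))
    (inr_mem_torus (Taft.mem_torus_of_isGroupLikeElem (hg.map (tensorSnd k _ _))))

theorem tensorSnd_eq_one {g z : Taft hq' ⊗[k] Taft hq} (hg : IsGroupLikeElem k g)
    (hz : IsSkewPrimitive k g z) (hne : Taft.skewForm hq' (tensorFst k _ _ z) ≠ 0) :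
    tensorSnd k _ _ g = 1 := by
  have hform := congrArg (TensorProduct.lid k _ ∘ (Taft.skewForm hq').rTensor _)
    (hz.eq_tmul_add_one_tmul.symm.trans hz.eq_tmul_add_tmul_one)
  simpa [Taft.skewForm_of_isGroupLikeElem (hg.map (tensorFst k _ _)), hne] using hform

theorem tensorFst_eq_one {g z : Taft hq' ⊗[k] Taft hq} (hg : IsGroupLikeElem k g)
    (hz : IsSkewPrimitive k g z) (hne : Taft.skewForm hq (tensorSnd k _ _ z) ≠ 0) :
    tensorFst k _ _ g = 1 := by
  have hform := congrArg (TensorProduct.rid k _ ∘ (Taft.skewForm hq).lTensor _)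
    (hz.eq_tmul_add_one_tmul.symm.trans hz.eq_tmul_add_tmul_one)
  simpa [Taft.skewForm_of_isGroupLikeElem (hg.map (tensorSnd k _ _)), hne, eq_comm] using hform

theorem mulCoalgHom_cases_of_isSkewPrimitive {g z : Taft hq' ⊗[k] Taft hq}
    (hg : IsGroupLikeElem k g) (hz : IsSkewPrimitive k g z) :
    μ z ∈ torus hq' hq σ α ∨
      (μ g = γ .h ∧ ∃ β : k, μ z - β • γ .x ∈ torus hq' hq σ α) ∨
      (μ g = γ .H ∧ ∃ β : k, μ z - β • γ .X ∈ torus hq' hq σ α) := by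
  set a := tensorFst k _ _ z
  set b := tensorSnd k _ _ z
  set c := tensorFst k _ _ g
  set d := tensorSnd k _ _ g
  have hc : IsGroupLikeElem k c := hg.map _
  have hd : IsGroupLikeElem k d := hg.map _
  have ha : IsSkewPrimitive k c a := hz.map _ tensorFst_one
  have hb : IsSkewPrimitive k d b := hz.map _ tensorSnd_one
  have hμg : μ g = inl c * inr d := by rw [← tensorFst_tmul_tensorSnd hg, mulCoalgHom_tmul]
  have hμz : μ z = inl c * inr b + inl a := by
    rw [hz.eq_tmul_add_tmul_one, map_add, mulCoalgHom_tmul, mulCoalgHom_tmul, map_one, mul_one]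
  have ha' := inl_mem_torus (hq := hq) (σ := σ) (α := α) (Taft.sub_smul_x_mem_torus hc ha)
  have hb' := inr_mem_torus (hq' := hq') (σ := σ) (α := α) (Taft.sub_smul_x_mem_torus hd hb)
  rw [map_sub, map_smul, inl_x] at ha'
  rw [map_sub, map_smul, inr_x] at hb'
  by_cases hξa : Taft.skewForm hq' a = 0 <;> by_cases hξb : Taft.skewForm hq b = 0
  · have hc' := inl_mem_torus (hq := hq) (σ := σ) (α := α) (Taft.mem_torus_of_isGroupLikeElem hc)
    rw [hξa, zero_smul, sub_zero] at ha'
    rw [hξb, zero_smul, sub_zero] at hb'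
    exact .inl (hμz ▸ add_mem (mul_mem hc' hb') ha')
  · rw [hξa, zero_smul, sub_zero] at ha'
    have hc1 : c = 1 := tensorFst_eq_one hg hz hξb
    rw [hc1, map_one, one_mul] at hμg hμz
    refine .inr (.inl ⟨by rw [hμg, Taft.eq_h_of_skewForm_ne_zero hd hb hξb, inr_h],
      Taft.skewForm hq b, ?_⟩)
    rw [hμz, add_sub_right_comm]
    exact add_mem hb' ha'
  · rw [hξb, zero_smul, sub_zero] at hb'
    have hc' := inl_mem_torus (hq := hq) (σ := σ) (α := α) (Taft.mem_torus_of_isGroupLikeElem hc)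
    have hd1 : d = 1 := tensorSnd_eq_one hg hz hξa
    rw [hd1, map_one, mul_one] at hμg
    refine .inr (.inr ⟨by rw [hμg, Taft.eq_h_of_skewForm_ne_zero hc ha hξa, inl_h],
      Taft.skewForm hq' a, ?_⟩)
    rw [hμz, add_sub_assoc]
    exact add_mem (mul_mem hc' hb') ha'
  · exact absurd ((Taft.eq_h_of_skewForm_ne_zero hd hb hξb).symm.trans (tensorSnd_eq_one hg hz hξa))
      (Taft.h_ne_one hq)

end SkewPrimitive

section Classification

variable {k : Type*} [Field k] {m n : ℕ} {q q' : k} {hq' : IsPrimitiveRoot q' n}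
  {hq : IsPrimitiveRoot q m} {σ α : k} [m.AtLeastTwo] [n.AtLeastTwo]

local notation "B" => Bicross hq' hq σ α
local notation "γ" => gen hq' hq σ α

theorem linearMap_eq_zero_of_mem_torus {L : B →ₗ[k] k} (hL : ∀ g, IsGroupLikeElem k g → L g = 0)
    {a : B} (ha : a ∈ torus hq' hq σ α) : L a = 0 := by
  have hspan := adjoin_le_span_isGroupLikeElem (k := k) (s := {γ .h, γ .H})
    (by rintro _ (rfl | rfl); exacts [isGroupLikeElem_h, isGroupLikeElem_H]) ha
  exact (Submodule.span_le (p := LinearMap.ker L)).2 hL hspan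

variable (hi : Function.Injective (mulCoalgHom hq' hq σ α))

/-- The coalgebra isomorphism `a ⊗ b ↦ a b`, once it is known to be injective. -/
noncomputable def mulCoalgEquiv : Taft hq' ⊗[k] Taft hq ≃ₗc[k] B :=
  CoalgEquiv.ofBijective (f := mulCoalgHom hq' hq σ α) ⟨hi, mulCoalgHom_surjective⟩

/-- The coalgebra projection `a b ↦ ε(a) b` onto the Taft algebra of `q`. -/
noncomputable def projR : B →ₗc[k] Taft hq :=
  (tensorSnd k _ _).comp (mulCoalgEquiv hi).symm.toCoalgHom

/-- The coalgebra projection `a b ↦ ε(b) a` onto the Taft algebra of `q'`. -/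
noncomputable def projL : B →ₗc[k] Taft hq' :=
  (tensorFst k _ _).comp (mulCoalgEquiv hi).symm.toCoalgHom

theorem projR_mul (a : Taft hq') (b : Taft hq) :
    projR hi (inl a * inr b) = counit (R := k) a • b :=
  congrArg (tensorSnd k _ _) ((mulCoalgEquiv hi).symm_apply_apply (a ⊗ₜ b))

theorem projL_mul (a : Taft hq') (b : Taft hq) :
    projL hi (inl a * inr b) = counit (R := k) b • a :=
  congrArg (tensorFst k _ _) ((mulCoalgEquiv hi).symm_apply_apply (a ⊗ₜ b))

theorem projR_inr (b : Taft hq) : projR hi (inr b) = b := by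
  simpa using projR_mul hi 1 b

theorem projR_inl (a : Taft hq') : projR hi (inl a) = counit (R := k) a • 1 := by
  simpa using projR_mul hi a 1

theorem projL_inl (a : Taft hq') : projL hi (inl a) = a := by
  simpa using projL_mul hi a 1

theorem x_notMem_torus (hi : Function.Injective (mulCoalgHom hq' hq σ α)) :
    γ .x ∉ torus hq' hq σ α := fun hx => by
  have hform := linearMap_eq_zero_of_mem_torus
    (L := Taft.skewForm hq ∘ₗ (projR hi : B →ₗ[k] Taft hq))
    (fun g hg => Taft.skewForm_of_isGroupLikeElem (hg.map (projR hi))) hx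
  rw [← inr_x, LinearMap.comp_apply, CoalgHom.coe_toLinearMap, projR_inr, Taft.skewForm_x] at hform
  exact one_ne_zero hform

theorem X_notMem_torus (hi : Function.Injective (mulCoalgHom hq' hq σ α)) :
    γ .X ∉ torus hq' hq σ α := fun hX => by
  have hform := linearMap_eq_zero_of_mem_torus
    (L := Taft.skewForm hq' ∘ₗ (projL hi : B →ₗ[k] Taft hq'))
    (fun g hg => Taft.skewForm_of_isGroupLikeElem (hg.map (projL hi))) hX
  rw [← inl_x, LinearMap.comp_apply, CoalgHom.coe_toLinearMap, projL_inl, Taft.skewForm_x] at hform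
  exact one_ne_zero hform

theorem x_ne_zero (hi : Function.Injective (mulCoalgHom hq' hq σ α)) : γ .x ≠ 0 := fun hx =>
  x_notMem_torus hi (hx ▸ zero_mem _)

theorem X_ne_zero (hi : Function.Injective (mulCoalgHom hq' hq σ α)) : γ .X ≠ 0 := fun hX =>
  X_notMem_torus hi (hX ▸ zero_mem _)

theorem h_ne_H (hi : Function.Injective (mulCoalgHom hq' hq σ α)) : γ .h ≠ γ .H := fun h_eq_H => by
  rw [← inr_h, ← inl_h] at h_eq_H
  have hproj := congrArg (projR hi) h_eq_H
  rw [projR_inr, projR_inl, Taft.counit_h, one_smul] at hproj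
  exact Taft.h_ne_one hq hproj

theorem one_sub_Hh_ne_zero (hi : Function.Injective (mulCoalgHom hq' hq σ α)) :
    1 - γ .H * γ .h ≠ 0 := fun hzero => by
  have hproj := congrArg (projR hi) (sub_eq_zero.1 hzero)
  rw [← inr_h, ← inl_h, projR_mul, Taft.counit_h, one_smul, ← map_one inr, projR_inr] at hproj
  exact Taft.h_ne_one hq hproj.symm

theorem mem_torus_of_isGroupLikeElem (hi : Function.Injective (mulCoalgHom hq' hq σ α)) {g : B}
    (hg : IsGroupLikeElem k g) : g ∈ torus hq' hq σ α :=
  (mulCoalgEquiv hi).apply_symm_apply g ▸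
    mulCoalgHom_mem_torus_of_isGroupLikeElem (hg.map (mulCoalgEquiv hi).symm)

theorem cases_of_isSkewPrimitive (hi : Function.Injective (mulCoalgHom hq' hq σ α)) {g y : B}
    (hg : IsGroupLikeElem k g) (hy : IsSkewPrimitive k g y) :
    y ∈ torus hq' hq σ α ∨
      (g = γ .h ∧ ∃ β : k, y - β • γ .x ∈ torus hq' hq σ α) ∨
      (g = γ .H ∧ ∃ β : k, y - β • γ .X ∈ torus hq' hq σ α) := by
  let e := mulCoalgEquiv hi
  have one_symm : e.symm 1 = 1 := by
    rw [← mulCoalgHom_one (hq' := hq') (hq := hq) (σ := σ) (α := α)]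
    exact e.symm_apply_apply 1
  have hcases := mulCoalgHom_cases_of_isSkewPrimitive (σ := σ) (α := α) (hg.map e.symm)
    (hy.map e.symm.toCoalgHom one_symm)
  have apply_symm (a : B) : mulCoalgHom hq' hq σ α (e.symm a) = a := e.apply_symm_apply a
  simpa only [CoalgEquiv.toCoalgHom_eq_coe, CoalgHom.coe_coe, apply_symm] using hcases

theorem cases_of_isSkewPrimitive_of_qcomm (hi : Function.Injective (mulCoalgHom hq' hq σ α))
    {g y : B} {r : k} (hg : IsGroupLikeElem k g) (hy : IsSkewPrimitive k g y) (hy0 : y ≠ 0)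
    (hr : r ≠ 1) (hyg : y * g = r • (g * y)) :
    (g = γ .h ∧ r = q ∧ ∃ β : k, y = β • γ .x) ∨
      (g = γ .H ∧ r = q' ∧ ∃ β : k, y = β • γ .X) := by
  have rel := relations hq' hq σ α
  rcases cases_of_isSkewPrimitive hi hg hy with htorus | ⟨rfl, β, hβ⟩ | ⟨rfl, β, hβ⟩
  · have hcomm := commute_of_mem_torus htorus (mem_torus_of_isGroupLikeElem hi hg)
    have hzero : (1 - r) • (g * y) = 0 := by rw [sub_smul, one_smul, ← hyg, hcomm, sub_self]
    have hgy := (smul_eq_zero.1 hzero).resolve_left (sub_ne_zero.2 hr.symm)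
    exact absurd (hg.isUnit.mul_right_eq_zero.1 hgy) hy0
  · obtain ⟨hv, hβr⟩ := eq_zero_and_eq_of_qcomm (S := (torus hq' hq σ α).toSubmodule)
      isGroupLikeElem_h.isUnit rel.xh (commute_of_mem_torus hβ (h_mem_torus hq' hq σ α))
      (x_notMem_torus hi) hβ hr (by rwa [add_sub_cancel])
    rw [sub_eq_zero] at hv
    refine .inl ⟨rfl, hβr.resolve_left ?_, β, hv⟩
    rintro rfl
    exact hy0 (by rw [hv, zero_smul])
  · obtain ⟨hv, hβr⟩ := eq_zero_and_eq_of_qcomm (S := (torus hq' hq σ α).toSubmodule)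
      isGroupLikeElem_H.isUnit rel.XH (commute_of_mem_torus hβ (H_mem_torus hq' hq σ α))
      (X_notMem_torus hi) hβ hr (by rwa [add_sub_cancel])
    rw [sub_eq_zero] at hv
    refine .inr ⟨rfl, hβr.resolve_left ?_, β, hv⟩
    rintro rfl
    exact hy0 (by rw [hv, zero_smul])

end Classification

end Bicross

section Involution

variable {G N : Type*} [Group G] [Group N]

/-- The homomorphism from `ℤ/2` sending the class of `1` to an element `s` with `s² = 1`. -/
def involutionHom (s : G) (hs : s * s = 1) : Multiplicative (ZMod 2) →* G where
  toFun z := if z = 1 then 1 else s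
  map_one' := if_pos rfl
  map_mul' a b := by
    have cases_zmod : ∀ z : Multiplicative (ZMod 2), z = 1 ∨ z = .ofAdd 1 := by decide
    have ofAdd_ne_one : (.ofAdd 1 : Multiplicative (ZMod 2)) ≠ 1 := by decide
    have ofAdd_mul_self : (.ofAdd 1 * .ofAdd 1 : Multiplicative (ZMod 2)) = 1 := by decide
    rcases cases_zmod a with rfl | rfl <;> rcases cases_zmod b with rfl | rfl <;>
      simp [ofAdd_ne_one, ofAdd_mul_self, hs]

theorem involutionHom_ofAdd_one (s : G) (hs : s * s = 1) :
    involutionHom s hs (.ofAdd 1) = s := rfl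

theorem involutionAction_ofAdd_one (ε : MulAut N) (hε : ε * ε = 1) :
    involutionAction ε hε (.ofAdd 1) = ε := rfl

theorem nonempty_mulEquiv_semidirectProduct {ι : N →* G} (hι : Function.Injective ι) {s : G}
    (hs : s * s = 1) (s_notMem : s ∉ ι.range) {ε : MulAut N} (hε : ε * ε = 1)
    (hconj : ∀ c, ι (ε c) = s * ι c * s) (hcover : ∀ g, g ∈ ι.range ∨ g * s ∈ ι.range) :
    Nonempty (G ≃* N ⋊[involutionAction ε hε] Multiplicative (ZMod 2)) := by
  have cases_zmod : ∀ z : Multiplicative (ZMod 2), z = 1 ∨ z = .ofAdd 1 := by decide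
  let F : N ⋊[involutionAction ε hε] Multiplicative (ZMod 2) →* G :=
    SemidirectProduct.lift ι (involutionHom s hs) (by
      intro z
      ext c
      rcases cases_zmod z with rfl | rfl
      · simp
      · simp [involutionAction_ofAdd_one, involutionHom_ofAdd_one, hconj,
          inv_eq_of_mul_eq_one_left hs])
  have F_apply (c z) : F ⟨c, z⟩ = ι c * involutionHom s hs z := rfl
  refine ⟨(MulEquiv.ofBijective F ⟨(injective_iff_map_eq_one F).2 ?_, fun g => ?_⟩).symm⟩
  · rintro ⟨c, z⟩ hcz
    rw [F_apply] at hcz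
    rcases cases_zmod z with rfl | rfl
    · rw [map_one, mul_one] at hcz
      rw [(map_eq_one_iff ι hι).1 hcz]
      rfl
    · rw [involutionHom_ofAdd_one] at hcz
      exact absurd ⟨c⁻¹, by rw [map_inv, inv_eq_of_mul_eq_one_right hcz]⟩ s_notMem
  · obtain ⟨c, hc⟩ | ⟨c, hc⟩ := hcover g
    · exact ⟨⟨c, 1⟩, by rw [F_apply, map_one, mul_one, hc]⟩
    · exact ⟨⟨c, .ofAdd 1⟩, by
        rw [F_apply, involutionHom_ofAdd_one, hc, mul_assoc, hs, mul_one]⟩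

end Involution

section HopfAut

variable {k A : Type*} [CommSemiring k] [Semiring A] [Algebra k A] [CoalgebraStruct k A]

theorem hopfAut_mul_apply (φ ψ : HopfAut k A) (a : A) : (φ * ψ) a = φ (ψ a) := rfl

theorem hopfAut_one_apply (a : A) : (1 : HopfAut k A) a = a := rfl

end HopfAut

/-- The pairs `(a, b)` for which `x ↦ a x`, `X ↦ b X` respects the relation
`x X = σ X x + α (1 - H h)`. -/
def scalingGroup {k : Type*} [CommRing k] (α : k) : Subgroup (kˣ × kˣ) where
  carrier := {p | α * (p.1 * p.2) = α}
  one_mem' := by simp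
  mul_mem' {p r} hp hr := by
    simp only [Set.mem_ofPred_eq, Prod.fst_mul, Prod.snd_mul, Units.val_mul] at hp hr ⊢
    rw [mul_mul_mul_comm, ← mul_assoc, hp, hr]
  inv_mem' {p} hp := by
    simp only [Set.mem_ofPred_eq, Prod.fst_inv, Prod.snd_inv, ← Units.val_mul, ← mul_inv] at hp ⊢
    rw [Units.mul_inv_eq_iff_eq_mul, hp]

theorem mem_scalingGroup {k : Type*} [CommRing k] {α : k} {p : kˣ × kˣ} :
    p ∈ scalingGroup α ↔ α * (p.1 * p.2) = α := Iff.rfl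

namespace Bicross

section Scale

variable {k : Type*} [Field k] {m n : ℕ} {q q' : k} {hq' : IsPrimitiveRoot q' n}
  {hq : IsPrimitiveRoot q m} {σ α : k}

local notation "B" => Bicross hq' hq σ α
local notation "γ" => gen hq' hq σ α

theorem scale_relations (p : scalingGroup α) :
    BicrossRelations m n q q' σ α (γ .h) ((p.1.1 : k) • γ .x) (γ .H) ((p.1.2 : k) • γ .X) := by
  have r := relations hq' hq σ α
  refine ⟨r.h_pow, r.H_pow, ?_, ?_, ?_, ?_, ?_, ?_, ?_, r.hH⟩
  · rw [smul_pow, r.x_pow, smul_zero]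
  · rw [smul_pow, r.X_pow, smul_zero]
  · rw [smul_mul_assoc, r.xh, mul_smul_comm, smul_comm]
  · rw [smul_mul_assoc, r.XH, mul_smul_comm, smul_comm]
  · rw [smul_mul_assoc, r.xH, mul_smul_comm, smul_comm]
  · rw [smul_mul_assoc, mul_smul_comm, r.hX, smul_comm]
  · rw [smul_mul_smul_comm, smul_mul_smul_comm, r.xX, smul_add, smul_smul _ α,
      mul_comm _ α, mem_scalingGroup.1 p.2, smul_comm _ σ, mul_comm (p.1.1 : k)]

variable [NeZero m] [NeZero n]

theorem hopfAut_ext {φ ψ : HopfAut k B} (h : ∀ i, φ (γ i) = ψ (γ i)) : φ = ψ :=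
  have hφψ : ((φ : B ≃ₐ[k] B) : B →ₐ[k] B) = (ψ : B ≃ₐ[k] B) := algHom_ext h
  BialgEquiv.ext fun a => DFunLike.congr_fun hφψ a

variable (hq' hq σ α) in
/-- The automorphisms `x ↦ a x`, `X ↦ b X`. -/
noncomputable def scale : scalingGroup α →* HopfAut k B where
  toFun p := BialgEquiv.ofAlgEquiv
    (AlgEquiv.ofAlgHom (lift (scale_relations p)) (lift (scale_relations p⁻¹))
      (algHom_ext (by rintro (_ | _ | _ | _) <;> simp [smul_smul]))
      (algHom_ext (by rintro (_ | _ | _ | _) <;> simp [smul_smul])))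
    (algHom_ext (by rintro (_ | _ | _ | _) <;> simp [counit_h, counit_x, counit_H, counit_X]))
    (algHom_ext (by
      rintro (_ | _ | _ | _) <;>
        simp [comul_h, comul_x, comul_H, comul_X, TensorProduct.smul_tmul']))
  map_one' := hopfAut_ext (by rintro (_ | _ | _ | _) <;> simp [hopfAut_one_apply])
  map_mul' p r := hopfAut_ext (by
    rintro (_ | _ | _ | _) <;> simp [hopfAut_mul_apply, smul_smul, mul_comm])

variable (p : scalingGroup α)

@[simp] theorem scale_h : scale hq' hq σ α p (γ .h) = γ .h := lift_h ..
@[simp] theorem scale_x : scale hq' hq σ α p (γ .x) = (p.1.1 : k) • γ .x := lift_x ..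
@[simp] theorem scale_H : scale hq' hq σ α p (γ .H) = γ .H := lift_H ..
@[simp] theorem scale_X : scale hq' hq σ α p (γ .X) = (p.1.2 : k) • γ .X := lift_X ..

end Scale

section Swap

variable {k : Type*} [Field k] {n : ℕ} {q q' : k} {hq' : IsPrimitiveRoot q' n}
  {hq : IsPrimitiveRoot q n} {σ α : k}

local notation "B" => Bicross hq' hq σ α
local notation "γ" => gen hq' hq σ α

theorem swap_relations (hqq' : q = q') (hσ : σ ^ 2 = 1) (hα : σ * α = -α) :
    BicrossRelations n n q q' σ α (γ .H) (γ .X) (γ .h) (γ .x) := by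
  subst hqq'
  have r := relations hq' hq σ α
  have hσσ : σ * σ = 1 := by rw [← pow_two, hσ]
  refine ⟨r.H_pow, r.h_pow, r.X_pow, r.x_pow, r.XH, r.xh, ?_, ?_, ?_, r.hH.symm⟩
  · rw [r.hX, smul_smul, hσσ, one_smul]
  · rw [r.xH, smul_smul, hσσ, one_smul]
  · rw [r.xX, smul_add, smul_smul, smul_smul, hσσ, hα, one_smul, neg_smul, r.hH,
      neg_add_cancel_right]

variable [NeZero n]

/-- The automorphism which exchanges `h` with `H` and `x` with `X`. -/
noncomputable def swap (hqq' : q = q') (hσ : σ ^ 2 = 1) (hα : σ * α = -α) : HopfAut k B :=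
  BialgEquiv.ofAlgEquiv
    (AlgEquiv.ofAlgHom (lift (swap_relations hqq' hσ hα)) (lift (swap_relations hqq' hσ hα))
      (algHom_ext (by rintro (_ | _ | _ | _) <;> simp))
      (algHom_ext (by rintro (_ | _ | _ | _) <;> simp)))
    (algHom_ext (by rintro (_ | _ | _ | _) <;> simp [counit_h, counit_x, counit_H, counit_X]))
    (algHom_ext (by rintro (_ | _ | _ | _) <;> simp [comul_h, comul_x, comul_H, comul_X]))

variable {hqq' : q = q'} {hσ : σ ^ 2 = 1} {hα : σ * α = -α}

@[simp] theorem swap_h : (swap hqq' hσ hα : HopfAut k B) (γ .h) = γ .H := lift_h ..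
@[simp] theorem swap_x : (swap hqq' hσ hα : HopfAut k B) (γ .x) = γ .X := lift_x ..
@[simp] theorem swap_H : (swap hqq' hσ hα : HopfAut k B) (γ .H) = γ .h := lift_H ..
@[simp] theorem swap_X : (swap hqq' hσ hα : HopfAut k B) (γ .X) = γ .x := lift_X ..

theorem swap_mul_swap : (swap hqq' hσ hα * swap hqq' hσ hα : HopfAut k B) = 1 :=
  hopfAut_ext (by rintro (_ | _ | _ | _) <;> simp [hopfAut_mul_apply, hopfAut_one_apply])

end Swap

section HopfAut

variable {k : Type*} [Field k] {m n : ℕ} {q q' : k} {hq' : IsPrimitiveRoot q' n}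
  {hq : IsPrimitiveRoot q m} {σ α : k} [m.AtLeastTwo] [n.AtLeastTwo]

local notation "B" => Bicross hq' hq σ α
local notation "γ" => gen hq' hq σ α

variable (hi : Function.Injective (mulCoalgHom hq' hq σ α))
include hi

theorem scale_injective : Function.Injective (scale hq' hq σ α) := fun p r hpr => by
  have hx := DFunLike.congr_fun hpr (γ .x)
  have hX := DFunLike.congr_fun hpr (γ .X)
  rw [scale_x, scale_x] at hx
  rw [scale_X, scale_X] at hX
  exact Subtype.ext (Prod.ext (Units.ext (smul_left_injective k (x_ne_zero hi) hx))
    (Units.ext (smul_left_injective k (X_ne_zero hi) hX)))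

theorem mem_range_scale {φ : HopfAut k B} (hh : φ (γ .h) = γ .h) (hH : φ (γ .H) = γ .H)
    {a b : k} (hx : φ (γ .x) = a • γ .x) (hX : φ (γ .X) = b • γ .X) :
    φ ∈ (scale hq' hq σ α).range := by
  have ha : a ≠ 0 := by
    rintro rfl
    rw [zero_smul, map_eq_zero_iff φ (EquivLike.injective φ)] at hx
    exact x_ne_zero hi hx
  have hb : b ≠ 0 := by
    rintro rfl
    rw [zero_smul, map_eq_zero_iff φ (EquivLike.injective φ)] at hX
    exact X_ne_zero hi hX
  have hab : α * (a * b) = α := by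
    have r := relations hq' hq σ α
    have hxX := congrArg φ r.xX
    simp only [map_mul, map_add, map_smul, map_sub, map_one, hh, hH, hx, hX] at hxX
    rw [smul_mul_smul_comm, smul_mul_smul_comm, r.xX, smul_add, mul_comm b a,
      smul_comm (a * b) σ, add_right_inj, smul_smul, mul_comm] at hxX
    exact smul_left_injective k (one_sub_Hh_ne_zero hi) hxX
  refine ⟨⟨(Units.mk0 a ha, Units.mk0 b hb), hab⟩, hopfAut_ext ?_⟩
  rintro (_ | _ | _ | _) <;> simp [hh, hH, hx, hX]

theorem mem_range_scale_or_exchange (φ : HopfAut k B) :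
    φ ∈ (scale hq' hq σ α).range ∨ (q = q' ∧ φ (γ .h) = γ .H ∧ φ (γ .H) = γ .h ∧
      ∃ a b : k, φ (γ .x) = a • γ .X ∧ φ (γ .X) = b • γ .x) := by
  have r := relations hq' hq σ α
  have φ_inj := EquivLike.injective φ
  have x_cases := cases_of_isSkewPrimitive_of_qcomm hi (y := φ (γ .x)) (isGroupLikeElem_h.map φ)
    (isSkewPrimitive_x.map φ.toCoalgHom (map_one φ))
    ((map_ne_zero_iff φ φ_inj).2 (x_ne_zero hi)) (hq.ne_one Nat.AtLeastTwo.prop)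
    (by simpa using congrArg φ r.xh)
  have X_cases := cases_of_isSkewPrimitive_of_qcomm hi (y := φ (γ .X)) (isGroupLikeElem_H.map φ)
    (isSkewPrimitive_X.map φ.toCoalgHom (map_one φ))
    ((map_ne_zero_iff φ φ_inj).2 (X_ne_zero hi)) (hq'.ne_one Nat.AtLeastTwo.prop)
    (by simpa using congrArg φ r.XH)
  rcases x_cases with ⟨hh, -, a, ha⟩ | ⟨hh, hqq', a, ha⟩ <;>
    rcases X_cases with ⟨hH, -, b, hb⟩ | ⟨hH, -, b, hb⟩
  · exact absurd (φ_inj (hh.trans hH.symm)) (h_ne_H hi)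
  · exact .inl (mem_range_scale hi hh hH ha hb)
  · exact .inr ⟨hqq', hh, hH, a, b, ha, hb⟩
  · exact absurd (φ_inj (hh.trans hH.symm)) (h_ne_H hi)

theorem sq_eq_one_of_exchange {φ : HopfAut k B} (hH : φ (γ .H) = γ .h) {a : k}
    (hx : φ (γ .x) = a • γ .X) : σ ^ 2 = 1 := by
  have r := relations hq' hq σ α
  have hφx : φ (γ .x) ≠ 0 := (map_ne_zero_iff φ (EquivLike.injective φ)).2 (x_ne_zero hi)
  have hxH := congrArg φ r.xH
  simp only [map_mul, map_smul, hH] at hxH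
  have hhx : γ .h * φ (γ .x) = σ • (φ (γ .x) * γ .h) := by
    rw [hx, mul_smul_comm, r.hX, smul_mul_assoc, smul_comm]
  rw [hhx, smul_smul, ← pow_two] at hxH
  have hne : φ (γ .x) * γ .h ≠ 0 := fun hzero =>
    hφx (isGroupLikeElem_h.isUnit.mul_left_eq_zero.1 hzero)
  exact smul_left_injective k hne (by simpa using hxH.symm)

theorem nonempty_hopfAut_mulEquiv (hqσ : q ≠ q' ∨ σ ^ 2 ≠ 1) :
    Nonempty (HopfAut k B ≃* scalingGroup α) := by
  refine ⟨(MulEquiv.ofBijective (scale hq' hq σ α) ⟨scale_injective hi, fun φ => ?_⟩).symm⟩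
  obtain hφ | ⟨hqq', -, hH, a, -, hx, -⟩ := mem_range_scale_or_exchange hi φ
  · exact hφ
  · exact (hqσ.elim (· hqq') (· (sq_eq_one_of_exchange hi hH hx))).elim

end HopfAut

section Semidirect

variable {k : Type*} [Field k] {n : ℕ} {q q' : k} {hq' : IsPrimitiveRoot q' n}
  {hq : IsPrimitiveRoot q n} {σ α : k} [n.AtLeastTwo]

local notation "B" => Bicross hq' hq σ α
local notation "γ" => gen hq' hq σ α

theorem nonempty_hopfAut_mulEquiv_semidirect {N : Type*} [Group N]
    (hi : Function.Injective (mulCoalgHom hq' hq σ α)) (hqq' : q = q') (hσ : σ ^ 2 = 1)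
    (hα : σ * α = -α) (e : N ≃* scalingGroup α) {ε : MulAut N} (hε : ε * ε = 1)
    (heε : ∀ c, (e (ε c) : kˣ × kˣ) = (e c : kˣ × kˣ).swap) :
    Nonempty (HopfAut k B ≃* N ⋊[involutionAction ε hε] Multiplicative (ZMod 2)) := by
  let s : HopfAut k B := swap hqq' hσ hα
  have range_eq : ((scale hq' hq σ α).comp e.toMonoidHom).range = (scale hq' hq σ α).range := by
    rw [MonoidHom.range_comp, MonoidHom.range_eq_top.2 e.surjective, MonoidHom.range_eq_map]
  refine nonempty_mulEquiv_semidirectProduct (ι := (scale hq' hq σ α).comp e.toMonoidHom) (s := s)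
    ((scale_injective hi).comp e.injective) swap_mul_swap ?_ hε (fun c => hopfAut_ext ?_)
    fun φ => ?_
  · rintro ⟨c, hc⟩
    have hh := DFunLike.congr_fun hc (γ .h)
    exact h_ne_H hi (by simpa [s] using hh)
  · rintro (_ | _ | _ | _) <;> simp [hopfAut_mul_apply, heε, s]
  · rw [range_eq]
    obtain hφ | ⟨-, hh, hH, a, b, hx, hX⟩ := mem_range_scale_or_exchange hi φ
    · exact .inl hφ
    · exact .inr (mem_range_scale hi (a := b) (b := a) (by simp [hopfAut_mul_apply, s, hH])
        (by simp [hopfAut_mul_apply, s, hh]) (by simp [hopfAut_mul_apply, s, hX])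
        (by simp [hopfAut_mul_apply, s, hx]))

end Semidirect

end Bicross

theorem toLinearMap_mul_lmul {k A : Type*} [CommSemiring k] [Semiring A] [Algebra k A]
    (f : A →ₐ[k] A) (a : A) :
    f.toLinearMap * Algebra.lmul k A a = Algebra.lmul k A (f a) * f.toLinearMap :=
  LinearMap.ext fun b => map_mul f a b

namespace Taft

variable {k : Type*} [Field k] {m : ℕ} {q : k} (hq : IsPrimitiveRoot q m)

/-- The endomorphism `h ↦ a h`, `x ↦ b x`, where `a ^ m = 1`. -/
noncomputable def rescale (a b : k) (ha : a ^ m = 1) : Taft hq →ₐ[k] Taft hq :=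
  lift (a • h hq) (b • x hq) (by rw [smul_pow, h_pow, ha, one_smul])
    (by rw [smul_pow, x_pow, smul_zero])
    (by rw [smul_mul_smul_comm, smul_mul_smul_comm, xh, smul_comm, mul_comm b])

variable {a b c d : k} (ha : a ^ m = 1) (hc : c ^ m = 1)

@[simp] theorem rescale_h : rescale hq a b ha (h hq) = a • h hq := lift_h ..
@[simp] theorem rescale_x : rescale hq a b ha (x hq) = b • x hq := lift_x ..

theorem rescale_comp_rescale : (rescale hq a b ha).comp (rescale hq c d hc) =
    rescale hq (a * c) (b * d) (by rw [mul_pow, ha, hc, mul_one]) :=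
  algHom_ext (by simp [smul_smul, mul_comm]) (by simp [smul_smul, mul_comm])

theorem rescale_one_one : rescale hq 1 1 (one_pow m) = AlgHom.id k _ :=
  algHom_ext (by simp) (by simp)

theorem rescale_toLinearMap_pow (j : ℕ) : (rescale hq a b ha).toLinearMap ^ j =
    (rescale hq (a ^ j) (b ^ j) (by rw [pow_right_comm, ha, one_pow])).toLinearMap := by
  induction j with
  | zero => simp only [pow_zero, rescale_one_one]; rfl
  | succ j ih =>
    rw [pow_succ, ih, Module.End.mul_eq_comp, ← AlgHom.comp_toLinearMap, rescale_comp_rescale]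
    simp only [pow_succ]

end Taft

namespace Bicross

variable {k : Type*} [Field k] {m n : ℕ} {q q' : k} (hq' : IsPrimitiveRoot q' n)
  (hq : IsPrimitiveRoot q m) {σ : k}

theorem tensor_relations (hσm : σ ^ m = 1) (hσn : σ ^ n = 1) :
    BicrossRelations (B := Module.End k (Taft hq') ⊗[k] Module.End k (Taft hq)) m n q q' σ 0
      ((Taft.rescale hq' 1 σ (one_pow n)).toLinearMap ⊗ₜ Algebra.lmul k _ (Taft.h hq))
      ((Taft.rescale hq' σ σ hσn).toLinearMap ⊗ₜ Algebra.lmul k _ (Taft.x hq))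
      (Algebra.lmul k _ (Taft.h hq') ⊗ₜ 1) (Algebra.lmul k _ (Taft.x hq') ⊗ₜ 1) := by
  constructor
  · rw [Algebra.TensorProduct.tmul_pow, Taft.rescale_toLinearMap_pow, ← map_pow, Taft.h_pow]
    simp only [one_pow, hσm, Taft.rescale_one_one, map_one]
    rfl
  · rw [Algebra.TensorProduct.tmul_pow, ← map_pow, Taft.h_pow, map_one, one_pow]
    rfl
  · rw [Algebra.TensorProduct.tmul_pow, ← map_pow, Taft.x_pow, map_zero, TensorProduct.tmul_zero]
  · rw [Algebra.TensorProduct.tmul_pow, ← map_pow, Taft.x_pow, map_zero, TensorProduct.zero_tmul]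
  · simp only [Algebra.TensorProduct.tmul_mul_tmul, Module.End.mul_eq_comp (M := Taft hq'),
      ← AlgHom.comp_toLinearMap, Taft.rescale_comp_rescale, ← map_mul, Taft.xh, map_smul,
      TensorProduct.tmul_smul, one_mul, mul_one]
  all_goals simp only [Algebra.TensorProduct.tmul_mul_tmul, toLinearMap_mul_lmul,
    Taft.rescale_h, Taft.rescale_x, map_smul, ← map_mul, Taft.xh, smul_mul_assoc,
    ← TensorProduct.smul_tmul', mul_one, one_mul, one_smul, zero_smul, add_zero]

variable [NeZero m] [NeZero n]

/-- The representation of `Bicross` with `σ ^ m = σ ^ n = 1` and `α = 0` on the space of ordered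
products `T' ⊗ T`. -/
noncomputable def tensorRep (hσm : σ ^ m = 1) (hσn : σ ^ n = 1) :
    Bicross hq' hq σ 0 →ₐ[k] Module.End k (Taft hq' ⊗[k] Taft hq) :=
  Module.endTensorEndAlgHom.comp (lift (tensor_relations hq' hq hσm hσn))

variable (hσm : σ ^ m = 1) (hσn : σ ^ n = 1)

theorem tensorRep_inl_tmul (a a' : Taft hq') (b : Taft hq) :
    tensorRep hq' hq hσm hσn (inl a) (a' ⊗ₜ b) = (a * a') ⊗ₜ b := by
  have lift_comp_inl : (lift (tensor_relations hq' hq hσm hσn)).comp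
      (inl : Taft hq' →ₐc[k] Bicross hq' hq σ 0).toAlgHom =
        Algebra.TensorProduct.includeLeft.comp (Algebra.lmul k (Taft hq')) := by
    refine Taft.algHom_ext (B := Module.End k (Taft hq') ⊗[k] Module.End k (Taft hq)) ?_ ?_
    · exact (congrArg _ inl_h).trans (lift_H _)
    · exact (congrArg _ inl_x).trans (lift_X _)
  exact congrArg (fun f => Module.endTensorEndAlgHom f (a' ⊗ₜ b))
    (DFunLike.congr_fun lift_comp_inl a)

theorem tensorRep_inr_one_tmul (b b' : Taft hq) :
    tensorRep hq' hq hσm hσn (inr b) (1 ⊗ₜ b') = 1 ⊗ₜ (b * b') := by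
  have hb : b ∈ Algebra.adjoin k {Taft.h hq, Taft.x hq} := Taft.adjoin_eq_top hq ▸ Algebra.mem_top
  induction hb using Algebra.adjoin_induction generalizing b' with
  | mem b hb =>
    rcases hb with rfl | rfl <;> simp [tensorRep, Module.endTensorEndAlgHom_apply]
  | algebraMap c => simp [Algebra.algebraMap_eq_smul_one]
  | add a b _ _ ha hb =>
    rw [map_add, map_add, LinearMap.add_apply, ha, hb, add_mul, TensorProduct.tmul_add]
  | mul a b _ _ ha hb => rw [map_mul, map_mul, Module.End.mul_apply, hb, ha, mul_assoc]

theorem mulCoalgHom_injective (hσm : σ ^ m = 1) (hσn : σ ^ n = 1) :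
    Function.Injective (mulCoalgHom hq' hq σ 0) := by
  apply Function.LeftInverse.injective (g := fun a => tensorRep hq' hq hσm hσn a (1 ⊗ₜ 1))
  intro z
  induction z with
  | zero => simp
  | add z w hz hw => simp only [map_add, LinearMap.add_apply, hz, hw]
  | tmul a b => simp [tensorRep_inl_tmul, tensorRep_inr_one_tmul]

end Bicross

section ConvDual

variable {k C : Type*} [CommSemiring k] [AddCommMonoid C] [Module k C] [Coalgebra k C]

theorem convMul_toConv_eq_comp_leftHit (f : WithConv (C →ₗ[k] k)) (g : C →ₗ[k] k) :
    f * toConv g = toConv (f.ofConv ∘ₗ leftHit g) := by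
  ext a
  rw [LinearMap.convMul_apply]
  simp only [leftHit, LinearMap.comp_apply]
  induction comul (R := k) a with
  | zero => simp
  | add s t hs ht => simp only [map_add, hs, ht]
  | tmul b c => simp [mul_comm]

theorem toConv_convMul_eq_comp_rightHit (f : WithConv (C →ₗ[k] k)) (g : C →ₗ[k] k) :
    toConv g * f = toConv (f.ofConv ∘ₗ rightHit g) := by
  ext a
  rw [LinearMap.convMul_apply]
  simp only [rightHit, LinearMap.comp_apply]
  induction comul (R := k) a with
  | zero => simp
  | add s t hs ht => simp only [map_add, hs, ht]
  | tmul b c => simp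

theorem toConv_pow_eq_counit_comp_leftHit_pow (g : C →ₗ[k] k) (j : ℕ) :
    toConv g ^ j = toConv (counit ∘ₗ leftHit g ^ j) := by
  induction j with
  | zero => rfl
  | succ j ih =>
    rw [pow_succ, ih, convMul_toConv_eq_comp_leftHit, pow_succ, Module.End.mul_eq_comp]
    rfl

end ConvDual

namespace Taft

variable {k : Type*} [Field k] {n : ℕ} {q q' : k} (hq : IsPrimitiveRoot q n)

section Character

variable [NeZero n]

/-- The character with `h ↦ q⁻¹ ^ j` and `x ↦ 0`. -/
noncomputable def characterPow (j : ℕ) : Taft hq →ₐ[k] k :=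
  lift (q⁻¹ ^ j) 0 (by rw [pow_right_comm, inv_pow, hq.pow_eq_one, inv_one, one_pow])
    (zero_pow (NeZero.ne n)) (by simp)

@[simp] theorem characterPow_h (j : ℕ) : characterPow hq j (h hq) = q⁻¹ ^ j := lift_h ..

@[simp] theorem characterPow_x (j : ℕ) : characterPow hq j (x hq) = 0 := lift_x ..

theorem toConv_character_pow (j : ℕ) : (toConv (character hq).toLinearMap) ^ j =
    (toConv (characterPow hq j).toLinearMap : ConvDual k (Taft hq)) := by
  induction j with
  | zero =>
    have : characterPow hq 0 = Bialgebra.counitAlgHom k _ :=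
      algHom_ext (by simp [counit_h]) (by simp [counit_x])
    rw [this, pow_zero]
    rfl
  | succ j ih =>
    have : characterPow hq (j + 1) =
        (toConv (characterPow hq j) * toConv (character hq)).ofConv :=
      algHom_ext (by simp [AlgHom.convMul_apply, comul_h, pow_succ])
        (by simp [AlgHom.convMul_apply, comul_x])
    rw [pow_succ, ih, this, AlgHom.toLinearMap_convMul]

theorem eq_zero_of_characterPow_eq_zero {a : Taft hq} (ha : a ∈ torus hq)
    (hχ : ∀ j, characterPow hq j a = 0) : a = 0 := by
  rw [torus, Algebra.adjoin_singleton_eq_range_aeval] at ha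
  obtain ⟨p, rfl⟩ := ha
  have isRoot (j : ℕ) : p.IsRoot (q⁻¹ ^ j) := by
    have hj : characterPow hq j (Polynomial.aeval (h hq) p) = 0 := hχ j
    rwa [← Polynomial.aeval_algHom_apply, characterPow_h,
      Polynomial.coe_aeval_eq_eval] at hj
  have dvd : Polynomial.X ^ n - 1 ∣ p := by
    rw [Polynomial.X_pow_sub_one_eq_prod (NeZero.pos n) hq.inv]
    refine Finset.prod_dvd_of_coprime
      ((Polynomial.pairwise_coprime_X_sub_C Function.injective_id).set_pairwise _) fun z hz => ?_
    obtain ⟨j, -, rfl⟩ :=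
      hq.inv.eq_pow_of_pow_eq_one ((Polynomial.mem_nthRootsFinset (NeZero.pos n) 1).1 hz)
    exact Polynomial.dvd_iff_isRoot.2 (isRoot j)
  obtain ⟨r, rfl⟩ := dvd
  change Polynomial.aeval (h hq) _ = 0
  simp [h_pow]

/-- The character `h ↦ q⁻¹`, `x ↦ 0` as an element of the dual algebra. -/
noncomputable def dualH : ConvDual k (Taft hq) := toConv (character hq).toLinearMap

theorem dualH_pow_eq_one : dualH hq ^ n = 1 := by
  have : characterPow hq n = characterPow hq 0 :=
    algHom_ext (by simp [hq.pow_eq_one]) (by simp)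
  rw [dualH, toConv_character_pow, this, ← toConv_character_pow, pow_zero]

end Character

variable [n.AtLeastTwo] (hq' : IsPrimitiveRoot q' n) (hqq' : q' = q⁻¹)

theorem character_comp_rightHit_skewForm : (character hq).toLinearMap ∘ₗ rightHit (skewForm hq) =
    q⁻¹ • (character hq).toLinearMap ∘ₗ leftHit (skewForm hq) := by
  refine LinearMap.eqLocus_eq_top.1 <| eq_top_of_adjoin_mul_mem (adjoin_eq_top hq) ?_ ?_
  · simp [leftHit_skewForm_of_mem_torus hq (one_mem _),
      rightHit_skewForm_of_mem_torus hq (one_mem _)]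
  · rintro a (rfl | rfl) b hb
    · rw [LinearMap.mem_eqLocus] at hb ⊢
      calc
        character hq (rightHit (skewForm hq) (h hq * b))
          = q⁻¹ * (q⁻¹ * character hq (rightHit (skewForm hq) b)) := by
          simp [rightHit_skewForm_h_mul]
        _ = q⁻¹ * (q⁻¹ * (q⁻¹ * character hq (leftHit (skewForm hq) b))) :=
          congrArg (fun c => q⁻¹ * (q⁻¹ * c)) hb
        _ = q⁻¹ * character hq (leftHit (skewForm hq) (h hq * b)) := by
          simp [leftHit_skewForm_h_mul]
    · simp [leftHit_skewForm_x_mul, rightHit_skewForm_x_mul]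

/-- The functional `-q⁻¹ ξ`, where `ξ` is the skew form, as an element of the dual algebra. -/
noncomputable def dualX : ConvDual k (Taft hq) := toConv (-q⁻¹ • skewForm hq)

theorem dualX_pow_eq_zero : dualX hq ^ n = 0 := by
  rw [dualX, toConv_smul, smul_pow, toConv_pow_eq_counit_comp_leftHit_pow, leftHit_skewForm_pow,
    LinearMap.comp_zero, toConv_zero, smul_zero]

theorem dualX_mul_dualH : dualX hq * dualH hq = q⁻¹ • (dualH hq * dualX hq) := by
  rw [dualX, dualH, toConv_smul, smul_mul_assoc, mul_smul_comm, smul_comm q⁻¹,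
    toConv_convMul_eq_comp_rightHit, convMul_toConv_eq_comp_leftHit,
    character_comp_rightHit_skewForm, toConv_smul]

/-- The algebra map from the Taft algebra with parameter `q⁻¹` to the dual of the Taft algebra with
parameter `q`. -/
noncomputable def toDual : Taft hq' →ₐ[k] ConvDual k (Taft hq) :=
  lift (dualH hq) (dualX hq) (dualH_pow_eq_one hq) (dualX_pow_eq_zero hq)
    (hqq' ▸ dualX_mul_dualH hq)

@[simp] theorem toDual_h : toDual hq hq' hqq' (h hq') = dualH hq := lift_h ..

@[simp] theorem toDual_x : toDual hq hq' hqq' (x hq') = dualX hq := lift_x ..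

theorem eq_zero_of_forall_toDual_eq_zero {a : Taft hq} (ha : ∀ b, toDual hq hq' hqq' b a = 0) :
    a = 0 := by
  let V : Submodule k (Taft hq) := ⨅ b, LinearMap.ker (toDual hq hq' hqq' b).ofConv
  have mem_V {a} : a ∈ V ↔ ∀ b, toDual hq hq' hqq' b a = 0 := by simp [V]
  suffices V = ⊥ from (Submodule.mem_bot k).1 (this ▸ mem_V.2 ha)
  refine eq_bot_of_leftHit_skewForm_mem hq (fun a ha => mem_V.2 fun b => ?_) fun a ha ht => ?_
  · have hbx := mem_V.1 ha (b * x hq')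
    rw [map_mul, toDual_x, dualX, toConv_smul, mul_smul_comm,
      convMul_toConv_eq_comp_leftHit] at hbx
    exact (smul_eq_zero.1 hbx).resolve_left
      (neg_ne_zero.2 (inv_ne_zero (hq.ne_zero (NeZero.ne n))))
  · refine eq_zero_of_characterPow_eq_zero hq ht fun j => ?_
    have hj := mem_V.1 ha (h hq' ^ j)
    rwa [map_pow, toDual_h, dualH, toConv_character_pow] at hj

theorem toDual_surjective : Function.Surjective (toDual hq hq' hqq') := by
  let W : Submodule k (Module.Dual k (Taft hq)) := LinearMap.range
    ((WithConv.linearEquiv k (Taft hq →ₗ[k] k)).toLinearMap ∘ₗ (toDual hq hq' hqq').toLinearMap)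
  have hbot : W.dualCoannihilator = ⊥ := (Submodule.eq_bot_iff _).2 fun a ha =>
    eq_zero_of_forall_toDual_eq_zero hq hq' hqq' fun b =>
      (Submodule.mem_dualCoannihilator a).1 ha _ ⟨b, rfl⟩
  have htop : W = ⊤ := by
    rw [← Subspace.dualCoannihilator_dualAnnihilator_eq (W := W), hbot,
      Submodule.dualAnnihilator_bot]
  intro f
  obtain ⟨b, hb⟩ : f.ofConv ∈ W := htop ▸ Submodule.mem_top
  exact ⟨b, WithConv.ofConv_injective hb⟩

theorem finrank_le_finrank_inv (hqq' : q' = q⁻¹) :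
    Module.finrank k (Taft hq) ≤ Module.finrank k (Taft hq') := by
  rw [← Subspace.dual_finrank_eq (K := k) (V := Taft hq),
    ← (WithConv.linearEquiv k (Taft hq →ₗ[k] k)).finrank_eq]
  exact LinearMap.finrank_le_finrank_of_surjective (f := (toDual hq hq' hqq').toLinearMap)
    (toDual_surjective hq hq' hqq')

theorem toDual_bijective : Function.Bijective (toDual hq hq' hqq') := by
  have finrank_eq : Module.finrank k (Taft hq') = Module.finrank k (ConvDual k (Taft hq)) := by
    rw [(WithConv.linearEquiv k (Taft hq →ₗ[k] k)).finrank_eq]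
    exact (le_antisymm (finrank_le_finrank_inv hq' hq (inv_eq_iff_eq_inv.1 hqq'.symm))
      (finrank_le_finrank_inv hq hq' hqq')).trans Subspace.dual_finrank_eq.symm
  have : Module.Finite k (ConvDual k (Taft hq)) :=
    Module.Finite.equiv (WithConv.linearEquiv k (Taft hq →ₗ[k] k)).symm
  have surjective := toDual_surjective hq hq' hqq'
  exact ⟨(LinearMap.injective_iff_surjective_of_finrank_eq_finrank finrank_eq
    (f := (toDual hq hq' hqq').toLinearMap)).2 surjective, surjective⟩

end Taft

namespace DrinfeldDouble

variable {k H : Type*} [Field k] [Ring H] [HopfAlgebra k H]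
  (hS : Function.Bijective (antipode k (A := H)))

theorem mk_mul_mk_eq_outer (f g : ConvDual k H) (a b : H) :
    mk hS f a * mk hS g b = outer f b (twist hS (comulTwo a) g) := rfl

theorem mk_one_right_mul (f g : ConvDual k H) (b : H) :
    mk hS f 1 * mk hS g b = mk hS (f * g) b := by
  rw [mk_mul_mk_eq_outer, twist_comulTwo_one, outer_tmul, one_mul]
  rfl

theorem mul_mk_one_left (f : ConvDual k H) (a b : H) :
    mk hS f a * mk hS 1 b = mk hS f (a * b) := by
  rw [mk_mul_mk_eq_outer, twist_comulTwo_unit, outer_tmul, mul_one]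
  rfl

/-- The dual algebra as a subalgebra of the Drinfeld double. -/
noncomputable def inl : ConvDual k H →ₐ[k] DrinfeldDouble hS :=
  AlgHom.ofLinearMap ((TensorProduct.mk k (ConvDual k H) H).flip 1) rfl
    fun f g => (mk_one_right_mul hS f g 1).symm

/-- The Hopf algebra as a subalgebra of its Drinfeld double. -/
noncomputable def inr : H →ₐ[k] DrinfeldDouble hS :=
  AlgHom.ofLinearMap (TensorProduct.mk k (ConvDual k H) H 1) rfl
    fun a b => (mul_mk_one_left hS 1 a b).symm

theorem inl_mul_inr (f : ConvDual k H) (a : H) : inl hS f * inr hS a = mk hS f a :=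
  (mul_mk_one_left hS f 1 a).trans (by rw [one_mul])

theorem outer_one_tmul (f : ConvDual k H) (a : H) :
    outer (k := k) 1 1 (f ⊗ₜ a) = inl hS f * inr hS a := by
  rw [outer_tmul, one_mul, mul_one, inl_mul_inr, mk]

theorem inr_mul_inl (a : H) (f : ConvDual k H) :
    inr hS a * inl hS f = outer (k := k) 1 1 (twist hS (comulTwo a) f) := rfl

theorem inr_mul_inl_of_isGroupLikeElem {g : H} (hg : IsGroupLikeElem k g) (f : ConvDual k H) :
    inr hS g * inl hS f = inl hS (coadj hS g g f) * inr hS g := by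
  rw [inr_mul_inl, comulTwo_apply, hg.comul_eq_tmul_self, LinearMap.lTensor_tmul,
    hg.comul_eq_tmul_self, twist_tmul, outer_one_tmul]

theorem inr_mul_inl_of_isSkewPrimitive {g y : H} (hg : IsGroupLikeElem k g)
    (hy : IsSkewPrimitive k g y) (f : ConvDual k H) :
    inr hS y * inl hS f = inl hS (coadj hS y g f) * inr hS g +
      (inl hS (coadj hS 1 g f) * inr hS y + inl hS (coadj hS 1 y f)) := by
  rw [inr_mul_inl, comulTwo_apply, hy, map_add, LinearMap.lTensor_tmul, LinearMap.lTensor_tmul,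
    hg.comul_eq_tmul_self, hy, TensorProduct.tmul_add]
  simp only [map_add, LinearMap.add_apply, twist_tmul]
  rw [outer_one_tmul hS, outer_one_tmul hS, outer_one_tmul hS, map_one, mul_one]
  rfl

end DrinfeldDouble

section DualComul

variable {k H : Type*} [Field k] [Ring H] [HopfAlgebra k H]

variable (k H) in
/-- The pairing of `H* ⊗ H*` with `H ⊗ H`. -/
noncomputable def dualPairing : ConvDual k H ⊗[k] ConvDual k H →ₐ[k] WithConv (H ⊗[k] H →ₗ[k] k) :=
  Algebra.TensorProduct.algHomOfLinearMapTensorProduct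
    ((WithConv.linearEquiv k _).symm.toLinearMap ∘ₗ TensorProduct.dualDistrib k H H ∘ₗ
      TensorProduct.map (WithConv.linearEquiv k (H →ₗ[k] k)).toLinearMap
        (WithConv.linearEquiv k (H →ₗ[k] k)).toLinearMap)
    (fun f₁ f₂ g₁ g₂ => by
      have map_mul := TensorProduct.map_convMul_map (f := f₁) (h := f₂) (g := g₁) (k := g₂)
      have := LinearMap.algHom_comp_convMul_distrib (Algebra.TensorProduct.lmul' k (S := k))
        (toConv (TensorProduct.map f₁.ofConv g₁.ofConv))
        (toConv (TensorProduct.map f₂.ofConv g₂.ofConv))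
      rw [map_mul] at this
      exact WithConv.ofConv_injective this) (by
      ext a b
      simp [mul_comm])

theorem dualPairing_tmul (f g : ConvDual k H) (a b : H) :
    dualPairing k H (f ⊗ₜ g) (a ⊗ₜ b) = f a * g b := rfl

theorem dualPairing_injective [Module.Finite k H] : Function.Injective (dualPairing k H) :=
  let L := WithConv.linearEquiv k (H →ₗ[k] k)
  (WithConv.linearEquiv k _).symm.injective.comp
    ((TensorProduct.dualDistribEquiv k H H).injective.comp (TensorProduct.congr L L).injective)

variable (k H) in
/-- The algebra map which sends a functional `f` to `a ⊗ b ↦ f (b * a)`. -/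
noncomputable def oppositeMul : ConvDual k H →ₐ[k] WithConv (H ⊗[k] H →ₗ[k] k) :=
  AlgHom.ofLinearMap
    ((WithConv.linearEquiv k _).symm.toLinearMap ∘ₗ
      LinearMap.lcomp k k (LinearMap.mul' k H ∘ₗ (TensorProduct.comm k H H).toLinearMap) ∘ₗ
        (WithConv.linearEquiv k (H →ₗ[k] k)).toLinearMap)
    (by
      ext a b
      simp)
    fun f g => by
      have := LinearMap.convMul_comp_coalgHom_distrib f g ((Bialgebra.mulCoalgHom k H).comp
        (Bialgebra.TensorProduct.comm k H H).toBialgHom.toCoalgHom)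
      exact WithConv.ofConv_injective this

theorem oppositeMul_tmul (f : ConvDual k H) (a b : H) :
    oppositeMul k H f (a ⊗ₜ b) = f (b * a) := rfl

theorem dualPairing_dualComulCop [Module.Finite k H] (f : ConvDual k H) :
    dualPairing k H (dualComulCop k H f) = oppositeMul k H f :=
  WithConv.ofConv_injective <| TensorProduct.ext' fun a b => dualComulCop_apply f a b

variable (k H) in
/-- The counit `f ↦ f 1` of the dual algebra. -/
noncomputable def evalOne : ConvDual k H →ₐ[k] k :=
  AlgHom.ofLinearMap
    (LinearMap.applyₗ (1 : H) ∘ₗ (WithConv.linearEquiv k (H →ₗ[k] k)).toLinearMap) (by simp)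
    fun f g => by simp [Algebra.TensorProduct.one_def]

@[simp] theorem evalOne_apply (f : ConvDual k H) : evalOne k H f = f 1 := rfl

end DualComul

namespace Taft

variable {k : Type*} [Field k] {n : ℕ} {q q' : k} (hq : IsPrimitiveRoot q n)

local notation "S" => antipode_bijective hq

section NeZero

variable [NeZero n]

include hq in
theorem pow_sub_one_eq_inv : q ^ (n - 1) = q⁻¹ :=
  eq_inv_of_mul_eq_one_left (by rw [pow_sub_one_mul (NeZero.ne n), hq.pow_eq_one])

theorem oppositeMul_dualH :
    oppositeMul k (Taft hq) (dualH hq) = dualPairing k (Taft hq) (dualH hq ⊗ₜ dualH hq) := by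
  refine WithConv.ofConv_injective <| TensorProduct.ext' fun a b => ?_
  rw [oppositeMul_tmul, dualPairing_tmul]
  simp [dualH, mul_comm]

theorem antipode_h_pow_sub_one : antipode k (h hq ^ (n - 1)) = h hq :=
  (left_inv_eq_right_inv (h_mul_inv hq)
    ((isGroupLikeElem_h hq).pow (n := n - 1)).mul_antipode_cancel).symm

theorem antipodeInv_h : antipodeInv (antipode_bijective hq) (h hq) = h hq ^ (n - 1) :=
  (antipode_bijective hq).1 <| by rw [antipode_antipodeInv, antipode_h_pow_sub_one]

theorem antipodeInv_x :
    antipodeInv (antipode_bijective hq) (x hq) = -(h hq ^ (n - 1) * x hq) :=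
  (antipode_bijective hq).1 <| by
    rw [antipode_antipodeInv, map_neg, antipode_mul_antidistrib, antipode_h_pow_sub_one, antipode_x,
      neg_mul, neg_neg, mul_assoc, inv_mul_h, mul_one]

theorem character_h_pow_sub_one : character hq (h hq ^ (n - 1)) = q := by
  rw [map_pow, character_h, inv_pow, pow_sub_one_eq_inv hq, inv_inv]

theorem coadj_h_h_dualH : coadj S (h hq) (h hq) (dualH hq) = dualH hq := by
  ext a
  rw [coadj_apply, antipodeInv_h]
  simp [dualH, -map_pow, character_h_pow_sub_one, mul_comm _ q⁻¹, hq.ne_zero (NeZero.ne n)]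

theorem coadj_one_h_dualH : coadj S 1 (h hq) (dualH hq) = q • dualH hq := by
  ext a
  rw [coadj_apply, antipodeInv_h]
  simp [dualH, -map_pow, character_h_pow_sub_one]

theorem coadj_x_h_dualH : coadj S (x hq) (h hq) (dualH hq) = 0 := by
  ext a
  simp [coadj_apply, dualH]

theorem coadj_one_x_dualH : coadj S 1 (x hq) (dualH hq) = 0 := by
  ext a
  simp [coadj_apply, dualH, antipodeInv_x]

end NeZero

variable [n.AtLeastTwo]

section ToDual

variable (hq' : IsPrimitiveRoot q' n) (hqq' : q' = q⁻¹)

theorem oppositeMul_dualX : oppositeMul k (Taft hq) (dualX hq) =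
    dualPairing k (Taft hq) (dualX hq ⊗ₜ dualH hq + 1 ⊗ₜ dualX hq) := by
  refine WithConv.ofConv_injective <| TensorProduct.ext' fun a b => ?_
  rw [map_add, oppositeMul_tmul, ofConv_add, LinearMap.add_apply, dualPairing_tmul,
    dualPairing_tmul]
  change -q⁻¹ * skewForm hq (b * a) = -q⁻¹ * skewForm hq a * character hq b +
    counit (R := k) a * (-q⁻¹ * skewForm hq b)
  rw [skewForm_mul]
  ring

theorem dualComulCop_toDual (a : Taft hq') :
    dualComulCop k (Taft hq) (toDual hq hq' hqq' a) =
      Algebra.TensorProduct.map (toDual hq hq' hqq') (toDual hq hq' hqq') (comul a) := by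
  have oppositeMul_comp_toDual : (oppositeMul k (Taft hq)).comp (toDual hq hq' hqq') =
      (dualPairing k (Taft hq)).comp ((Algebra.TensorProduct.map (toDual hq hq' hqq')
        (toDual hq hq' hqq')).comp (Bialgebra.comulAlgHom k (Taft hq'))) :=
    algHom_ext (by simp [comul_h, oppositeMul_dualH]) (by simp [comul_x, oppositeMul_dualX])
  exact dualPairing_injective <|
    (dualPairing_dualComulCop _).trans (DFunLike.congr_fun oppositeMul_comp_toDual a)

theorem toDual_apply_one (a : Taft hq') : toDual hq hq' hqq' a 1 = counit (R := k) a := by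
  have : (evalOne k (Taft hq)).comp (toDual hq hq' hqq') = Bialgebra.counitAlgHom k (Taft hq') :=
    algHom_ext (by simp [dualH, counit_h]) (by simp [dualX, counit_x])
  exact DFunLike.congr_fun this a

end ToDual

theorem coadj_h_h_dualX : coadj S (h hq) (h hq) (dualX hq) = q • dualX hq := by
  ext a
  rw [coadj_apply, antipodeInv_h]
  simp [dualX, -map_pow, character_h_pow_sub_one, skewForm_mul, counit_h,
    mul_left_comm q⁻¹]

theorem coadj_one_h_dualX : coadj S 1 (h hq) (dualX hq) = q • dualX hq := by
  ext a
  rw [coadj_apply, antipodeInv_h]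
  simp [dualX, -map_pow, character_h_pow_sub_one, skewForm_mul, mul_left_comm q⁻¹]

theorem coadj_x_h_dualX : coadj S (x hq) (h hq) (dualX hq) = -dualH hq := by
  ext a
  rw [coadj_apply, antipodeInv_h]
  simp [dualX, dualH, -map_pow, character_h_pow_sub_one, skewForm_mul, counit_x,
    hq.ne_zero (NeZero.ne n)]

theorem coadj_one_x_dualX : coadj S 1 (x hq) (dualX hq) = 1 := by
  ext a
  rw [coadj_apply, antipodeInv_x]
  simp [dualX, -map_pow, character_h_pow_sub_one, skewForm_mul, hq.ne_zero (NeZero.ne n)]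

theorem double_relations : BicrossRelations (B := DrinfeldDouble S) n n q (q ^ (n - 1)) q 1
    (DrinfeldDouble.inr S (h hq)) (DrinfeldDouble.inr S (x hq))
    (DrinfeldDouble.inl S (dualH hq)) (DrinfeldDouble.inl S (dualX hq)) where
  h_pow := by rw [← map_pow, h_pow, map_one]
  H_pow := by rw [← map_pow, dualH_pow_eq_one, map_one]
  x_pow := by rw [← map_pow, x_pow, map_zero]
  X_pow := by rw [← map_pow, dualX_pow_eq_zero, map_zero]
  xh := by rw [← map_mul, xh, map_smul, map_mul]
  XH := by rw [← map_mul, dualX_mul_dualH, map_smul, map_mul, pow_sub_one_eq_inv hq]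
  xH := by
    rw [DrinfeldDouble.inr_mul_inl_of_isSkewPrimitive _ (isGroupLikeElem_h hq)
      (isSkewPrimitive_x hq), coadj_x_h_dualH, coadj_one_h_dualH, coadj_one_x_dualH, map_zero,
      zero_mul, zero_add, add_zero, map_smul, smul_mul_assoc]
  hX := by
    rw [DrinfeldDouble.inr_mul_inl_of_isGroupLikeElem _ (isGroupLikeElem_h hq), coadj_h_h_dualX,
      map_smul, smul_mul_assoc]
  xX := by
    rw [DrinfeldDouble.inr_mul_inl_of_isSkewPrimitive _ (isGroupLikeElem_h hq)
      (isSkewPrimitive_x hq), coadj_x_h_dualX, coadj_one_h_dualX, coadj_one_x_dualX, map_neg,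
      neg_mul, map_smul, smul_mul_assoc, map_one, one_smul]
    abel
  hH := by
    rw [DrinfeldDouble.inr_mul_inl_of_isGroupLikeElem _ (isGroupLikeElem_h hq), coadj_h_h_dualH]

end Taft

/-- Isomorphic Hopf algebras have isomorphic automorphism groups. -/
def hopfAutCongr {k A B : Type*} [CommSemiring k] [Semiring A] [Algebra k A] [CoalgebraStruct k A]
    [Semiring B] [Algebra k B] [CoalgebraStruct k B] (e : A ≃ₐc[k] B) :
    HopfAut k A ≃* HopfAut k B where
  toFun φ := (e.symm.trans φ).trans e
  invFun ψ := (e.trans ψ).trans e.symm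
  left_inv φ := BialgEquiv.ext fun a =>
    (e.symm_apply_apply _).trans (congrArg φ (e.symm_apply_apply a))
  right_inv ψ := BialgEquiv.ext fun b =>
    (e.apply_symm_apply _).trans (congrArg ψ (e.apply_symm_apply b))
  map_mul' φ ψ := BialgEquiv.ext fun b =>
    congrArg (fun a => e (φ a)) (e.symm_apply_apply (ψ (e.symm b))).symm

namespace Taft

variable {k : Type*} [Field k] {n : ℕ} {q : k} (hq : IsPrimitiveRoot q n) [n.AtLeastTwo]

local notation "S" => antipode_bijective hq
local notation "hqi" => isPrimitiveRoot_pow_sub_one hq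
local notation "δ" => toDual hq hqi (pow_sub_one_eq_inv hq)

/-- The algebra map from `Q^1_n(q)` to the Drinfeld double. -/
noncomputable def toDouble : TaftQ hq 1 →ₐ[k] DrinfeldDouble S :=
  Bicross.lift (double_relations hq)

theorem toDouble_inl (a : Taft hqi) :
    toDouble hq (Bicross.inl a) = DrinfeldDouble.inl S (δ a) := by
  have : (toDouble hq).comp (Bicross.inl : Taft hqi →ₐc[k] TaftQ hq 1) =
      (DrinfeldDouble.inl S).comp δ :=
    algHom_ext (by simp [toDouble]) (by simp [toDouble])
  exact DFunLike.congr_fun this a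

theorem toDouble_inr (b : Taft hq) : toDouble hq (Bicross.inr b) = DrinfeldDouble.inr S b := by
  have : (toDouble hq).comp (Bicross.inr : Taft hq →ₐc[k] TaftQ hq 1) = DrinfeldDouble.inr S :=
    algHom_ext (by simp [toDouble]) (by simp [toDouble])
  exact DFunLike.congr_fun this b

/-- The coalgebra isomorphism of the tensor product of two Taft algebras with the Drinfeld double
given by the isomorphism `toDual` of the first one with the dual of the second one. -/
noncomputable def tensorEquivDouble : Taft hqi ⊗[k] Taft hq ≃ₗc[k] DrinfeldDouble S where
  toLinearEquiv := TensorProduct.congr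
    (LinearEquiv.ofBijective (δ).toLinearMap (toDual_bijective hq _ _)) (LinearEquiv.refl k _)
  counit_comp := TensorProduct.ext' fun a b => by
    change δ a 1 * counit (R := k) b = counit (R := k) b * counit a
    rw [toDual_apply_one, mul_comm]
  map_comp_comul := TensorProduct.ext' fun a b => by
    have naturality := LinearMap.congr_fun (TensorProduct.tensorTensorTensorComm_comp_map k
      (δ).toLinearMap (δ).toLinearMap LinearMap.id (LinearMap.id : Taft hq →ₗ[k] _))
      (comul a ⊗ₜ comul b)
    refine naturality.symm.trans ?_
    rw [LinearMap.comp_apply, TensorProduct.map_tmul, TensorProduct.map_id]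
    exact congrArg (fun s => TensorProduct.tensorTensorTensorComm k _ _ _ _ (s ⊗ₜ comul b))
      (dualComulCop_toDual hq hqi (pow_sub_one_eq_inv hq) a).symm

theorem toDouble_mulCoalgHom (z : Taft hqi ⊗[k] Taft hq) :
    toDouble hq (Bicross.mulCoalgHom hqi hq q 1 z) = tensorEquivDouble hq z := by
  induction z with
  | zero => simp only [map_zero]
  | add z w hz hw => simp only [map_add, hz, hw]
  | tmul a b =>
    rw [Bicross.mulCoalgHom_tmul, map_mul, toDouble_inl, toDouble_inr, DrinfeldDouble.inl_mul_inr]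
    rfl

theorem mulCoalgHom_one_injective : Function.Injective (Bicross.mulCoalgHom hqi hq q 1) :=
  .of_comp (f := toDouble hq) <| by
    convert (tensorEquivDouble hq).injective
    exact funext (toDouble_mulCoalgHom hq)

/-- The Drinfeld double of a Taft algebra is `Q^1_n(q)`. -/
noncomputable def taftQEquivDouble : TaftQ hq 1 ≃ₐc[k] DrinfeldDouble S :=
  let mulEquiv := CoalgEquiv.ofBijective (f := Bicross.mulCoalgHom hqi hq q 1)
    ⟨mulCoalgHom_one_injective hq, Bicross.mulCoalgHom_surjective⟩
  have toDouble_eq (b : TaftQ hq 1) :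
      toDouble hq b = tensorEquivDouble hq (mulEquiv.symm b) := by
    rw [← toDouble_mulCoalgHom]
    exact congrArg (toDouble hq) (mulEquiv.apply_symm_apply b).symm
  { mulEquiv.symm.trans (tensorEquivDouble hq) with
    map_mul' a b := by
      change tensorEquivDouble hq (mulEquiv.symm (a * b)) =
        tensorEquivDouble hq (mulEquiv.symm a) * tensorEquivDouble hq (mulEquiv.symm b)
      rw [← toDouble_eq, ← toDouble_eq, ← toDouble_eq, map_mul] }

end Taft

namespace Bicross

variable {k : Type*} [Field k]

/-- The scalings of `T^σ_{n,m}` are unrestricted. -/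
def scalingGroupZeroEquiv : kˣ × kˣ ≃* scalingGroup (0 : k) :=
  Subgroup.topEquiv.symm.trans <|
    MulEquiv.subgroupCongr (eq_top_iff.2 fun _ _ => mem_scalingGroup.2 (zero_mul _)).symm

/-- The scalings of `Q^1_n(q)` are the pairs `(c, c⁻¹)`. -/
def scalingGroupOneEquiv : kˣ ≃* scalingGroup (1 : k) where
  toFun c := ⟨(c, c⁻¹), mem_scalingGroup.2 (by simp)⟩
  invFun p := p.1.1
  left_inv _ := rfl
  right_inv p := Subtype.ext <| Prod.ext rfl <| inv_eq_of_mul_eq_one_right <| Units.ext <| by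
    simpa using mem_scalingGroup.1 p.2
  map_mul' a b := Subtype.ext (Prod.ext rfl (mul_inv a b))

theorem nonempty_hopfAut_taftT {m n : ℕ} [m.AtLeastTwo] [n.AtLeastTwo] {q q' σ : k}
    (hq : IsPrimitiveRoot q m) (hq' : IsPrimitiveRoot q' n) (hσm : σ ^ m = 1) (hσn : σ ^ n = 1)
    (hqσ : q ≠ q' ∨ σ ^ 2 ≠ 1) : Nonempty (HopfAut k (TaftT hq' hq σ) ≃* kˣ × kˣ) :=
  (nonempty_hopfAut_mulEquiv (mulCoalgHom_injective hq' hq hσm hσn) hqσ).map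
    (·.trans scalingGroupZeroEquiv.symm)

variable {n : ℕ} {q : k} (hq : IsPrimitiveRoot q n)

theorem nonempty_hopfAut_taftT_semidirect [n.AtLeastTwo] {σ : k} (hσn : σ ^ n = 1)
    (hσ : σ ^ 2 = 1) : Nonempty (HopfAut k (TaftT hq hq σ) ≃*
      (kˣ × kˣ) ⋊[swapAction kˣ] Multiplicative (ZMod 2)) :=
  nonempty_hopfAut_mulEquiv_semidirect (mulCoalgHom_injective hq hq hσn hσn) rfl hσ (by simp)
    scalingGroupZeroEquiv _ fun _ => rfl

theorem nonempty_hopfAut_taftQ [NeZero n] (hn : 3 ≤ n) :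
    Nonempty (HopfAut k (TaftQ hq 1) ≃* kˣ) :=
  have : n.AtLeastTwo := ⟨Nat.le_of_succ_le hn⟩
  (nonempty_hopfAut_mulEquiv (Taft.mulCoalgHom_one_injective hq)
    (.inr (hq.pow_ne_one_of_pos_of_lt two_ne_zero hn))).map (·.trans scalingGroupOneEquiv.symm)

theorem nonempty_hopfAut_taftQ_semidirect [NeZero n] (hn : n = 2) :
    Nonempty (HopfAut k (TaftQ hq 1) ≃* kˣ ⋊[invAction kˣ] Multiplicative (ZMod 2)) := by
  have : n.AtLeastTwo := ⟨hn.ge⟩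
  have q_eq : q = -1 := (hn ▸ hq).eq_neg_one_of_two_right
  exact nonempty_hopfAut_mulEquiv_semidirect (Taft.mulCoalgHom_one_injective hq)
    (by rw [hn, pow_one]) (hn ▸ hq.pow_eq_one) (by rw [q_eq, mul_one])
    scalingGroupOneEquiv _ fun c => Prod.ext rfl (inv_inv c)

theorem nonempty_hopfAut_double [NeZero n] (hn : 3 ≤ n) :
    Nonempty (HopfAut k (DrinfeldDouble (Taft.antipode_bijective hq)) ≃* kˣ) :=
  have : n.AtLeastTwo := ⟨Nat.le_of_succ_le hn⟩
  (nonempty_hopfAut_taftQ hq hn).map ((hopfAutCongr (Taft.taftQEquivDouble hq)).symm.trans ·)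

theorem nonempty_hopfAut_double_semidirect [NeZero n] (hn : n = 2) :
    Nonempty (HopfAut k (DrinfeldDouble (Taft.antipode_bijective hq)) ≃*
      kˣ ⋊[invAction kˣ] Multiplicative (ZMod 2)) :=
  have : n.AtLeastTwo := ⟨hn.ge⟩
  (nonempty_hopfAut_taftQ_semidirect hq hn).map
    ((hopfAutCongr (Taft.taftQEquivDouble hq)).symm.trans ·)

end Bicross

end TaftBicrossed

theorem mainTheorem5_general {k : Type*} [Field k] :
    (∀ (m n : ℕ) [NeZero m] [NeZero n], 2 ≤ m → 2 ≤ n → m ≠ n →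
      ∀ (q q' σ : k) (hq : IsPrimitiveRoot q m) (hq' : IsPrimitiveRoot q' n),
        σ ^ Nat.gcd m n = 1 →
          Nonempty (TaftBicrossed.HopfAut k (TaftBicrossed.TaftT hq' hq σ) ≃* kˣ × kˣ)) ∧
    (∀ (n : ℕ) [NeZero n], 2 ≤ n →
      ∀ (q q' σ : k) (hq : IsPrimitiveRoot q n) (hq' : IsPrimitiveRoot q' n),
        σ ^ n = 1 → q ≠ q' →
          Nonempty (TaftBicrossed.HopfAut k (TaftBicrossed.TaftT hq' hq σ) ≃* kˣ × kˣ)) ∧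
    (∀ (n : ℕ) [NeZero n], 2 ≤ n →
      ∀ (q σ : k) (hq : IsPrimitiveRoot q n), σ ^ n = 1 →
        (σ ^ 2 ≠ 1 →
          Nonempty (TaftBicrossed.HopfAut k (TaftBicrossed.TaftT hq hq σ) ≃* kˣ × kˣ)) ∧
        (σ ^ 2 = 1 →
          Nonempty (TaftBicrossed.HopfAut k (TaftBicrossed.TaftT hq hq σ) ≃*
            (kˣ × kˣ) ⋊[TaftBicrossed.swapAction kˣ] Multiplicative (ZMod 2)))) ∧
    (∀ (n : ℕ) [NeZero n] (q : k) (hq : IsPrimitiveRoot q n),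
        (3 ≤ n →
          Nonempty (TaftBicrossed.HopfAut k (TaftBicrossed.TaftQ hq 1) ≃* kˣ)) ∧
        (n = 2 →
          Nonempty (TaftBicrossed.HopfAut k (TaftBicrossed.TaftQ hq 1) ≃*
            kˣ ⋊[TaftBicrossed.invAction kˣ] Multiplicative (ZMod 2)))) ∧
    (∀ (n : ℕ) [NeZero n] (q : k) (hq : IsPrimitiveRoot q n),
        (3 ≤ n →
          Nonempty (TaftBicrossed.HopfAut k
            (TaftBicrossed.DrinfeldDouble (TaftBicrossed.Taft.antipode_bijective hq)) ≃* kˣ)) ∧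
        (n = 2 →
          Nonempty (TaftBicrossed.HopfAut k
            (TaftBicrossed.DrinfeldDouble (TaftBicrossed.Taft.antipode_bijective hq)) ≃*
              kˣ ⋊[TaftBicrossed.invAction kˣ] Multiplicative (ZMod 2)))) := by
  open TaftBicrossed Bicross in
  refine ⟨?_, ?_, ?_, ?_, ?_⟩
  · intro m n _ _ hm hn hmn q q' σ hq hq' hσ
    have : m.AtLeastTwo := ⟨hm⟩
    have : n.AtLeastTwo := ⟨hn⟩
    have hqq' : q ≠ q' := by
      rintro rfl
      exact hmn (hq.unique hq')
    obtain ⟨hσm, hσn⟩ := pow_gcd_eq_one.1 hσ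
    exact nonempty_hopfAut_taftT hq hq' hσm hσn (.inl hqq')
  · intro n _ hn q q' σ hq hq' hσ hqq'
    have : n.AtLeastTwo := ⟨hn⟩
    exact nonempty_hopfAut_taftT hq hq' hσ hσ (.inl hqq')
  · intro n _ hn q σ hq hσ
    have : n.AtLeastTwo := ⟨hn⟩
    exact ⟨fun hσ2 => nonempty_hopfAut_taftT hq hq hσ hσ (.inr hσ2),
      nonempty_hopfAut_taftT_semidirect hq hσ⟩
  · exact fun n _ q hq => ⟨nonempty_hopfAut_taftQ hq, nonempty_hopfAut_taftQ_semidirect hq⟩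
  · exact fun n _ q hq => ⟨nonempty_hopfAut_double hq, nonempty_hopfAut_double_semidirect hq⟩

theorem mainTheorem5 {k : Type*} [Field k] [CharZero k] :
    (∀ (m n : ℕ) [NeZero m] [NeZero n], 2 ≤ m → 2 ≤ n → m ≠ n →
      ∀ (q q' σ : k) (hq : IsPrimitiveRoot q m) (hq' : IsPrimitiveRoot q' n),
        σ ^ Nat.gcd m n = 1 →
          Nonempty (TaftBicrossed.HopfAut k (TaftBicrossed.TaftT hq' hq σ) ≃* kˣ × kˣ)) ∧
    (∀ (n : ℕ) [NeZero n], 2 ≤ n →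
      ∀ (q q' σ : k) (hq : IsPrimitiveRoot q n) (hq' : IsPrimitiveRoot q' n),
        σ ^ n = 1 → q ≠ q' →
          Nonempty (TaftBicrossed.HopfAut k (TaftBicrossed.TaftT hq' hq σ) ≃* kˣ × kˣ)) ∧
    (∀ (n : ℕ) [NeZero n], 2 ≤ n →
      ∀ (q σ : k) (hq : IsPrimitiveRoot q n), σ ^ n = 1 →
        (σ ^ 2 ≠ 1 →
          Nonempty (TaftBicrossed.HopfAut k (TaftBicrossed.TaftT hq hq σ) ≃* kˣ × kˣ)) ∧
        (σ ^ 2 = 1 →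
          Nonempty (TaftBicrossed.HopfAut k (TaftBicrossed.TaftT hq hq σ) ≃*
            (kˣ × kˣ) ⋊[TaftBicrossed.swapAction kˣ] Multiplicative (ZMod 2)))) ∧
    (∀ (n : ℕ) [NeZero n], 2 ≤ n → ∀ (q : k) (hq : IsPrimitiveRoot q n),
        (3 ≤ n →
          Nonempty (TaftBicrossed.HopfAut k (TaftBicrossed.TaftQ hq 1) ≃* kˣ)) ∧
        (n = 2 →
          Nonempty (TaftBicrossed.HopfAut k (TaftBicrossed.TaftQ hq 1) ≃*
            kˣ ⋊[TaftBicrossed.invAction kˣ] Multiplicative (ZMod 2)))) ∧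
    (∀ (n : ℕ) [NeZero n], 2 ≤ n → ∀ (q : k) (hq : IsPrimitiveRoot q n),
        (3 ≤ n →
          Nonempty (TaftBicrossed.HopfAut k
            (TaftBicrossed.DrinfeldDouble (TaftBicrossed.Taft.antipode_bijective hq)) ≃* kˣ)) ∧
        (n = 2 →
          Nonempty (TaftBicrossed.HopfAut k
            (TaftBicrossed.DrinfeldDouble (TaftBicrossed.Taft.antipode_bijective hq)) ≃*
              kˣ ⋊[TaftBicrossed.invAction kˣ] Multiplicative (ZMod 2)))) := by
  obtain ⟨taftT_ne, taftT_ne', taftT_eq, taftQ, double⟩ := mainTheorem5_general (k := k)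
  exact ⟨taftT_ne, taftT_ne', taftT_eq, fun n _ _ => taftQ n, fun n _ _ => double n⟩
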